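/- Let $n\ge 2$, let $G=\mathrm{GL}_n(q)$ be the general linear group over the finite field $F_q$ of characteristic $p$, let $\ell\ne p$ be a prime, and let $R$ be a local principal ideal domain of characteristic $0$ with maximal ideal $\ell R$ that contains a primitive $p$-th root of unity; put $K=R/\ell R$. Let $B$ be the upper triangular subgroup of $G$, let $I$ be the left ideal of $RG$ generated by $\sum_{\sigma\in S_n}\mathrm{sg}(\sigma)\,\sigma\sum_{b\in B}b$ (permutations being viewed as permutation matrices), and let $L$ be the $KG$-module $I/\ell I$. Let $f:I\times I\to R$ be $1/|B|$ times the restriction to $I$ of the bilinear form on $RG$ with $(g,h)\mapsto\delta_{g,h}$ for $g,h\in G$. For $c\ge 0$ put $I(c)=\{x\in I: f(x,I)\subseteq \ell^cR\}$ and $L(c)=(I(c)+\ell I)/\ell I$, so that $L=L(0)\supseteq L(1)\supseteq L(2)\supseteq\cdots$ (the Gow filtration). A standard parabolic subgroup is a subgroup of $G$ containing $B$. Let $V$ be the number of different values $\nu_\ell([G:P])$ for $P$ a standard parabolic subgroup, choose standard parabolic subgroups $P_0,\dots,P_{V-1}$ with $\nu_\ell([G:P_0])>\cdots>\nu_\ell([G:P_{V-1}])$,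 and put $L(P_i)=L(\nu_\ell([G:P_i]))$. Let $e=\min\{i\ge 2 : \ell \text{ divides } (q^i-1)/(q-1)\}$. Call a module uniserial if its submodules are totally ordered by inclusion. Then: (a) If $\lfloor n/e\rfloor\le\ell$, then $L$ is uniserial and its only composition series is the Gow filtration with repeated terms deleted. (b) If $\lfloor n/e\rfloor>\ell$, then $V>\ell$, and the first $\ell+1$ nonzero terms $\mathrm{soc}^1(L),\dots,\mathrm{soc}^{\ell+1}(L)$ of the socle series of $L$ are $L(P_0),\dots,L(P_\ell)$, respectively. Moreover, $0\subset L(P_0)\subset\cdots\subset L(P_\ell)$ is a composition series of $L(P_\ell)$. In particular, $L(P_\ell)$ is uniserial of length $\ell+1$, and with $c_i=\nu_\ell([G:P_i])$ the factors $L(c_i)/L(c_i+1)$, $0\le i\le\ell$, are irreducible. -/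

import Mathlib

noncomputable section

/-! ## Uniserial modules and the socle series -/

/-- A module is uniserial if its submodules are totally ordered by inclusion. -/
def IsUniserial (A M : Type*) [Ring A] [AddCommGroup M] [Module A M] : Prop :=
  ∀ N₁ N₂ : Submodule A M, N₁ ≤ N₂ ∨ N₂ ≤ N₁

/-- The socle of a module: the sum of all its simple submodules. -/
def moduleSocle (A M : Type*) [Ring A] [AddCommGroup M] [Module A M] : Submodule A M :=
  sSup {N : Submodule A M | IsSimpleModule A N}

/-- The socle series: `soc⁰ = 0`, and `socᵏ⁺¹ / socᵏ` is the socle of `M / socᵏ`. -/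
def socleSeries (A M : Type*) [Ring A] [AddCommGroup M] [Module A M] : ℕ → Submodule A M
  | 0 => ⊥
  | k + 1 => (moduleSocle A (M ⧸ socleSeries A M k)).comap (socleSeries A M k).mkQ

namespace Steinberg

open Matrix MonoidAlgebra

/-! ## The general linear group, its Borel subgroup, and the standard parabolic subgroups -/

section Group

variable (n : ℕ) (F : Type*) [Field F]

/-- The upper triangular subgroup `B` of `GL_n(F)`. -/
def borel : Subgroup (GL (Fin n) F) where
  carrier := {g | ∀ i j : Fin n, j < i → (g : Matrix (Fin n) (Fin n) F) i j = 0}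
  one_mem' := fun i j hij => by simp [hij.ne']
  mul_mem' := by
    intro a b ha hb
    have ha' : (a : Matrix (Fin n) (Fin n) F).BlockTriangular id := fun i j h => ha i j h
    have hb' : (b : Matrix (Fin n) (Fin n) F).BlockTriangular id := fun i j h => hb i j h
    intro i j h
    exact ha'.mul hb' h
  inv_mem' := by
    intro a ha
    have ha' : (a : Matrix (Fin n) (Fin n) F).BlockTriangular id := fun i j h => ha i j h
    intro i j h
    have : Invertible (a : Matrix (Fin n) (Fin n) F) := a.invertible
    have := Matrix.blockTriangular_inv_of_blockTriangular ha' h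
    rwa [← Matrix.coe_units_inv] at this

instance [DecidableEq F] : DecidablePred (· ∈ borel n F) := fun g =>
  haveI : ∀ i j : Fin n, Decidable ((g : Matrix (Fin n) (Fin n) F) i j = 0) := fun i j =>
    inferInstanceAs (Decidable ((g.val i j : F) = 0))
  inferInstanceAs
    (Decidable (∀ i j : Fin n, j < i → (g : Matrix (Fin n) (Fin n) F) i j = 0))

/-- The set `𝒫` of standard parabolic subgroups, i.e. the subgroups of `GL_n(F)` containing `B`. -/
abbrev StdParabolic : Type _ := {P : Subgroup (GL (Fin n) F) // borel n F ≤ P}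

variable {n F} in
/-- `ϑ(P) = ν_ℓ([G : P])`. -/
def theta (ℓ : ℕ) (P : StdParabolic n F) : ℕ := padicValNat ℓ (P : Subgroup (GL (Fin n) F)).index

/-- The set of `𝒫`-values. -/
def pValues (ℓ : ℕ) : Set ℕ := Set.range (theta (n := n) (F := F) ℓ)

/-- The total number `V` of `𝒫`-values. -/
def numPValues (ℓ : ℕ) : ℕ := (pValues n F ℓ).ncard

/-- Standard parabolic subgroups `P_0, …, P_{V-1}` with `ϑ(P_0) > ⋯ > ϑ(P_{V-1})` exist. -/
theorem exists_strictAnti_theta [Finite F] (ℓ : ℕ) :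
    ∃ P : Fin (numPValues n F ℓ) → StdParabolic n F, StrictAnti fun i => theta ℓ (P i) := by
  have hfin : (pValues n F ℓ).Finite := Set.finite_range _
  have hc : hfin.toFinset.card = numPValues n F ℓ :=
    (Set.ncard_eq_toFinset_card _ hfin).symm
  have h : ∀ i : Fin (numPValues n F ℓ), ∃ P : StdParabolic n F,
      theta ℓ P = hfin.toFinset.orderEmbOfFin hc i.rev := by
    intro i
    have := Finset.orderEmbOfFin_mem hfin.toFinset hc i.rev
    rw [Set.Finite.mem_toFinset] at this
    exact this
  choose P hP using h
  refine ⟨P, fun i j hij => ?_⟩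
  simp only [hP]
  exact (hfin.toFinset.orderEmbOfFin hc).strictMono (Fin.rev_lt_rev.mpr hij)

variable {n} in
/-- The permutation matrix of `σ`, with `σ e_j = e_{σ(j)}`. -/
def permGL (σ : Equiv.Perm (Fin n)) : GL (Fin n) F where
  val := Matrix.of fun i j => if i = σ j then 1 else 0
  inv := Matrix.of fun i j => if σ i = j then 1 else 0
  val_inv := by
    ext i j
    rw [Matrix.mul_apply, Finset.sum_eq_single (σ.symm i)]
    · simp [Matrix.one_apply]
    · intro k _ hk
      have : i ≠ σ k := fun h => hk (by simp [h])
      simp [this]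
    · simp
  inv_val := by
    ext i j
    simp [Matrix.mul_apply, Matrix.one_apply]

end Group

/-- `e = min {i ≥ 2 : ℓ ∣ (q^i - 1)/(q - 1)}`. -/
def eNumber (q ℓ : ℕ) : ℕ := sInf {i : ℕ | 2 ≤ i ∧ ℓ ∣ (q ^ i - 1) / (q - 1)}

/-! ## The Steinberg lattice -/

section Lattice

variable (n : ℕ) (F R : Type*) [Field F] [Fintype F] [DecidableEq F] [CommRing R]

/-- The group algebra `RG` of `G = GL_n(F)`. -/
abbrev GroupAlg : Type _ := MonoidAlgebra R (GL (Fin n) F)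

/-- The element `∑_{σ ∈ S_n} sg(σ) σ ∑_{b ∈ B} b` of the group algebra. -/
def steinbergElt : GroupAlg n F R :=
  ∑ σ : Equiv.Perm (Fin n), ∑ b : borel n F,
    MonoidAlgebra.single (permGL F σ * (b : GL (Fin n) F)) (((Equiv.Perm.sign σ : ℤˣ) : ℤ) : R)

/-- The Steinberg lattice `I`: the left ideal of `RG` generated by `steinbergElt`. -/
def lattice : Submodule (GroupAlg n F R) (GroupAlg n F R) :=
  Submodule.span (GroupAlg n F R) {steinbergElt n F R}

variable {n F R}

/-- The coefficient functions of the elements of `I` are constant on the left cosets of `B`. -/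
theorem coeff_mul_borel (x : lattice n F R) (g b : GL (Fin n) F) (hb : b ∈ borel n F) :
    (x : GroupAlg n F R).coeff (g * b) = (x : GroupAlg n F R).coeff g := by
  have hu : steinbergElt n F R * (MonoidAlgebra.single b⁻¹ 1 : GroupAlg n F R) = steinbergElt n F R := by
    simp only [steinbergElt, Finset.sum_mul]
    refine Finset.sum_congr rfl fun σ _ => ?_
    refine Fintype.sum_equiv (Equiv.mulRight (⟨b, hb⟩⁻¹ : borel n F)) _ _ fun c => ?_
    simp [MonoidAlgebra.single_mul_single, mul_assoc]
  have hx : (x : GroupAlg n F R) * (MonoidAlgebra.single b⁻¹ 1 : GroupAlg n F R) =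
      (x : GroupAlg n F R) := by
    obtain ⟨a, ha⟩ := Submodule.mem_span_singleton.mp x.2
    rw [← ha, smul_eq_mul, mul_assoc, hu]
  conv_rhs => rw [← hx]
  rw [MonoidAlgebra.coeff_mul_single_apply]
  simp

variable (n F R) in
/-- The form `f` on `I`: the form `(g, h) ↦ δ_{g,h}` on `RG`, restricted to `I` and scaled by
`1 / |B|`. As `I` consists of functions on `G` that are constant on the cosets `gB`, this is the
sum of `x(g) y(g)` over representatives of these cosets; see `card_mul_gowForm`. -/
def gowForm : LinearMap.BilinForm R (lattice n F R) :=
  LinearMap.mk₂ R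
    (fun x y => ∑ c : GL (Fin n) F ⧸ borel n F,
      (x : GroupAlg n F R).coeff c.out * (y : GroupAlg n F R).coeff c.out)
    (fun x x' y => by simp [add_mul, Finset.sum_add_distrib])
    (fun r x y => by simp [Finset.mul_sum, mul_assoc])
    (fun x y y' => by simp [mul_add, Finset.sum_add_distrib])
    (fun r x y => by simp [Finset.mul_sum, mul_left_comm])

theorem gowForm_apply (x y : lattice n F R) :
    gowForm n F R x y = ∑ c : GL (Fin n) F ⧸ borel n F,
      (x : GroupAlg n F R).coeff c.out * (y : GroupAlg n F R).coeff c.out := rfl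

theorem coeff_eq_of_mk_eq (x : lattice n F R) {g h : GL (Fin n) F}
    (hgh : (g : GL (Fin n) F ⧸ borel n F) = h) :
    (x : GroupAlg n F R).coeff g = (x : GroupAlg n F R).coeff h := by
  have := coeff_mul_borel x g (g⁻¹ * h) (QuotientGroup.eq.mp hgh)
  simpa using this.symm

/-- `|B| f(x, y)` is the standard form `∑_g x_g y_g` of `RG`. -/
theorem card_mul_gowForm (x y : lattice n F R) :
    (Nat.card (borel n F) : R) * gowForm n F R x y =
      ∑ g : GL (Fin n) F, (x : GroupAlg n F R).coeff g * (y : GroupAlg n F R).coeff g := by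
  have h := (Finset.sum_fiberwise (Finset.univ : Finset (GL (Fin n) F))
    (fun g => (g : GL (Fin n) F ⧸ borel n F))
    (fun g => (x : GroupAlg n F R).coeff g * (y : GroupAlg n F R).coeff g)).symm
  rw [h, gowForm_apply, Finset.mul_sum]
  refine Finset.sum_congr rfl fun c _ => ?_
  have hc : ∀ g ∈ (Finset.univ : Finset (GL (Fin n) F)).filter
      (fun g : GL (Fin n) F => (QuotientGroup.mk g : GL (Fin n) F ⧸ borel n F) = c),
      (x : GroupAlg n F R).coeff g * (y : GroupAlg n F R).coeff g =
        (x : GroupAlg n F R).coeff c.out * (y : GroupAlg n F R).coeff c.out := by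
    intro g hg
    have hg' : (g : GL (Fin n) F ⧸ borel n F) = (c.out : GL (Fin n) F) := by
      rw [QuotientGroup.out_eq']; exact (Finset.mem_filter.mp hg).2
    rw [coeff_eq_of_mk_eq x hg', coeff_eq_of_mk_eq y hg']
  rw [Finset.sum_congr rfl hc, Finset.sum_const, nsmul_eq_mul]
  congr 2
  rw [Nat.card_eq_fintype_card, Fintype.card]
  refine Finset.card_bij (fun b _ => c.out * (b : GL (Fin n) F)) ?_ ?_ ?_
  · intro b _
    refine Finset.mem_filter.mpr ⟨Finset.mem_univ _, ?_⟩
    rw [QuotientGroup.mk_mul_of_mem _ b.2, QuotientGroup.out_eq']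
  · intro b _ b' _ hbb
    exact Subtype.ext (mul_left_cancel hbb)
  · intro g hg
    have hg' : (c.out : GL (Fin n) F) = (g : GL (Fin n) F ⧸ borel n F) := by
      rw [QuotientGroup.out_eq']; exact (Finset.mem_filter.mp hg).2.symm
    exact ⟨⟨c.out⁻¹ * g, QuotientGroup.eq.mp hg'⟩, Finset.mem_univ _, by simp⟩

/-- The form `f` is `G`-invariant. -/
theorem gowForm_single_smul (g : GL (Fin n) F) (r : R) (x y : lattice n F R) :
    gowForm n F R ((MonoidAlgebra.single g r : GroupAlg n F R) • x) y =
      r * gowForm n F R x ((MonoidAlgebra.single g⁻¹ 1 : GroupAlg n F R) • y) := by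
  rw [gowForm_apply, gowForm_apply, Finset.mul_sum]
  refine Fintype.sum_equiv (MulAction.toPerm g⁻¹) _ _ fun c => ?_
  have key : ((g⁻¹ * c.out : GL (Fin n) F) : GL (Fin n) F ⧸ borel n F) =
      ((g⁻¹ • c).out : GL (Fin n) F) := by
    rw [QuotientGroup.out_eq']
    conv_rhs => rw [← QuotientGroup.out_eq' c]
    rfl
  have hx := coeff_eq_of_mk_eq x key
  have hy : (y : GroupAlg n F R).coeff c.out =
      (y : GroupAlg n F R).coeff (g * (g⁻¹ • c).out) := by
    refine coeff_eq_of_mk_eq y ?_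
    have : ((g * (g⁻¹ • c).out : GL (Fin n) F) : GL (Fin n) F ⧸ borel n F) =
        g • (((g⁻¹ • c).out : GL (Fin n) F) : GL (Fin n) F ⧸ borel n F) := rfl
    rw [this, QuotientGroup.out_eq', QuotientGroup.out_eq', smul_inv_smul]
  simp [MonoidAlgebra.coeff_single_mul_apply, hx, hy, mul_assoc]

variable (n F R) in
/-- The `RG`-submodule `I(c) = {x ∈ I : f(x, I) ⊆ ℓ^c R}` of `I`. -/
def latticeFiltration (ℓ c : ℕ) : Submodule (GroupAlg n F R) (lattice n F R) where
  carrier := {x | ∀ y : lattice n F R, gowForm n F R x y ∈ Ideal.span {(ℓ : R) ^ c}}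
  zero_mem' := fun y => by simp
  add_mem' := fun hx hx' y => by
    rw [map_add, LinearMap.add_apply]; exact Ideal.add_mem _ (hx y) (hx' y)
  smul_mem' := by
    intro a x hx
    induction a using MonoidAlgebra.induction_linear with
    | zero => intro y; simp
    | add a a' ha ha' =>
      intro y
      rw [add_smul, map_add, LinearMap.add_apply]
      exact Ideal.add_mem _ (ha y) (ha' y)
    | single g r =>
      intro y
      rw [gowForm_single_smul]
      exact Ideal.mul_mem_left _ _ (hx _)

/-! ## The reduction modulo `ℓ` -/

variable (n F R) (ℓ : ℕ)

/-- `K = R / ℓR`. -/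
abbrev ResField (R : Type*) [CommRing R] (ℓ : ℕ) : Type _ := R ⧸ Ideal.span {(ℓ : R)}

/-- The `K`-module `I / ℓI`. -/
abbrev ReductionSpace : Type _ :=
  lattice n F R ⧸ (Ideal.span {(ℓ : R)} • ⊤ : Submodule R (lattice n F R))

/-- Left multiplication by `g ∈ G` on `I`, as an `R`-linear map. -/
def leftMul (g : GL (Fin n) F) : lattice n F R →ₗ[R] lattice n F R where
  toFun x := (MonoidAlgebra.single g 1 : GroupAlg n F R) • x
  map_add' := smul_add _
  map_smul' r x := smul_comm _ r x

theorem leftMul_one (x : lattice n F R) : leftMul n F R 1 x = x :=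
  one_smul (GroupAlg n F R) x

theorem leftMul_mul (g h : GL (Fin n) F) (x : lattice n F R) :
    leftMul n F R (g * h) x = leftMul n F R g (leftMul n F R h x) := by
  simp [leftMul, smul_smul, MonoidAlgebra.single_mul_single]

/-- The `R`-linear map induced on `I / ℓI` by left multiplication by `g ∈ G`. -/
def reductionMap (g : GL (Fin n) F) : ReductionSpace n F R ℓ →ₗ[R] ReductionSpace n F R ℓ :=
  Submodule.mapQ _ _ (leftMul n F R g) (by
    rw [Submodule.smul_le]
    intro r hr x _
    rw [Submodule.mem_comap, map_smul]
    exact Submodule.smul_mem_smul hr trivial)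

theorem reductionMap_mk (g : GL (Fin n) F) (x : lattice n F R) :
    reductionMap n F R ℓ g (Submodule.Quotient.mk x) =
      Submodule.Quotient.mk (leftMul n F R g x) := rfl

/-- The action of `G` on `I / ℓI` induced by left multiplication. -/
def reductionRep : Representation (ResField R ℓ) (GL (Fin n) F) (ReductionSpace n F R ℓ) where
  toFun g :=
    { toFun := reductionMap n F R ℓ g
      map_add' := map_add (reductionMap n F R ℓ g)
      map_smul' := by
        intro k x
        obtain ⟨r, rfl⟩ := Ideal.Quotient.mk_surjective k
        exact map_smul (reductionMap n F R ℓ g) r x }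
  map_one' := by
    refine LinearMap.ext fun x => ?_
    obtain ⟨x, rfl⟩ := Submodule.Quotient.mk_surjective _ x
    change reductionMap n F R ℓ 1 (Submodule.Quotient.mk x) = Submodule.Quotient.mk x
    rw [reductionMap_mk, leftMul_one]
  map_mul' g h := by
    refine LinearMap.ext fun x => ?_
    obtain ⟨x, rfl⟩ := Submodule.Quotient.mk_surjective _ x
    change reductionMap n F R ℓ (g * h) (Submodule.Quotient.mk x) =
      reductionMap n F R ℓ g (reductionMap n F R ℓ h (Submodule.Quotient.mk x))
    rw [reductionMap_mk, reductionMap_mk, reductionMap_mk, leftMul_mul]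

/-- The `KG`-module `L = I / ℓI`. -/
abbrev Reduction : Type _ := (reductionRep n F R ℓ).asModule

/-- The group algebra `KG`. -/
abbrev ResGroupAlg : Type _ := GroupAlg n F (ResField R ℓ)

/-- The coefficientwise reduction `RG → KG`. -/
abbrev reduceCoeff : GroupAlg n F R →+* ResGroupAlg n F R ℓ :=
  MonoidAlgebra.mapRingHom (GL (Fin n) F) (Ideal.Quotient.mk (Ideal.span {(ℓ : R)}))

instance : RingHomSurjective (reduceCoeff n F R ℓ) where
  is_surjective := by
    intro a
    induction a using MonoidAlgebra.induction_linear with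
    | zero => exact ⟨0, map_zero _⟩
    | add a b ha hb =>
      obtain ⟨a, rfl⟩ := ha
      obtain ⟨b, rfl⟩ := hb
      exact ⟨a + b, map_add _ _ _⟩
    | single g k =>
      obtain ⟨r, rfl⟩ := Ideal.Quotient.mk_surjective k
      exact ⟨MonoidAlgebra.single g r, by simp⟩

/-- The canonical projection `I → L = I / ℓI`. -/
def toReduction : lattice n F R →ₛₗ[reduceCoeff n F R ℓ] Reduction n F R ℓ where
  toFun x := (reductionRep n F R ℓ).asModuleEquiv.symm
    (Submodule.Quotient.mk x : ReductionSpace n F R ℓ)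
  map_add' x y := by simp
  map_smul' a x := by
    induction a using MonoidAlgebra.induction_linear with
    | zero => simp
    | add a b ha hb =>
      rw [add_smul, map_add, add_smul, ← ha, ← hb, Submodule.Quotient.mk_add, map_add]
    | single g r =>
      have h : (MonoidAlgebra.single g r : GroupAlg n F R) • x = r • leftMul n F R g x := by
        simp [leftMul, ← smul_assoc]
      apply (reductionRep n F R ℓ).asModuleEquiv.injective
      rw [h, Representation.asModuleEquiv_map_smul]
      simp [Representation.asAlgebraHom_single]
      rfl

/-- The `KG`-submodule `L(c) = (I(c) + ℓI) / ℓI` of `L`, i.e. the image of `I(c)` in `L`. -/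
def gowFiltration (c : ℕ) : Submodule (ResGroupAlg n F R ℓ) (Reduction n F R ℓ) :=
  (latticeFiltration n F R ℓ c).map (toReduction n F R ℓ)

/-- The factor `M(c) = L(c) / L(c+1)`. -/
abbrev gowFactor (c : ℕ) : Type _ :=
  gowFiltration n F R ℓ c ⧸
    (gowFiltration n F R ℓ (c + 1)).submoduleOf (gowFiltration n F R ℓ c)

end Lattice

end Steinberg

end

namespace Steinberg

/-! ## Permutations and blocks -/

section Perm

open Equiv

variable {n : ℕ}

/-! Let U be the group of upper unitriangular matrices and ψ a nontrivial character of F with values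
in R. A composition β of n gives the linear character λ_β of U that applies ψ to the sum of the
superdiagonal entries inside the blocks of β. Since I is spanned over R by the U-translates of its
generator (`mem_unipSpan`), the unnormalized idempotent of λ_β maps I into a single line, spanned by
a vector E_β (`exists_unipSum_smul_eq`). By the Bruhat decomposition, f pairs E_β with its
counterpart for ψ⁻¹ to |U| [G : P_β] (`gowForm_eigenvec`), and |U| is a unit. Hence E_β reduces into
L(c) exactly when c ≤ ν_ℓ([G : P_β]) (`eigenvec_mem_gowFiltration_iff`).

These vectors control the submodules of L. Every nonzero KG-module contains a nonzero vector on
which U acts through some λ_β (`exists_unipSum_smul_ne_zero`), so a submodule of L is determined by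
the set of all β with E_β in it (`le_of_eigenvec_mem`). This set is closed under refinement
(`eigenvec_mem_of_refine`). If β' refines β, then some element of RG takes E_β' to κ E_β, where κ [G
: P_β] is a unit times [G : P_β']. So the set is also closed under coarsening that does not change
ν_ℓ([G : P_β]) (`eigenvec_mem_of_coarsen`).

The rest is combinatorics of compositions. By lifting the exponent, ν_ℓ([G : P_β]) = H - ∑ (d ⌊m/e⌋
+ ν_ℓ(⌊m/e⌋!)), summed over the block sizes m, with d = ν_ℓ([e]_q) ≥ 1 and H the value of the
summand at m = n. A set closed in both ways that contains a β with ∑ ⌊m/e⌋ ≥ i also contains the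
composition with i parts e and all other parts 1. For i ≤ ℓ it then contains every β whose total
value is at most d i, because the factorials involved are prime to ℓ (`IsClosedType.of_basicType`).
So, for i ≤ ℓ and e i ≤ n, a submodule not inside the preceding term of the chain 0 ⊂ L(H) ⊂ L(H -
d) ⊂ L(H - 2d) ⊂ ⋯ contains L(H - d i) (`Setting.chain_le`). This gives the bottom of the submodule
lattice, hence (b). If ⌊n/e⌋ ≤ ℓ, the only total value outside this pattern is H itself, when ⌊n/e⌋
= ℓ, and a submodule reaching it is all of L (`Setting.exists_eq_gowFiltration`). This gives (a). -/

theorem rel_of_rel_adjacent {β : Fin n → ℕ} (hβ : Monotone β) {r : Fin n → Fin n → Prop}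
    (htrans : ∀ i j k, r i j → r j k → r i k)
    (h : ∀ i j : Fin n, i.val + 1 = j.val → β i = β j → r i j) :
    ∀ i j : Fin n, i < j → β i = β j → r i j := by
  have key : ∀ d : ℕ, ∀ i j : Fin n, i.val + d + 1 = j.val → β i = β j → r i j := by
    intro d
    induction d with
    | zero => intro i j hij; exact h i j (by omega)
    | succ d ih =>
      intro i j hij hb
      have hk : i.val + d + 1 < n := by have := j.2; omega
      have h1 : β i ≤ β ⟨i.val + d + 1, hk⟩ := hβ (Fin.mk_le_mk.mpr (by omega))
      have h2 : β ⟨i.val + d + 1, hk⟩ ≤ β j := hβ (Fin.mk_le_mk.mpr (by omega))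
      exact htrans _ ⟨i.val + d + 1, hk⟩ _ (ih _ _ rfl (by omega))
        (h _ _ (by simp; omega) (by omega))
  intro i j hij hb
  exact key (j.val - i.val - 1) i j (by have : i.val < j.val := hij; omega) hb

theorem exists_descent {x : Perm (Fin n)} (hx : x ≠ 1) :
    ∃ i j : Fin n, i.val + 1 = j.val ∧ x j < x i := by
  by_contra! h
  apply hx
  have hmono : StrictMono x := fun i j hij =>
    rel_of_rel_adjacent (β := fun _ => 0) monotone_const (r := fun i j => x i < x j)
      (fun _ _ _ => lt_trans)
      (fun i j hij _ => lt_of_le_of_ne (h i j hij) fun he => by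
        have := x.injective he
        rw [this] at hij; omega) i j hij rfl
  have : hmono.orderIsoOfSurjective _ x.surjective = OrderIso.refl _ := Subsingleton.elim _ _
  ext i
  have := congrArg (fun f => (f i).val) this
  simpa using this

/-- Permuting the arguments does not change the sum of β, so a termwise inequality is an equality
throughout. -/
theorem perm_comp_eq_of_le {β : Fin n → ℕ} {x : Perm (Fin n)} (h : ∀ j, β (x j) ≤ β j) (j : Fin n) :
    β (x j) = β j :=
  (Finset.sum_eq_sum_iff_of_le (fun i _ => h i)).mp (Equiv.sum_comp x β) j (Finset.mem_univ j)

theorem inv_perm_apply_self (x : Perm (Fin n)) (i : Fin n) : x⁻¹ (x i) = i :=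
  x.symm_apply_apply i

theorem perm_apply_inv_self (x : Perm (Fin n)) (i : Fin n) : x (x⁻¹ i) = i :=
  x.apply_symm_apply i

theorem perm_inv_comp_eq {β : Fin n → ℕ} {x : Perm (Fin n)} (h : ∀ j, β (x j) = β j) (j : Fin n) :
    β (x⁻¹ j) = β j := by
  rw [← h (x⁻¹ j)]; simp

theorem descent_mem_block {β : Fin n → ℕ} (hβ : Monotone β) {x : Perm (Fin n)}
    (hx : ∀ j, β (x j) = β j) {i j : Fin n} (hij : i ≤ j) (hlt : x j < x i) : β i = β j :=
  le_antisymm (hβ hij) (by rw [← hx i, ← hx j]; exact hβ hlt.le)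

/-- The rearrangement inequality for one transposition. The sum ∑ k * x k replaces the Coxeter
length as a measure: it grows whenever an inversion is removed. -/
theorem sum_mul_perm_swap_lt {x : Perm (Fin n)} {i j : Fin n} (hij : i < j) (h : x j < x i) :
    ∑ k : Fin n, (k : ℕ) * (x k : ℕ) < ∑ k : Fin n, (k : ℕ) * ((x * swap i j) k : ℕ) := by
  have h1 : ∑ k : Fin n, (k : ℕ) * ((x * swap i j) k : ℕ) =
      ∑ k : Fin n, (swap i j k : ℕ) * (x k : ℕ) := by
    rw [← Equiv.sum_comp (swap i j)]
    simp
  rw [h1]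
  have hne : i ≠ j := hij.ne
  have split : ∀ f : Fin n → ℕ, ∑ k, f k = f i + f j + ∑ k ∈ (Finset.univ.erase i).erase j, f k := by
    intro f
    rw [add_assoc, Finset.add_sum_erase _ _ (by simp [hne.symm]),
      Finset.add_sum_erase _ _ (Finset.mem_univ i)]
  rw [split, split]
  have : ∑ k ∈ (Finset.univ.erase i).erase j, (swap i j k : ℕ) * (x k : ℕ) =
      ∑ k ∈ (Finset.univ.erase i).erase j, (k : ℕ) * (x k : ℕ) := by
    refine Finset.sum_congr rfl fun k hk => ?_
    simp only [Finset.mem_erase, Finset.mem_univ, and_true] at hk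
    rw [swap_apply_of_ne_of_ne hk.2 hk.1]
  rw [this, swap_apply_left, swap_apply_right]
  have hij' : (i : ℕ) < j := hij
  have h' : (x j : ℕ) < x i := h
  nlinarith

theorem sum_mul_perm_le (x : Perm (Fin n)) : ∑ k : Fin n, (k : ℕ) * (x k : ℕ) ≤ n * (n * n) := by
  calc _ ≤ ∑ _k : Fin n, n * n := Finset.sum_le_sum fun k _ => Nat.mul_le_mul k.2.le (x k).2.le
    _ = _ := by simp

/-- Induction on permutations by removing adjacent descents. -/
theorem perm_descent_induction {P : Perm (Fin n) → Prop} (one : P 1)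
    (step : ∀ (x : Perm (Fin n)) (i j : Fin n), i.val + 1 = j.val → x j < x i →
      P (x * swap i j) → P x) (x : Perm (Fin n)) : P x := by
  induction h : n * (n * n) - ∑ k : Fin n, (k : ℕ) * (x k : ℕ) using Nat.strong_induction_on
    generalizing x with
  | _ m ih =>
    by_cases hx : x = 1
    · exact hx ▸ one
    · obtain ⟨i, j, hij, hlt⟩ := exists_descent hx
      refine step x i j hij hlt (ih _ ?_ _ rfl)
      have h1 := sum_mul_perm_swap_lt (Fin.lt_def.mpr (by omega)) hlt
      have h2 := sum_mul_perm_le (x * swap i j)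
      omega

/-- A block-preserving x that maximizes ∑ k * w (x k) leaves no descent inside a block. Then w x is
the minimal representative of the coset of w modulo the Young subgroup. -/
theorem exists_increasing_on_blocks {β : Fin n → ℕ} (hβ : Monotone β) (w : Perm (Fin n)) :
    ∃ x : Perm (Fin n), (∀ i, β (x i) = β i) ∧ ∀ i j, i < j → β i = β j → w (x i) < w (x j) := by
  classical
  let S : Finset (Perm (Fin n)) := Finset.univ.filter fun x => ∀ i, β (x i) = β i
  obtain ⟨x, hxS, hmax⟩ := S.exists_max_image (fun x => ∑ k : Fin n, (k : ℕ) * ((w * x) k : ℕ))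
    ⟨1, by simp [S]⟩
  have hx : ∀ i, β (x i) = β i := by simpa [S] using hxS
  refine ⟨x, hx, rel_of_rel_adjacent hβ (fun _ _ _ => lt_trans) fun i j hij hb => ?_⟩
  by_contra hlt
  have hne : i ≠ j := by rintro rfl; omega
  have hlt' : (w * x) j < (w * x) i :=
    lt_of_le_of_ne (not_lt.mp hlt) fun he => hne ((w * x).injective he).symm
  have h1 := sum_mul_perm_swap_lt (Fin.lt_def.mpr (by omega)) hlt'
  have h2 := hmax (x * swap i j) (by
    simp only [S, Finset.mem_filter, Finset.mem_univ, true_and]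
    intro k
    rw [Perm.mul_apply, hx]
    rcases eq_or_ne k i with rfl | hki
    · rw [swap_apply_left, hb]
    · rcases eq_or_ne k j with rfl | hkj
      · rw [swap_apply_right, hb]
      · rw [swap_apply_of_ne_of_ne hki hkj])
  rw [mul_assoc] at h1
  omega

/-- Uniqueness of minimal coset representatives. A descent of x would stay inside a block, and there
v and v x would order its two positions in opposite ways. -/
theorem eq_one_of_increasing_on_blocks {β : Fin n → ℕ} (hβ : Monotone β) {v x : Perm (Fin n)}
    (hx : ∀ i, β (x i) = β i) (hv : ∀ i j, i < j → β i = β j → v i < v j)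
    (hvx : ∀ i j, i < j → β i = β j → v (x i) < v (x j)) : x = 1 := by
  by_contra hne
  obtain ⟨i, j, hij, hlt⟩ := exists_descent hne
  have hij' : i < j := Fin.lt_def.mpr (by omega)
  have hb := descent_mem_block hβ hx hij'.le hlt
  exact lt_asymm (hvx i j hij' hb) (hv _ _ hlt (by rw [hx, hx, hb]))

/-- The longest element of the Young subgroup, obtained by sorting the total reversal on the blocks.
-/
theorem exists_block_reversal {β : Fin n → ℕ} (hβ : Monotone β) :
    ∃ w : Perm (Fin n), (∀ i, β (w i) = β i) ∧ ∀ i j, i < j → β i = β j → w j < w i := by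
  obtain ⟨w, h1, h2⟩ := exists_increasing_on_blocks hβ Fin.revPerm
  exact ⟨w, h1, fun i j hij hb => by simpa using h2 i j hij hb⟩

theorem inv_decreasing_on_blocks {β : Fin n → ℕ} {w : Perm (Fin n)} (h1 : ∀ i, β (w i) = β i)
    (h2 : ∀ i j, i < j → β i = β j → w j < w i) (i j : Fin n) (hij : i < j) (hb : β i = β j) :
    w⁻¹ j < w⁻¹ i := by
  rcases lt_trichotomy (w⁻¹ i) (w⁻¹ j) with h | h | h
  · have := h2 _ _ h (by rw [perm_inv_comp_eq h1, perm_inv_comp_eq h1, hb])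
    rw [← Perm.mul_apply, ← Perm.mul_apply, mul_inv_cancel] at this
    exact absurd this hij.not_gt
  · exact absurd (w⁻¹.injective h) hij.ne
  · exact h

/-- If `β'` refines `β`, the product of the block reversals of `β` and `β'` carries the
adjacent pairs within blocks of `β'` to adjacent pairs within blocks of `β`. -/
theorem adjacent_reversal_iff {β β' : Fin n → ℕ} (hβ : Monotone β) (hβ' : Monotone β')
    (href : ∀ i j, β' i = β' j → β i = β j) {w w' : Perm (Fin n)}
    (h1 : ∀ i, β (w i) = β i) (h2 : ∀ i j, i < j → β i = β j → w j < w i)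
    (h1' : ∀ i, β' (w' i) = β' i) (h2' : ∀ i j, i < j → β' i = β' j → w' j < w' i)
    {a b : Fin n} (hab : a < b) (hb : β' a = β' b) :
    ((w (w' a)).val + 1 = (w (w' b)).val ∧ β (w (w' a)) = β (w (w' b))) ↔ a.val + 1 = b.val := by
  have hpos : ∀ a b : Fin n, a < b → β' a = β' b → w (w' a) < w (w' b) := fun a b hab hb =>
    h2 _ _ (h2' a b hab hb) (href _ _ (by rw [h1', h1', hb]))
  have hbb : β (w' a) = β (w' b) := href _ _ (by rw [h1', h1', hb])
  have hsame : β (w (w' a)) = β (w (w' b)) := by rw [h1, h1, hbb]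
  constructor
  · rintro ⟨h, -⟩
    by_contra hne
    have hlt : a.val + 1 < b.val := by have : a.val < b.val := hab; omega
    -- An index strictly between a and b lies in their block of β', so its image falls strictly
    -- between two adjacent numbers.
    let c : Fin n := ⟨a.val + 1, hlt.trans b.2⟩
    have hac : a < c := Fin.lt_def.mpr (by simp [c])
    have hcb : c < b := Fin.lt_def.mpr hlt
    have hβc : β' a = β' c := le_antisymm (hβ' hac.le) (by rw [hb]; exact hβ' hcb.le)
    have h3 := Fin.lt_def.mp (hpos a c hac hβc)
    have h4 := Fin.lt_def.mp (hpos c b hcb (hβc.symm.trans hb))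
    omega
  · intro h
    refine ⟨?_, hsame⟩
    by_contra hne
    have hlt := Fin.lt_def.mp (hpos a b hab hb)
    let c : Fin n := ⟨(w (w' a)).val + 1, by have := (w (w' b)).2; omega⟩
    have hac : w (w' a) < c := Fin.lt_def.mpr (by simp [c])
    have hcb : c < w (w' b) := Fin.lt_def.mpr (by simp [c]; omega)
    have hβc : β (w (w' a)) = β c :=
      le_antisymm (hβ hac.le) (by rw [hsame]; exact hβ hcb.le)
    have h3 := inv_decreasing_on_blocks h1 h2 _ _ hac hβc
    have h4 := inv_decreasing_on_blocks h1 h2 _ _ hcb (hβc.symm.trans hsame)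
    rw [inv_perm_apply_self] at h3 h4
    have hβa : β' (w' b) = β' (w' a) := by rw [h1', h1', hb]
    have h5 : β' (w' b) = β' (w⁻¹ c) :=
      le_antisymm (hβ' h4.le) (by rw [hβa]; exact hβ' h3.le)
    have h6 := inv_decreasing_on_blocks h1' h2' _ _ h3 (h5.symm.trans hβa)
    have h7 := inv_decreasing_on_blocks h1' h2' _ _ h4 h5
    rw [inv_perm_apply_self] at h6 h7
    rw [Fin.lt_def] at h6 h7
    omega

end Perm

end Steinberg

namespace Steinberg

open Matrix MonoidAlgebra

section Group

open Equiv

variable {n : ℕ} {F : Type*} [Field F]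

/-! ## Matrices of permutations, transvections, and the Bruhat decomposition -/

theorem permGL_apply (σ : Perm (Fin n)) (i j : Fin n) :
    (permGL F σ).val i j = if i = σ j then 1 else 0 := rfl

theorem permGL_mul_val (σ : Perm (Fin n)) (g : GL (Fin n) F) (i j : Fin n) :
    (permGL F σ * g).val i j = g.val (σ⁻¹ i) j := by
  rw [Units.val_mul, Matrix.mul_apply, Finset.sum_eq_single (σ⁻¹ i)]
  · simp [permGL_apply]
  · intro k _ hk
    rw [permGL_apply, if_neg, zero_mul]
    rintro rfl
    exact hk (inv_perm_apply_self σ k).symm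
  · simp

theorem mul_permGL_val (σ : Perm (Fin n)) (g : GL (Fin n) F) (i j : Fin n) :
    (g * permGL F σ).val i j = g.val i (σ j) := by
  rw [Units.val_mul, Matrix.mul_apply, Finset.sum_eq_single (σ j)]
  · simp [permGL_apply]
  · intro k _ hk
    rw [permGL_apply, if_neg hk, mul_zero]
  · simp

theorem permGL_one : permGL F (1 : Perm (Fin n)) = 1 := by
  ext i j
  rw [permGL_apply, Units.val_one, Matrix.one_apply, Perm.one_apply]

theorem permGL_mul (σ τ : Perm (Fin n)) : permGL F (σ * τ) = permGL F σ * permGL F τ := by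
  ext i j
  rw [mul_permGL_val, permGL_apply, permGL_apply, Perm.mul_apply]

theorem permGL_inv (σ : Perm (Fin n)) : permGL F σ⁻¹ = (permGL F σ)⁻¹ := by
  rw [eq_inv_iff_mul_eq_one, ← permGL_mul, inv_mul_cancel, permGL_one]

theorem permGL_swap_mul_self (i j : Fin n) :
    permGL F (swap i j) * permGL F (swap i j) = 1 := by
  rw [← permGL_mul, Equiv.swap_mul_self, permGL_one]

theorem permGL_conj_val (v w : Perm (Fin n)) (g : GL (Fin n) F) (i j : Fin n) :
    ((permGL F v)⁻¹ * g * permGL F w).val i j = g.val (v i) (w j) := by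
  rw [mul_permGL_val, ← permGL_inv, permGL_mul_val, inv_inv]

/-- The elementary matrix `1 + y E_{ij}`. -/
def transv {i j : Fin n} (hij : i ≠ j) (y : F) : GL (Fin n) F where
  val := transvection i j y
  inv := transvection i j (-y)
  val_inv := by rw [transvection_mul_transvection_same i j hij]; simp
  inv_val := by rw [transvection_mul_transvection_same i j hij]; simp

theorem transv_val {i j : Fin n} (hij : i ≠ j) (y : F) (k l : Fin n) :
    (transv hij y).val k l = (if k = l then 1 else 0) + if i = k ∧ j = l then y else 0 := by
  simp [transv, transvection, Matrix.one_apply, Matrix.single_apply]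

theorem transv_zero {i j : Fin n} (hij : i ≠ j) : transv hij (0 : F) = 1 := by
  ext k l
  simp [transv_val, Matrix.one_apply]

theorem transv_mul {i j : Fin n} (hij : i ≠ j) (y z : F) :
    transv hij y * transv hij z = transv hij (y + z) :=
  Units.ext (transvection_mul_transvection_same i j hij y z)

theorem transv_inv {i j : Fin n} (hij : i ≠ j) (y : F) :
    (transv hij y)⁻¹ = transv hij (-y) := by
  rw [inv_eq_iff_mul_eq_one, transv_mul, add_neg_cancel, transv_zero]

theorem transv_mul_val {i j : Fin n} (hij : i ≠ j) (y : F) (g : GL (Fin n) F) (k l : Fin n) :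
    (transv hij y * g).val k l = g.val k l + if i = k then y * g.val j l else 0 := by
  have : (transv hij y * g).val = g.val + Matrix.single i j y * g.val := by
    rw [Units.val_mul]
    change transvection i j y * _ = _
    rw [transvection, add_mul, one_mul]
  rw [this, Matrix.add_apply]
  split_ifs with h
  · subst h; simp
  · simp [Ne.symm h]

theorem mul_transv_val {i j : Fin n} (hij : i ≠ j) (y : F) (g : GL (Fin n) F) (k l : Fin n) :
    (g * transv hij y).val k l = g.val k l + if j = l then g.val k i * y else 0 := by
  have : (g * transv hij y).val = g.val + g.val * Matrix.single i j y := by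
    rw [Units.val_mul]
    change _ * transvection i j y = _
    rw [transvection, mul_add, mul_one]
  rw [this, Matrix.add_apply]
  split_ifs with h
  · subst h; simp
  · simp [Ne.symm h]

theorem transv_conj_permGL {i j : Fin n} (hij : i ≠ j) (y : F) (w : Perm (Fin n)) :
    (permGL F w)⁻¹ * transv hij y * permGL F w =
      transv (fun h => hij (w⁻¹.injective h) : w⁻¹ i ≠ w⁻¹ j) y := by
  ext k l
  rw [permGL_conj_val, transv_val, transv_val]
  simp [Equiv.symm_apply_eq, w.injective.eq_iff]

theorem mem_borel_iff {g : GL (Fin n) F} :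
    g ∈ borel n F ↔ ∀ i j : Fin n, j < i → g.val i j = 0 := Iff.rfl

theorem transv_mem_borel {i j : Fin n} (hij : i < j) (y : F) : transv hij.ne y ∈ borel n F := by
  intro k l hlk
  rw [transv_val, if_neg hlk.ne', if_neg, add_zero]
  rintro ⟨rfl, rfl⟩
  exact lt_asymm hij hlk

theorem mul_diag_of_mem_borel {a b : GL (Fin n) F} (ha : a ∈ borel n F) (hb : b ∈ borel n F)
    (i : Fin n) : (a * b).val i i = a.val i i * b.val i i := by
  rw [Units.val_mul, Matrix.mul_apply, Finset.sum_eq_single i]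
  · intro k _ hk
    rcases lt_or_gt_of_ne hk with h | h
    · rw [ha i k h, zero_mul]
    · rw [hb k i h, mul_zero]
  · simp

theorem mul_adjacent_of_mem_borel {a b : GL (Fin n) F} (ha : a ∈ borel n F) (hb : b ∈ borel n F)
    {i j : Fin n} (hij : i.val + 1 = j.val) :
    (a * b).val i j = a.val i i * b.val i j + a.val i j * b.val j j := by
  have hne : i ≠ j := by rintro rfl; omega
  rw [Units.val_mul, Matrix.mul_apply, Finset.sum_eq_add i j hne]
  · intro k _ hk
    rcases lt_or_gt_of_ne hk.1 with h | h
    · rw [ha i k h, zero_mul]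
    · rw [hb k j, mul_zero]
      have : k.val ≠ j.val := fun h => hk.2 (Fin.ext h)
      rw [Fin.lt_def] at *
      omega
  · simp
  · simp

theorem diag_ne_zero_of_mem_borel {a : GL (Fin n) F} (ha : a ∈ borel n F) (i : Fin n) :
    a.val i i ≠ 0 := by
  have := mul_diag_of_mem_borel ha (inv_mem ha) i
  rw [mul_inv_cancel] at this
  intro h
  simp [h] at this

/-- The relation between the transposition and the transvections in `GL_2`. -/
theorem exists_swap_mul_transv_mul_swap {i j : Fin n} (hij : i ≠ j) {y : F} (hy : y ≠ 0) :
    ∃ h : GL (Fin n) F, (∀ k l, k ≠ l → ¬ (k = i ∧ l = j) → h.val k l = 0) ∧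
      permGL F (swap i j) * transv hij y * permGL F (swap i j) =
        transv hij y⁻¹ * permGL F (swap i j) * h := by
  refine ⟨(permGL F (swap i j))⁻¹ * (transv hij (-y⁻¹) *
    (permGL F (swap i j) * transv hij y * permGL F (swap i j))), ?_, ?_⟩
  · intro k l hkl hne
    rw [← permGL_inv, permGL_mul_val, transv_mul_val, mul_permGL_val, permGL_mul_val,
      mul_permGL_val, permGL_mul_val, transv_val, transv_val, inv_inv, swap_inv]
    rcases eq_or_ne k i with rfl | hki
    · rcases eq_or_ne l j with rfl | hlj
      · exact absurd ⟨rfl, rfl⟩ hne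
      · simp [hij, hkl, swap_apply_of_ne_of_ne hkl.symm hlj, hlj.symm]
    · rcases eq_or_ne k j with rfl | hkj
      · rcases eq_or_ne l i with rfl | hli
        · simp [hij, hy]
        · simp [hij, swap_apply_of_ne_of_ne hli hkl.symm, hkl, hli.symm]
      · rw [swap_apply_of_ne_of_ne hki hkj, swap_apply_of_ne_of_ne hki hkj]
        have : k ≠ swap i j l := by
          intro h
          rw [← swap_apply_of_ne_of_ne hki hkj] at h
          exact hkl ((swap i j).injective h)
        simp [this, hki.symm]
  · rw [← transv_inv]
    group

theorem swap_lt_swap_of_adjacent {i j k l : Fin n} (hij : i.val + 1 = j.val) (hkl : l < k)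
    (hne : ¬ (l = i ∧ k = j)) : swap i j l < swap i j k := by
  rw [swap_apply_def, swap_apply_def]
  rw [Fin.lt_def] at hkl ⊢
  simp only [Fin.ext_iff] at hne ⊢
  split_ifs <;> omega

theorem borel_conj_swap {i j : Fin n} (hij : i.val + 1 = j.val) {b : GL (Fin n) F}
    (hb : b ∈ borel n F) (h0 : b.val i j = 0) :
    permGL F (swap i j) * b * permGL F (swap i j) ∈ borel n F := by
  intro k l hlk
  rw [mul_permGL_val, permGL_mul_val, swap_inv]
  by_cases hne : l = i ∧ k = j
  · rw [hne.1, hne.2, swap_apply_left, swap_apply_right, h0]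
  · exact hb _ _ (swap_lt_swap_of_adjacent hij hlk hne)

/-- `GL_n(F)` is generated by the diagonal matrices, the upper triangular transvections and the
adjacent transpositions. -/
theorem mem_of_generators (H : Submonoid (GL (Fin n) F))
    (hdiag : ∀ g : GL (Fin n) F, (∀ i j, i ≠ j → g.val i j = 0) → g ∈ H)
    (htransv : ∀ (i j : Fin n) (hij : i < j) (y : F), transv hij.ne y ∈ H)
    (hswap : ∀ i j : Fin n, i.val + 1 = j.val → permGL F (swap i j) ∈ H)
    (g : GL (Fin n) F) : g ∈ H := by
  have hperm : ∀ x : Perm (Fin n), permGL F x ∈ H := by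
    intro x
    induction x using perm_descent_induction with
    | one => rw [permGL_one]; exact H.one_mem
    | step x i j hij _ ih =>
      have := H.mul_mem ih (hswap i j hij)
      rwa [← permGL_mul, mul_assoc, Equiv.swap_mul_self, mul_one] at this
  have htr : ∀ (i j : Fin n) (hij : i ≠ j) (y : F), transv hij y ∈ H := by
    intro i j hij y
    rcases lt_or_gt_of_ne hij with h | h
    · exact htransv i j h y
    · have := H.mul_mem (H.mul_mem (hperm (swap i j)⁻¹) (htransv j i h y)) (hperm (swap i j))
      rw [permGL_inv, transv_conj_permGL] at this
      simpa using this
  have key := diagonal_transvection_induction_of_det_ne_zero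
    (fun M => ∀ g : GL (Fin n) F, g.val = M → g ∈ H) g.val
    ((Matrix.isUnit_iff_isUnit_det _).mp g.isUnit).ne_zero ?_ ?_ ?_
  · exact key g rfl
  · intro D _ g hg
    refine hdiag g fun i j hij => ?_
    rw [hg, diagonal_apply_ne _ hij]
  · intro t g hg
    have : g = transv t.hij t.c := Units.ext hg
    rw [this]; exact htr _ _ _ _
  · intro A B hA hB ihA ihB g hg
    have hg' : g = GeneralLinearGroup.mkOfDetNeZero A hA * GeneralLinearGroup.mkOfDetNeZero B hB :=
      Units.ext hg
    rw [hg']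
    exact H.mul_mem (ihA _ rfl) (ihB _ rfl)

/-- The union of the double cosets B w B is stable under left multiplication by the generators. For
an adjacent transposition s, the relation in GL_2 between s and a transvection handles the case
where s and w do not combine directly. -/
theorem exists_bruhat (g : GL (Fin n) F) :
    ∃ b ∈ borel n F, ∃ w : Perm (Fin n), ∃ b' ∈ borel n F, g = b * permGL F w * b' := by
  let X : Set (GL (Fin n) F) :=
    {g | ∃ b ∈ borel n F, ∃ w : Perm (Fin n), ∃ b' ∈ borel n F, g = b * permGL F w * b'}
  let H : Submonoid (GL (Fin n) F) :=
    { carrier := {h | ∀ g ∈ X, h * g ∈ X}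
      one_mem' := fun g hg => by rwa [one_mul]
      mul_mem' := fun {a b} ha hb g hg => by rw [mul_assoc]; exact ha _ (hb _ hg) }
  have hborel : ∀ b ∈ borel n F, b ∈ H := by
    rintro b hb _ ⟨c, hc, w, c', hc', rfl⟩
    exact ⟨b * c, mul_mem hb hc, w, c', hc', by group⟩
  have hH : g ∈ H := by
    refine mem_of_generators H (fun g hg => hborel g fun i j h => hg i j h.ne')
      (fun i j h y => hborel _ (transv_mem_borel h y)) ?_ g
    rintro i j hij _ ⟨b, hb, w, b', hb', rfl⟩
    have hlt : i < j := Fin.lt_def.mpr (by omega)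
    set s := permGL F (swap i j) with hs
    have hss : s * s = 1 := permGL_swap_mul_self i j
    -- This y makes the (i, j) entry of b0 vanish, so that conjugation by s keeps b0 in B.
    set y := b.val i j / b.val i i
    set b0 := b * transv hlt.ne (-y) with hb0
    have hb0B : b0 ∈ borel n F := mul_mem hb (transv_mem_borel hlt _)
    have hb00 : b0.val i j = 0 := by
      rw [hb0, mul_transv_val, if_pos rfl]
      simp only [y]
      field_simp [diag_ne_zero_of_mem_borel hb i]
      ring
    have hbb : b = b0 * transv hlt.ne y := by
      rw [hb0, mul_assoc, transv_mul, neg_add_cancel, transv_zero, mul_one]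
    have hsb : s * b0 * s ∈ borel n F := borel_conj_swap hij hb0B hb00
    suffices hx : s * transv hlt.ne y * permGL F w ∈ X by
      obtain ⟨c, hc, v, c', hc', hcv⟩ := hx
      refine ⟨s * b0 * s * c, mul_mem hsb hc, v, c' * b', mul_mem hc' hb', ?_⟩
      calc s * (b * permGL F w * b') = s * b0 * (s * s) * transv hlt.ne y * permGL F w * b' := by
            rw [hss, hbb]; group
        _ = s * b0 * s * (s * transv hlt.ne y * permGL F w) * b' := by group
        _ = _ := by rw [hcv]; group
    rcases lt_trichotomy (w⁻¹ i) (w⁻¹ j) with h | h | h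
    · refine ⟨1, one_mem _, swap i j * w, _, transv_mem_borel h y, ?_⟩
      rw [← transv_conj_permGL hlt.ne, permGL_mul, ← hs]
      group
    · exact absurd (w⁻¹.injective h) hlt.ne
    · by_cases hy : y = 0
      · refine ⟨1, one_mem _, swap i j * w, 1, one_mem _, ?_⟩
        rw [hy, transv_zero, permGL_mul, ← hs]
        group
      -- Here w does not conjugate the transvection into B. Writing w = s w' and applying the GL_2
      -- relation replaces it by a factor h' that w' does conjugate into B.
      · obtain ⟨h', hh', hrel⟩ := exists_swap_mul_transv_mul_swap hlt.ne hy
        set w' := swap i j * w with hw'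
        have hw : permGL F w = s * permGL F w' := by
          rw [hw', permGL_mul, ← mul_assoc, hss, one_mul]
        refine ⟨_, transv_mem_borel hlt y⁻¹, w, (permGL F w')⁻¹ * h' * permGL F w', ?_, ?_⟩
        · intro k l hlk
          rw [permGL_conj_val]
          refine hh' _ _ (fun he => hlk.ne' (w'.injective he)) ?_
          rintro ⟨h1, h2⟩
          have h1' : w k = j := by
            have := congrArg (swap i j) h1
            simpa [hw'] using this
          have h2' : w l = i := by
            have := congrArg (swap i j) h2
            simpa [hw'] using this
          rw [← h1', ← h2', inv_perm_apply_self, inv_perm_apply_self] at h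
          exact lt_asymm h hlk
        · rw [hw, ← mul_assoc, hs, hrel]
          group
  obtain ⟨b, hb, w, b', hb', h⟩ := hH 1 ⟨1, one_mem _, 1, 1, one_mem _, by simp [permGL_one]⟩
  exact ⟨b, hb, w, b', hb', by rw [← h, mul_one]⟩

/-! ## Standard parabolic subgroups -/

/-- The block upper triangular subgroup with blocks the fibres of `β`. -/
def parabolic (F : Type*) [Field F] (β : Fin n → ℕ) : Subgroup (GL (Fin n) F) where
  carrier := {g | ∀ i j : Fin n, β j < β i → g.val i j = 0}
  one_mem' := fun i j hij => by
    have : i ≠ j := by rintro rfl; exact lt_irrefl _ hij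
    simp [this]
  mul_mem' := by
    intro a b ha hb
    have ha' : a.val.BlockTriangular β := fun i j h => ha i j h
    have hb' : b.val.BlockTriangular β := fun i j h => hb i j h
    intro i j h
    exact ha'.mul hb' h
  inv_mem' := by
    intro a ha
    have ha' : a.val.BlockTriangular β := fun i j h => ha i j h
    intro i j h
    have : Invertible a.val := a.invertible
    have := Matrix.blockTriangular_inv_of_blockTriangular ha' h
    rwa [← Matrix.coe_units_inv] at this

theorem mem_parabolic_iff {β : Fin n → ℕ} {g : GL (Fin n) F} :
    g ∈ parabolic F β ↔ ∀ i j : Fin n, β j < β i → g.val i j = 0 := Iff.rfl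

theorem borel_le_parabolic {β : Fin n → ℕ} (hβ : Monotone β) : borel n F ≤ parabolic F β :=
  fun _ hg i j hij => hg i j (lt_of_not_ge fun h => (hβ h).not_gt hij)

theorem permGL_mem_parabolic {β : Fin n → ℕ} {x : Perm (Fin n)} (hx : ∀ j, β (x j) = β j) :
    permGL F x ∈ parabolic F β := by
  intro i j hij
  rw [permGL_apply, if_neg]
  rintro rfl
  exact hij.ne (hx j).symm

/-- The entry of v⁻¹ b w in position (v⁻¹ w j, j) is a diagonal entry of b, hence nonzero, which
bounds the block of v⁻¹ w j by that of j. This is the disjointness half of the Bruhat decomposition.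
-/
theorem comp_eq_of_conj_mem_parabolic {β : Fin n → ℕ} {b : GL (Fin n) F} (hb : b ∈ borel n F)
    {v w : Perm (Fin n)} (h : (permGL F v)⁻¹ * b * permGL F w ∈ parabolic F β) (j : Fin n) :
    β ((v⁻¹ * w) j) = β j := by
  refine perm_comp_eq_of_le (x := v⁻¹ * w) (fun j => ?_) j
  by_contra hlt
  have := mem_parabolic_iff.mp h _ _ (not_le.mp hlt)
  rw [permGL_conj_val, Perm.mul_apply, perm_apply_inv_self] at this
  exact diag_ne_zero_of_mem_borel hb _ this

/-- P is determined by the adjacent transpositions it contains: a new block of β starts after each k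
whose transposition is missing from P. For the inclusion in the block triangular group, every
descent of a permutation in P must come from an adjacent transposition in P. -/
theorem eq_parabolic_of_borel_le {P : Subgroup (GL (Fin n) F)} (hP : borel n F ≤ P) :
    ∃ β : Fin n → ℕ, Monotone β ∧ P = parabolic F β := by
  classical
  let S : Finset (Fin n) := Finset.univ.filter fun k =>
    ∀ j : Fin n, k.val + 1 = j.val → permGL F (swap k j) ∉ P
  let β : Fin n → ℕ := fun i => (S.filter (· < i)).card
  have hβ : Monotone β := fun i j hij => Finset.card_le_card fun k hk => by
    simp only [Finset.mem_filter] at hk ⊢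
    exact ⟨hk.1, hk.2.trans_le hij⟩
  have hlink : ∀ i j : Fin n, i.val + 1 = j.val → (β i = β j ↔ permGL F (swap i j) ∈ P) := by
    intro i j hij
    have huniq : ∀ j' : Fin n, i.val + 1 = j'.val → j' = j := fun j' h => Fin.ext (by omega)
    constructor
    · intro h
      by_contra hn
      have : S.filter (· < i) ⊂ S.filter (· < j) := by
        rw [Finset.ssubset_iff]
        refine ⟨i, by simp, fun k hk => ?_⟩
        simp only [Finset.mem_insert, Finset.mem_filter, S, Finset.mem_univ, true_and] at hk ⊢
        rcases hk with rfl | hk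
        · exact ⟨fun j' hj' => by rw [huniq j' hj']; exact hn, Fin.lt_def.mpr (by omega)⟩
        · exact ⟨hk.1, hk.2.trans (Fin.lt_def.mpr (by omega))⟩
      exact (Finset.card_lt_card this).ne h
    · intro h
      refine congrArg Finset.card (Finset.filter_congr fun k hk => ?_)
      simp only [Finset.mem_filter, S, Finset.mem_univ, true_and] at hk
      have hki : k ≠ i := by rintro rfl; exact hk j hij h
      rw [Fin.lt_def, Fin.lt_def]
      have : k.val ≠ i.val := fun h => hki (Fin.ext h)
      omega
  have hBP := borel_le_parabolic (F := F) hβ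
  refine ⟨β, hβ, le_antisymm ?_ ?_⟩
  · intro g hg
    obtain ⟨b, hb, w, b', hb', rfl⟩ := exists_bruhat g
    have hw : permGL F w ∈ P := by
      have := mul_mem (mul_mem (inv_mem (hP hb)) hg) (inv_mem (hP hb'))
      convert this using 1
      group
    have key : ∀ x : Perm (Fin n), permGL F x ∈ P → ∀ k, β (x k) = β k := by
      intro x
      induction x using perm_descent_induction with
      | one => intros; rfl
      | step x i j hij hlt ih =>
        intro hx
        have hij' : i < j := Fin.lt_def.mpr (by omega)
        -- Since x has a descent at (i, j), conjugating an upper transvection by x gives the lower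
        -- transvection for this pair. The GL_2 relation then extracts the transposition from it.
        have hlow : permGL F (swap i j) * transv hij'.ne 1 * permGL F (swap i j) ∈ P := by
          have h1 := mul_mem (mul_mem (inv_mem hx) (hP (transv_mem_borel hlt 1))) hx
          have h2 := transv_conj_permGL (F := F) hij'.ne 1 (swap i j)
          rw [← permGL_inv, swap_inv] at h2
          rw [transv_conj_permGL] at h1
          rw [h2]
          convert h1 using 2 <;> simp [inv_perm_apply_self]
        obtain ⟨h, hh, hrel⟩ := exists_swap_mul_transv_mul_swap (F := F) hij'.ne one_ne_zero
        have hhB : h ∈ borel n F := fun k l hlk => hh k l hlk.ne' (by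
          rintro ⟨rfl, rfl⟩; exact lt_asymm hij' hlk)
        have hs : permGL F (swap i j) ∈ P := by
          rw [hrel] at hlow
          have := mul_mem (mul_mem (inv_mem (hP (transv_mem_borel hij' 1⁻¹))) hlow)
            (inv_mem (hP hhB))
          convert this using 1
          group
        intro k
        have := ih (by rw [permGL_mul]; exact mul_mem hx hs) (swap i j k)
        rw [Perm.mul_apply, swap_apply_self] at this
        rw [this]
        have hb := (hlink i j hij).mpr hs
        rw [swap_apply_def]
        split_ifs with h1 h2
        · rw [h1, hb]
        · rw [h2, hb]
        · rfl
    exact mul_mem (mul_mem (hBP hb) (permGL_mem_parabolic (key w hw))) (hBP hb')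
  · intro g hg
    obtain ⟨b, hb, w, b', hb', rfl⟩ := exists_bruhat g
    have hw : permGL F w ∈ parabolic F β := by
      have := mul_mem (mul_mem (inv_mem (hBP hb)) hg) (inv_mem (hBP hb'))
      convert this using 1
      group
    have hwβ := comp_eq_of_conj_mem_parabolic (one_mem (borel n F)) (v := 1) (w := w)
      (by simpa [permGL_one] using hw)
    have key : ∀ x : Perm (Fin n), (∀ k, β (x k) = β k) → permGL F x ∈ P := by
      intro x
      induction x using perm_descent_induction with
      | one => intro; rw [permGL_one]; exact one_mem _
      | step x i j hij hlt ih =>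
        intro hx
        have hij' : i < j := Fin.lt_def.mpr (by omega)
        have hb := descent_mem_block hβ hx hij'.le hlt
        have hs := (hlink i j hij).mp hb
        have := mul_mem (ih fun k => by
          rw [Perm.mul_apply, hx, swap_apply_def]
          split_ifs with h1 h2
          · rw [h1, hb]
          · rw [h2, hb]
          · rfl) hs
        rwa [← permGL_mul, mul_assoc, Equiv.swap_mul_self, mul_one] at this
    exact mul_mem (mul_mem (hP hb) (key w (by simpa using hwβ))) (hP hb')

end Group

end Steinberg

namespace Steinberg

open Matrix MonoidAlgebra

section Count

open Equiv

variable {n : ℕ} {F : Type*} [Field F]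

/-! ## Unipotent subgroups and the index of a parabolic subgroup -/

/-- The group of upper unitriangular matrices. -/
def unip (n : ℕ) (F : Type*) [Field F] : Subgroup (GL (Fin n) F) where
  carrier := {g | g ∈ borel n F ∧ ∀ i, g.val i i = 1}
  one_mem' := ⟨one_mem _, fun i => by simp⟩
  mul_mem' := fun {a b} ha hb => ⟨mul_mem ha.1 hb.1, fun i => by
    rw [mul_diag_of_mem_borel ha.1 hb.1, ha.2, hb.2, mul_one]⟩
  inv_mem' := fun {a} ha => ⟨inv_mem ha.1, fun i => by
    have := mul_diag_of_mem_borel ha.1 (inv_mem ha.1) i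
    rw [mul_inv_cancel, ha.2, one_mul] at this
    rw [← this]; simp⟩

theorem unip_le_borel : unip n F ≤ borel n F := fun _ h => h.1

theorem mem_unip_iff {g : GL (Fin n) F} :
    g ∈ unip n F ↔ ∀ i j : Fin n, ¬ i < j → g.val i j = if i = j then 1 else 0 := by
  constructor
  · intro h i j hij
    split_ifs with he
    · rw [← he]; exact h.2 i
    · exact h.1 i j (lt_of_le_of_ne (not_lt.mp hij) (Ne.symm he))
  · intro h
    exact ⟨fun i j hij => by rw [h i j hij.not_gt, if_neg hij.ne'],
      fun i => by rw [h i i (lt_irrefl i), if_pos rfl]⟩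

theorem transv_mem_unip {i j : Fin n} (hij : i < j) (y : F) : transv hij.ne y ∈ unip n F :=
  ⟨transv_mem_borel hij y, fun k => by
    rw [transv_val, if_pos rfl, if_neg, add_zero]
    rintro ⟨rfl, rfl⟩
    exact lt_irrefl _ hij⟩

theorem exists_unip_mul_diag {b : GL (Fin n) F} (hb : b ∈ borel n F) :
    ∃ u ∈ unip n F, ∃ t : GL (Fin n) F, (∀ i j, i ≠ j → t.val i j = 0) ∧ b = u * t := by
  let t : GL (Fin n) F := GeneralLinearGroup.mkOfDetNeZero (diagonal fun i => b.val i i) (by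
    rw [det_diagonal]
    exact Finset.prod_ne_zero_iff.mpr fun i _ => diag_ne_zero_of_mem_borel hb i)
  have ht : ∀ i j, i ≠ j → t.val i j = 0 := fun i j hij => diagonal_apply_ne _ hij
  have htB : t ∈ borel n F := fun i j hij => ht i j hij.ne'
  refine ⟨b * t⁻¹, ⟨mul_mem hb (inv_mem htB), fun i => ?_⟩, t, ht, by group⟩
  have h1 := mul_diag_of_mem_borel htB (inv_mem htB) i
  have h2 : t.val i i = b.val i i := diagonal_apply_eq _ _
  rw [mul_diag_of_mem_borel hb (inv_mem htB), ← h2, ← h1, mul_inv_cancel]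
  simp

/-- The group `U ∩ w U w⁻¹`. -/
def unipInter (F : Type*) [Field F] (w : Perm (Fin n)) : Subgroup (GL (Fin n) F) :=
  unip n F ⊓ (borel n F).comap (MulAut.conj (permGL F w)⁻¹).toMonoidHom

theorem mem_unipInter_iff {w : Perm (Fin n)} {g : GL (Fin n) F} :
    g ∈ unipInter F w ↔ g ∈ unip n F ∧ (permGL F w)⁻¹ * g * permGL F w ∈ borel n F := by
  simp [unipInter, Subgroup.mem_inf]

theorem mem_unipInter_iff_val {w : Perm (Fin n)} {g : GL (Fin n) F} :
    g ∈ unipInter F w ↔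
      ∀ i j : Fin n, ¬ (i < j ∧ w⁻¹ i < w⁻¹ j) → g.val i j = if i = j then 1 else 0 := by
  rw [mem_unipInter_iff, mem_unip_iff]
  constructor
  · rintro ⟨h1, h2⟩ i j hij
    by_cases h : i < j
    · rw [if_neg h.ne]
      have hlt : w⁻¹ j < w⁻¹ i := lt_of_le_of_ne (not_lt.mp fun h' => hij ⟨h, h'⟩)
        fun he => h.ne' (w⁻¹.injective he)
      have := mem_borel_iff.mp h2 _ _ hlt
      rwa [permGL_conj_val, perm_apply_inv_self, perm_apply_inv_self] at this
    · exact h1 i j h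
  · intro h
    refine ⟨fun i j hij => h i j fun h' => hij h'.1, fun i j hij => ?_⟩
    rw [permGL_conj_val, h, if_neg fun he => hij.ne' (w.injective he)]
    rw [inv_perm_apply_self, inv_perm_apply_self]
    exact fun h' => lt_asymm h'.2 hij

theorem card_GL_of_fintype (ι : Type*) [Fintype ι] [DecidableEq ι] :
    Nat.card (GL ι F) = Nat.card (GL (Fin (Fintype.card ι)) F) :=
  Nat.card_congr (Units.mapEquiv
    (Matrix.reindexAlgEquiv F F (Fintype.equivFin ι)).toMulEquiv).toEquiv

/-- A priori the stabilizer is U ∩ v P v⁻¹. Since v is increasing on blocks, conjugation by v⁻¹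
creates no entries below the diagonal inside a block, so P may be replaced by B. -/
theorem stabilizer_unip_eq {β : Fin n → ℕ} (hβ : Monotone β) {v : Perm (Fin n)}
    (hv : ∀ i j, i < j → β i = β j → v i < v j) (u : unip n F) :
    u ∈ MulAction.stabilizer (unip n F) ((permGL F v : GL (Fin n) F) : GL (Fin n) F ⧸ parabolic F β)
      ↔ (u : GL (Fin n) F) ∈ unipInter F v := by
  rw [MulAction.mem_stabilizer_iff, mem_unipInter_iff]
  have h1 : u • ((permGL F v : GL (Fin n) F) : GL (Fin n) F ⧸ parabolic F β) =
      ((u : GL (Fin n) F) * permGL F v : GL (Fin n) F) := rfl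
  rw [h1, eq_comm, QuotientGroup.eq, ← mul_assoc]
  refine ⟨fun h => ⟨u.2, fun i j hij => ?_⟩, fun h => borel_le_parabolic hβ h.2⟩
  rcases (hβ hij.le).lt_or_eq with hlt | he
  · exact h i j hlt
  · rw [permGL_conj_val]
    exact u.2.1 _ _ (hv _ _ hij he)

variable [Fintype F]

/-- The entries at the positions in Φ are free and invertibility is automatic, so Φ need not be
closed in the way that would make the set a subgroup. -/
theorem card_pattern (Φ : Fin n → Fin n → Prop) [∀ i j, Decidable (Φ i j)]
    (hΦ : ∀ i j, Φ i j → i < j) :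
    Nat.card {g : GL (Fin n) F // ∀ i j, ¬ Φ i j → g.val i j = if i = j then 1 else 0} =
      Fintype.card F ^ (Finset.univ.filter fun p : Fin n × Fin n => Φ p.1 p.2).card := by
  let M : ({p : Fin n × Fin n // Φ p.1 p.2} → F) → Matrix (Fin n) (Fin n) F := fun f =>
    Matrix.of fun i j => if h : Φ i j then f ⟨(i, j), h⟩ else if i = j then 1 else 0
  have hM : ∀ f, (M f).det = 1 := by
    intro f
    rw [det_of_isUpperTriangular (M := M f)]
    · refine Finset.prod_eq_one fun i _ => ?_
      have : ¬ Φ i i := fun h => lt_irrefl _ (hΦ i i h)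
      simp [M, this]
    · intro i j hij
      have hij' : j < i := hij
      have : ¬ Φ i j := fun h => lt_asymm hij' (hΦ i j h)
      simp [M, this, hij'.ne']
  let e : {g : GL (Fin n) F // ∀ i j, ¬ Φ i j → g.val i j = if i = j then 1 else 0} ≃
      ({p : Fin n × Fin n // Φ p.1 p.2} → F) :=
    { toFun := fun g p => g.1.val p.1.1 p.1.2
      invFun := fun f => ⟨GeneralLinearGroup.mkOfDetNeZero (M f) (by rw [hM]; exact one_ne_zero),
        fun i j hij => by
          change M f i j = _
          simp [M, hij]⟩
      left_inv := fun g => by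
        apply Subtype.ext
        ext i j
        change M (fun p => g.1.val p.1.1 p.1.2) i j = g.1.val i j
        by_cases h : Φ i j
        · simp [M, h]
        · simp [M, h, g.2 i j h]
      right_inv := fun f => by
        funext p
        change M f p.1.1 p.1.2 = _
        simp [M, p.2] }
  rw [Nat.card_congr e, Nat.card_fun, Nat.card_eq_fintype_card, Nat.card_eq_fintype_card,
    Fintype.card_subtype]

theorem card_unipInter (w : Perm (Fin n)) :
    Nat.card (unipInter F w) = Fintype.card F ^
      (Finset.univ.filter fun p : Fin n × Fin n => p.1 < p.2 ∧ w⁻¹ p.1 < w⁻¹ p.2).card := by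
  rw [← card_pattern (F := F) (fun i j : Fin n => i < j ∧ w⁻¹ i < w⁻¹ j) fun _ _ h => h.1]
  exact Nat.card_congr (Equiv.subtypeEquivRight fun g => mem_unipInter_iff_val)

theorem card_unip :
    Nat.card (unip n F) = Fintype.card F ^
      (Finset.univ.filter fun p : Fin n × Fin n => p.1 < p.2).card := by
  rw [← card_pattern (F := F) (fun i j : Fin n => i < j) fun _ _ h => h]
  exact Nat.card_congr (Equiv.subtypeEquivRight fun g => mem_unip_iff)

/-- Both sides are q to the number of inversions of v. Passing from v to (w₀ v)⁻¹, with w₀ the total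
reversal, turns permutations increasing on blocks into those indexing the nonzero coefficients of
eigenvectors. -/
theorem card_orbit_mul {β : Fin n → ℕ} (hβ : Monotone β) {v : Perm (Fin n)}
    (hv : ∀ i j, i < j → β i = β j → v i < v j) :
    Nat.card (MulAction.orbit (unip n F)
        ((permGL F v : GL (Fin n) F) : GL (Fin n) F ⧸ parabolic F β)) =
      Nat.card (unipInter F (Fin.revPerm * v : Perm (Fin n))⁻¹) := by
  classical
  have h1 : Nat.card (MulAction.orbit (unip n F)
      ((permGL F v : GL (Fin n) F) : GL (Fin n) F ⧸ parabolic F β)) *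
      Nat.card (MulAction.stabilizer (unip n F)
        ((permGL F v : GL (Fin n) F) : GL (Fin n) F ⧸ parabolic F β)) = Nat.card (unip n F) := by
    have : Fintype (unip n F) := Fintype.ofFinite _
    have : Fintype (MulAction.orbit (unip n F)
      ((permGL F v : GL (Fin n) F) : GL (Fin n) F ⧸ parabolic F β)) := Fintype.ofFinite _
    have : Fintype (MulAction.stabilizer (unip n F)
      ((permGL F v : GL (Fin n) F) : GL (Fin n) F ⧸ parabolic F β)) := Fintype.ofFinite _
    simp only [Nat.card_eq_fintype_card]
    exact MulAction.card_orbit_mul_card_stabilizer_eq_card_group _ _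
  have h2 : Nat.card (MulAction.stabilizer (unip n F)
      ((permGL F v : GL (Fin n) F) : GL (Fin n) F ⧸ parabolic F β)) =
      Nat.card (unipInter F v) := by
    refine Nat.card_congr
      { toFun := fun x => ⟨x.1.1, (stabilizer_unip_eq hβ hv x.1).mp x.2⟩
        invFun := fun x => ⟨⟨x.1, (mem_unipInter_iff.mp x.2).1⟩,
          (stabilizer_unip_eq hβ hv _).mpr x.2⟩
        left_inv := fun x => rfl
        right_inv := fun x => rfl }
  have h3 : (Finset.univ.filter fun p : Fin n × Fin n =>
      p.1 < p.2 ∧ (Fin.revPerm * v : Perm (Fin n))⁻¹⁻¹ p.1 < (Fin.revPerm * v : Perm (Fin n))⁻¹⁻¹ p.2).card +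
      (Finset.univ.filter fun p : Fin n × Fin n => p.1 < p.2 ∧ v⁻¹ p.1 < v⁻¹ p.2).card =
      (Finset.univ.filter fun p : Fin n × Fin n => p.1 < p.2).card := by
    have h4 : (Finset.univ.filter fun p : Fin n × Fin n =>
        p.1 < p.2 ∧ (Fin.revPerm * v : Perm (Fin n))⁻¹⁻¹ p.1 < (Fin.revPerm * v : Perm (Fin n))⁻¹⁻¹ p.2).card =
        (Finset.univ.filter fun p : Fin n × Fin n => p.1 < p.2 ∧ ¬ v⁻¹ p.1 < v⁻¹ p.2).card := by
      refine Finset.card_bij (fun p _ => (v p.2, v p.1)) ?_ ?_ ?_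
      · rintro ⟨i, j⟩ hp
        simp only [Finset.mem_filter, Finset.mem_univ, true_and, inv_inv, Perm.mul_apply,
          Fin.revPerm_apply, Fin.rev_lt_rev, inv_perm_apply_self] at hp ⊢
        exact ⟨hp.2, hp.1.not_gt⟩
      · rintro ⟨i, j⟩ _ ⟨i', j'⟩ _ h
        simpa [and_comm] using h
      · rintro ⟨i, j⟩ hp
        refine ⟨(v⁻¹ j, v⁻¹ i), ?_, by simp⟩
        simp only [Finset.mem_filter, Finset.mem_univ, true_and, inv_inv, Perm.mul_apply,
          Fin.revPerm_apply, Fin.rev_lt_rev, perm_apply_inv_self] at hp ⊢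
        exact ⟨lt_of_le_of_ne (not_lt.mp hp.2) fun h => hp.1.ne' (v⁻¹.injective h), hp.1⟩
    rw [h4, add_comm, ← Finset.filter_filter, ← Finset.filter_filter]
    exact Finset.card_filter_add_card_filter_not _
  rw [h2, card_unipInter, card_unip, ← h3, pow_add] at h1
  rw [card_unipInter]
  exact Nat.eq_of_mul_eq_mul_right (pow_pos Fintype.card_pos _) h1

open Classical in
/-- The index of a parabolic subgroup as a sum over permutations. -/
theorem index_parabolic {β : Fin n → ℕ} (hβ : Monotone β) :
    (parabolic F β).index = ∑ w : Perm (Fin n),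
      if ∀ i j, i < j → β i = β j → w⁻¹ j < w⁻¹ i then Nat.card (unipInter F w) else 0 := by
  let S := {v : Perm (Fin n) // ∀ i j, i < j → β i = β j → v i < v j}
  -- G / P is the disjoint union of the U-orbits of the cosets v P, with v running over the minimal
  -- coset representatives.
  let f : (Σ v : S, MulAction.orbit (unip n F)
      ((permGL F v.1 : GL (Fin n) F) : GL (Fin n) F ⧸ parabolic F β)) →
      GL (Fin n) F ⧸ parabolic F β := fun x => x.2.1
  have hf : Function.Bijective f := by
    constructor
    · rintro ⟨⟨v, hv⟩, ⟨_, ⟨u, rfl⟩⟩⟩ ⟨⟨v', hv'⟩, ⟨y, ⟨u', hu'⟩⟩⟩ h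
      have h' : u • ((permGL F v : GL (Fin n) F) : GL (Fin n) F ⧸ parabolic F β) = y := h
      subst h'
      have h1 : (((u' : GL (Fin n) F) * permGL F v' : GL (Fin n) F) :
          GL (Fin n) F ⧸ parabolic F β) = ((u : GL (Fin n) F) * permGL F v : GL (Fin n) F) := hu'
      rw [eq_comm, QuotientGroup.eq] at h1
      have h2 : (permGL F v)⁻¹ * ((u : GL (Fin n) F)⁻¹ * u') * permGL F v' ∈ parabolic F β := by
        convert h1 using 1
        group
      have h3 := comp_eq_of_conj_mem_parabolic
        (mul_mem (inv_mem (unip_le_borel u.2)) (unip_le_borel u'.2)) h2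
      have h4 := eq_one_of_increasing_on_blocks hβ h3 hv fun i j hij hb => by
        simpa using hv' i j hij hb
      have h5 : v' = v := by rwa [inv_mul_eq_one, eq_comm] at h4
      subst h5
      rfl
    · intro x
      obtain ⟨g, rfl⟩ := QuotientGroup.mk_surjective x
      obtain ⟨b, hb, w, b', hb', rfl⟩ := exists_bruhat g
      obtain ⟨u, hu, t, ht, rfl⟩ := exists_unip_mul_diag hb
      obtain ⟨x, hx, hwx⟩ := exists_increasing_on_blocks hβ w
      refine ⟨⟨⟨w * x, hwx⟩, ⟨_, ⟨⟨u, hu⟩, rfl⟩⟩⟩, ?_⟩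
      change ((u * permGL F (w * x) : GL (Fin n) F) : GL (Fin n) F ⧸ parabolic F β) = _
      rw [QuotientGroup.eq, permGL_mul]
      have htw : (permGL F w)⁻¹ * t * permGL F w ∈ parabolic F β :=
        borel_le_parabolic hβ fun i j hij => by
          rw [permGL_conj_val]
          exact ht _ _ fun h => hij.ne' (w.injective h)
      have := mul_mem (mul_mem (inv_mem (permGL_mem_parabolic (F := F) hx)) htw)
        (borel_le_parabolic hβ hb')
      convert this using 1
      group
  rw [Subgroup.index, ← Nat.card_congr (Equiv.ofBijective f hf), Nat.card_sigma,
    ← Finset.sum_filter]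
  refine Finset.sum_bij (fun v _ => (Fin.revPerm * v.1 : Perm (Fin n))⁻¹) ?_ ?_ ?_ ?_
  · intro v _
    simp only [Finset.mem_filter, Finset.mem_univ, true_and, inv_inv, Perm.mul_apply,
      Fin.revPerm_apply, Fin.rev_lt_rev]
    exact v.2
  · intro v _ v' _ h
    exact Subtype.ext (mul_left_cancel (inv_injective h))
  · intro w hw
    refine ⟨⟨Fin.revPerm * w⁻¹, ?_⟩, Finset.mem_univ _, ?_⟩
    · simpa using hw
    · have : (Fin.revPerm : Perm (Fin n)) * Fin.revPerm = 1 := by ext; simp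
      simp only [← mul_assoc, this, one_mul, inv_inv]
  · intro v _
    exact card_orbit_mul hβ v.2

/-! ## The order of a parabolic subgroup -/

/-- The entries above the diagonal blocks are arbitrary, and the determinant of a block triangular
matrix is the product over the diagonal blocks, so each of these is an arbitrary invertible matrix.
-/
theorem card_parabolic {m : ℕ} (β : Fin n → Fin m) :
    Nat.card (parabolic F fun i => (β i).val) =
      Fintype.card F ^ (Finset.univ.filter fun p : Fin n × Fin n => β p.1 < β p.2).card *
        ∏ k : Fin m, Nat.card (GL (Fin (Finset.univ.filter fun i => β i = k).card) F) := by
  have hdet : ∀ g : parabolic F fun i => (β i).val,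
      g.1.val.det = ∏ k, (g.1.val.toSquareBlock β k).det := fun g =>
    Matrix.BlockTriangular.det_fintype fun i j h => g.2 i j h
  let M : ({p : Fin n × Fin n // β p.1 < β p.2} → F) × ((k : Fin m) → GL {i // β i = k} F) →
      Matrix (Fin n) (Fin n) F := fun x => Matrix.of fun i j =>
    if h : β i < β j then x.1 ⟨(i, j), h⟩ else
      if h : β i = β j then (x.2 (β j)).val ⟨i, h⟩ ⟨j, rfl⟩ else 0
  have hblock : ∀ x k, (M x).toSquareBlock β k = (x.2 k).val := by
    rintro x k
    ext ⟨i, hi⟩ ⟨j, hj⟩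
    subst hj
    simp [M, Matrix.toSquareBlock_def, hi]
  have htri : ∀ x, (M x).BlockTriangular β := by
    intro x i j hij
    simp [M, hij.not_gt, hij.ne']
  let e : parabolic F (fun i => (β i).val) ≃
      ({p : Fin n × Fin n // β p.1 < β p.2} → F) × ((k : Fin m) → GL {i // β i = k} F) :=
    { toFun := fun g => (fun p => g.1.val p.1.1 p.1.2, fun k =>
        GeneralLinearGroup.mkOfDetNeZero (g.1.val.toSquareBlock β k) fun h0 => by
          have h1 := hdet g
          rw [Finset.prod_eq_zero (Finset.mem_univ k) h0] at h1
          exact ((Matrix.isUnit_iff_isUnit_det _).mp g.1.isUnit).ne_zero h1)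
      invFun := fun x => ⟨GeneralLinearGroup.mkOfDetNeZero (M x) (by
          rw [(htri x).det_fintype]
          refine Finset.prod_ne_zero_iff.mpr fun k _ => ?_
          rw [hblock]
          exact ((Matrix.isUnit_iff_isUnit_det _).mp (x.2 k).isUnit).ne_zero),
        fun i j hij => htri x hij⟩
      left_inv := fun g => by
        apply Subtype.ext
        ext i j
        by_cases h : β i < β j
        · exact dif_pos h
        · by_cases h' : β i = β j
          · exact (dif_neg h).trans (dif_pos h')
          · have : β j < β i := lt_of_le_of_ne (not_lt.mp h) (Ne.symm h')
            exact ((dif_neg h).trans (dif_neg h')).trans (g.2 i j this).symm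
      right_inv := fun x => by
        refine Prod.ext ?_ ?_
        · funext p
          change M x p.1.1 p.1.2 = _
          simp [M, p.2]
        · funext k
          apply Units.ext
          exact hblock x k }
  rw [Nat.card_congr e, Nat.card_prod, Nat.card_fun, Nat.card_pi, Nat.card_eq_fintype_card,
    Nat.card_eq_fintype_card, Fintype.card_subtype]
  congr 1
  refine Finset.prod_congr rfl fun k _ => ?_
  rw [card_GL_of_fintype, Fintype.card_subtype]

/-- The `ℓ`-adic valuation of the order of `GL_m(q)`. -/
def glVal (ℓ q m : ℕ) : ℕ := ∑ i ∈ Finset.range m, padicValNat ℓ (q ^ (i + 1) - 1)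

theorem padicValNat_card_GL {ℓ : ℕ} [Fact ℓ.Prime] (hq : ¬ ℓ ∣ Fintype.card F) (m : ℕ) :
    padicValNat ℓ (Nat.card (GL (Fin m) F)) = glVal ℓ (Fintype.card F) m := by
  have hq1 : 1 < Fintype.card F := Fintype.one_lt_card
  have hne : ∀ i : ℕ, Fintype.card F ^ (i + 1) - 1 ≠ 0 := fun i => by
    have : 1 < Fintype.card F ^ (i + 1) := Nat.one_lt_pow (Nat.succ_ne_zero i) hq1
    omega
  rw [card_GL_field, Fin.prod_univ_eq_prod_range (fun i => Fintype.card F ^ m - Fintype.card F ^ i) m,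
    ← Finset.prod_range_reflect]
  have : ∀ i ∈ Finset.range m, Fintype.card F ^ m - Fintype.card F ^ (m - 1 - i) =
      Fintype.card F ^ (m - 1 - i) * (Fintype.card F ^ (i + 1) - 1) := by
    intro i hi
    rw [Finset.mem_range] at hi
    rw [Nat.mul_sub, ← pow_add, mul_one]
    congr 2
    omega
  rw [Finset.prod_congr rfl this, glVal]
  clear this
  generalize hs : Finset.range m = s
  clear hs
  induction s using Finset.induction_on with
  | empty => simp
  | insert a s ha ih =>
    rw [Finset.prod_insert ha, Finset.sum_insert ha, padicValNat.mul
      (mul_ne_zero (pow_ne_zero _ (by omega)) (hne a))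
      (Finset.prod_ne_zero_iff.mpr fun i _ => mul_ne_zero (pow_ne_zero _ (by omega)) (hne i)),
      ih, padicValNat.mul (pow_ne_zero _ (by omega)) (hne a), padicValNat.pow,
      padicValNat.eq_zero_of_not_dvd hq, mul_zero, zero_add]

/-- The unipotent radical has order a power of q, prime to ℓ, so only the Levi factors count. The
additive form avoids truncated subtraction. -/
theorem padicValNat_index_parabolic {ℓ : ℕ} [Fact ℓ.Prime] (hq : ¬ ℓ ∣ Fintype.card F) {m : ℕ}
    (β : Fin n → Fin m) :
    padicValNat ℓ (parabolic F fun i => (β i).val).index +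
      ∑ k : Fin m, glVal ℓ (Fintype.card F) (Finset.univ.filter fun i => β i = k).card =
      glVal ℓ (Fintype.card F) n := by
  have h := (parabolic F fun i => (β i).val).index_mul_card
  have hq0 : Fintype.card F ≠ 0 := Fintype.card_ne_zero
  have hpow : ∀ k : ℕ, padicValNat ℓ (Fintype.card F ^ k) = 0 := fun k => by
    rw [padicValNat.pow, padicValNat.eq_zero_of_not_dvd hq, mul_zero]
  rw [← padicValNat_card_GL hq, ← h, padicValNat.mul Subgroup.index_ne_zero_of_finite
    Nat.card_pos.ne', card_parabolic, padicValNat.mul (pow_ne_zero _ hq0)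
    (Finset.prod_ne_zero_iff.mpr fun k _ => Nat.card_pos.ne'), hpow, zero_add]
  congr 1
  generalize (Finset.univ : Finset (Fin m)) = s
  induction s using Finset.induction_on with
  | empty => simp
  | insert a s ha ih =>
    rw [Finset.prod_insert ha, Finset.sum_insert ha, padicValNat.mul Nat.card_pos.ne'
      (Finset.prod_ne_zero_iff.mpr fun k _ => Nat.card_pos.ne'), ← ih, padicValNat_card_GL hq]

end Count

end Steinberg

namespace Steinberg

open Matrix MonoidAlgebra

section Lattice

open Equiv

variable {n : ℕ} {F R : Type*} [Field F] [Fintype F] [DecidableEq F] [CommRing R]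

/-! ## Translates of the generator of the Steinberg lattice -/

variable (R) in
/-- The sum of the elements of the coset `g B`. -/
noncomputable def cosetSum (g : GL (Fin n) F) : GroupAlg n F R :=
  ∑ b : borel n F, MonoidAlgebra.single (g * (b : GL (Fin n) F)) 1

theorem single_mul_cosetSum (h g : GL (Fin n) F) :
    (MonoidAlgebra.single h 1 : GroupAlg n F R) * cosetSum R g = cosetSum R (h * g) := by
  simp only [cosetSum, Finset.mul_sum, MonoidAlgebra.single_mul_single, mul_one, mul_assoc]

theorem cosetSum_mul {b : GL (Fin n) F} (hb : b ∈ borel n F) (g : GL (Fin n) F) :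
    cosetSum R (g * b) = cosetSum R g := by
  refine Fintype.sum_equiv (Equiv.mulLeft (⟨b, hb⟩ : borel n F)) _ _ fun c => ?_
  simp [mul_assoc]

theorem cosetSum_mul_permGL {w : Perm (Fin n)} {b : GL (Fin n) F}
    (hb : (permGL F w)⁻¹ * b * permGL F w ∈ borel n F) (g : GL (Fin n) F) :
    cosetSum R (g * b * permGL F w) = cosetSum R (g * permGL F w) := by
  rw [← cosetSum_mul hb (g * permGL F w)]
  congr 1
  group

variable (R) in
/-- The sign of a permutation in `R`. -/
noncomputable def sgn (σ : Perm (Fin n)) : R := ((Perm.sign σ : ℤ) : R)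

theorem sgn_mul_self (σ : Perm (Fin n)) : sgn R σ * sgn R σ = 1 := by
  rw [sgn, ← Int.cast_mul, ← Units.val_mul, Int.units_mul_self]
  simp

theorem sgn_swap_mul {i j : Fin n} (hij : i ≠ j) (σ : Perm (Fin n)) :
    sgn R (swap i j * σ) = - sgn R σ := by
  simp [sgn, Perm.sign_swap hij]

theorem isUnit_sgn (σ : Perm (Fin n)) : IsUnit (sgn R σ) :=
  IsUnit.of_mul_eq_one _ (sgn_mul_self σ)

theorem steinbergElt_eq : steinbergElt n F R =
    ∑ σ : Perm (Fin n), sgn R σ • cosetSum R (permGL F σ) := by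
  simp [steinbergElt, cosetSum, sgn, Finset.smul_sum]

theorem single_mul_steinbergElt (g : GL (Fin n) F) :
    (MonoidAlgebra.single g 1 : GroupAlg n F R) * steinbergElt n F R =
      ∑ σ : Perm (Fin n), sgn R σ • cosetSum R (g * permGL F σ) := by
  simp only [steinbergElt_eq, Finset.mul_sum, mul_smul_comm, single_mul_cosetSum]

variable (R) in
/-- The part of a translate of `steinbergElt` over the permutations `σ` with
`σ⁻¹ i < σ⁻¹ j`. -/
noncomputable def ascentSum (i j : Fin n) (g : GL (Fin n) F) : GroupAlg n F R :=
  ∑ σ : Perm (Fin n) with σ⁻¹ i < σ⁻¹ j, sgn R σ • cosetSum R (g * permGL F σ)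

/-- Pairing σ with (i j) σ flips the sign and exchanges the two halves of the sum. -/
theorem single_mul_steinbergElt_eq_sub {i j : Fin n} (hij : i ≠ j) (g : GL (Fin n) F) :
    (MonoidAlgebra.single g 1 : GroupAlg n F R) * steinbergElt n F R =
      ascentSum R i j g - ascentSum R i j (g * permGL F (swap i j)) := by
  rw [single_mul_steinbergElt, ascentSum, ascentSum,
    ← Finset.sum_filter_add_sum_filter_not _ (fun σ : Perm (Fin n) => σ⁻¹ i < σ⁻¹ j), sub_eq_add_neg,
    ← Finset.sum_neg_distrib]
  refine congrArg₂ (· + ·) rfl ?_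
  refine Finset.sum_bij (fun σ _ => swap i j * σ) ?_ ?_ ?_ ?_
  · intro σ hσ
    simp only [Finset.mem_filter, Finset.mem_univ, true_and, _root_.mul_inv_rev, swap_inv,
      Perm.mul_apply, swap_apply_left, swap_apply_right] at hσ ⊢
    exact lt_of_le_of_ne (not_lt.mp hσ) fun h => hij.symm (σ⁻¹.injective h)
  · intro σ _ τ _ h
    exact mul_left_cancel h
  · intro σ hσ
    refine ⟨swap i j * σ, ?_, by rw [← mul_assoc, Equiv.swap_mul_self, one_mul]⟩
    simp only [Finset.mem_filter, Finset.mem_univ, true_and, _root_.mul_inv_rev, swap_inv,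
      Perm.mul_apply, swap_apply_left, swap_apply_right] at hσ ⊢
    exact hσ.not_gt
  · intro σ _
    rw [sgn_swap_mul hij, permGL_mul, mul_assoc g, ← mul_assoc (permGL F (swap i j)),
      permGL_swap_mul_self, one_mul, neg_smul, neg_neg]

/-- Every σ occurring in the sum conjugates h into B, where the coset sums absorb it. -/
theorem ascentSum_mul {i j : Fin n} {h : GL (Fin n) F}
    (hh : ∀ k l, k ≠ l → ¬ (k = i ∧ l = j) → h.val k l = 0) (g : GL (Fin n) F) :
    ascentSum R i j (g * h) = ascentSum R i j g := by
  refine Finset.sum_congr rfl fun σ hσ => ?_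
  rw [cosetSum_mul_permGL]
  intro k l hlk
  rw [permGL_conj_val]
  refine hh _ _ (fun he => hlk.ne' (σ.injective he)) ?_
  rintro ⟨h1, h2⟩
  rw [Finset.mem_filter, ← h1, ← h2, inv_perm_apply_self, inv_perm_apply_self] at hσ
  exact lt_asymm hσ.2 hlk

theorem diag_mul_steinbergElt {t : GL (Fin n) F} (ht : ∀ i j, i ≠ j → t.val i j = 0) :
    (MonoidAlgebra.single t 1 : GroupAlg n F R) * steinbergElt n F R = steinbergElt n F R := by
  rw [single_mul_steinbergElt, steinbergElt_eq]
  refine Finset.sum_congr rfl fun σ _ => ?_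
  rw [← one_mul t, cosetSum_mul_permGL, one_mul]
  intro k l hlk
  rw [permGL_conj_val]
  exact ht _ _ fun he => hlk.ne' (σ.injective he)

theorem swap_mul_steinbergElt {i j : Fin n} (hij : i ≠ j) :
    (MonoidAlgebra.single (permGL F (swap i j)) 1 : GroupAlg n F R) * steinbergElt n F R =
      - steinbergElt n F R := by
  have h1 := single_mul_steinbergElt_eq_sub (R := R) hij (1 : GL (Fin n) F)
  rw [← MonoidAlgebra.one_def, one_mul, one_mul] at h1
  rw [single_mul_steinbergElt_eq_sub hij, permGL_swap_mul_self, h1]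
  abel

/-- Expand all three terms as differences of ascent sums. The GL_2 relation and the absorption of
upper triangular factors leave the same two sums on both sides. This is what keeps the span of the
U-translates stable under adjacent transpositions. -/
theorem swap_mul_transv_mul_steinbergElt {i j : Fin n} (hij : i ≠ j) {y : F} (hy : y ≠ 0) :
    (MonoidAlgebra.single (permGL F (swap i j) * transv hij y) 1 : GroupAlg n F R) *
      steinbergElt n F R =
    (MonoidAlgebra.single (transv hij y⁻¹) 1 : GroupAlg n F R) * steinbergElt n F R -
      steinbergElt n F R := by
  obtain ⟨h, hh, hrel⟩ := exists_swap_mul_transv_mul_swap hij hy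
  have htr : ∀ (z : F) (k l : Fin n), k ≠ l → ¬ (k = i ∧ l = j) → (transv hij z).val k l = 0 := by
    intro z k l hkl hne
    rw [transv_val, if_neg hkl, if_neg, add_zero]
    rintro ⟨rfl, rfl⟩
    exact hne ⟨rfl, rfl⟩
  have h1 := single_mul_steinbergElt_eq_sub (R := R) hij (1 : GL (Fin n) F)
  rw [← MonoidAlgebra.one_def, one_mul, one_mul] at h1
  rw [single_mul_steinbergElt_eq_sub hij, single_mul_steinbergElt_eq_sub hij, h1, hrel,
    ascentSum_mul (htr y), ascentSum_mul hh]
  have h2 := ascentSum_mul (R := R) (htr y⁻¹) 1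
  rw [one_mul] at h2
  rw [h2]
  abel

variable (n F R) in
/-- The `R`-span of the translates of `steinbergElt` by upper unitriangular matrices. -/
noncomputable def unipSpan : Submodule R (GroupAlg n F R) :=
  Submodule.span R {x | ∃ u ∈ unip n F,
    x = (MonoidAlgebra.single u 1 : GroupAlg n F R) * steinbergElt n F R}

/-- It suffices to treat generators of G. Diagonal matrices normalize U and fix the generator of I.
For an adjacent transposition s, a transvection is split off from u so that s normalizes the
remaining factor within U, and the preceding relation applies to the transvection. -/
theorem single_mul_mem_unipSpan (g : GL (Fin n) F) :
    ∀ x ∈ unipSpan n F R, (MonoidAlgebra.single g 1 : GroupAlg n F R) * x ∈ unipSpan n F R := by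
  let H : Submonoid (GL (Fin n) F) :=
    { carrier := {g | ∀ x ∈ unipSpan n F R,
        (MonoidAlgebra.single g 1 : GroupAlg n F R) * x ∈ unipSpan n F R}
      one_mem' := fun x hx => by rwa [← MonoidAlgebra.one_def, one_mul]
      mul_mem' := fun {a b} ha hb x hx => by
        have : (MonoidAlgebra.single (a * b) 1 : GroupAlg n F R) =
          MonoidAlgebra.single a 1 * MonoidAlgebra.single b 1 := by
          rw [MonoidAlgebra.single_mul_single, one_mul]
        rw [this, mul_assoc]
        exact ha _ (hb _ hx) }
  have hH : ∀ g : GL (Fin n) F, (∀ u ∈ unip n F,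
      (MonoidAlgebra.single (g * u) 1 : GroupAlg n F R) * steinbergElt n F R ∈ unipSpan n F R) →
      g ∈ H := by
    intro g hg x hx
    induction hx using Submodule.span_induction with
    | mem x hx =>
      obtain ⟨u, hu, rfl⟩ := hx
      rw [← mul_assoc, MonoidAlgebra.single_mul_single, one_mul]
      exact hg u hu
    | zero => rw [mul_zero]; exact zero_mem _
    | add x y _ _ hx hy => rw [mul_add]; exact add_mem hx hy
    | smul r x _ hx => rw [mul_smul_comm]; exact Submodule.smul_mem _ _ hx
  have hmem : ∀ u ∈ unip n F,
      (MonoidAlgebra.single u 1 : GroupAlg n F R) * steinbergElt n F R ∈ unipSpan n F R :=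
    fun u hu => Submodule.subset_span ⟨u, hu, rfl⟩
  have split : ∀ a b : GL (Fin n) F,
      (MonoidAlgebra.single (a * b) 1 : GroupAlg n F R) * steinbergElt n F R =
      MonoidAlgebra.single a 1 * (MonoidAlgebra.single b 1 * steinbergElt n F R) := by
    intro a b
    rw [← mul_assoc, MonoidAlgebra.single_mul_single, one_mul]
  refine mem_of_generators H ?_ ?_ ?_ g
  · intro t ht
    refine hH t fun u hu => ?_
    have htB : t ∈ borel n F := fun i j hij => ht i j hij.ne'
    have : t * u = t * u * t⁻¹ * t := by group
    rw [this, split, diag_mul_steinbergElt ht]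
    refine hmem _ ⟨mul_mem (mul_mem htB hu.1) (inv_mem htB), fun i => ?_⟩
    have h1 := mul_diag_of_mem_borel htB (inv_mem htB) i
    rw [mul_diag_of_mem_borel (mul_mem htB hu.1) (inv_mem htB), mul_diag_of_mem_borel htB hu.1,
      hu.2, mul_one, ← h1, mul_inv_cancel]
    simp
  · intro i j hij y
    exact hH _ fun u hu => hmem _ (mul_mem (transv_mem_unip hij y) hu)
  · intro i j hij
    refine hH _ fun u hu => ?_
    have hlt : i < j := Fin.lt_def.mpr (by omega)
    set y := u.val i j
    set u0 := u * transv hlt.ne (-y) with hu0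
    have hu0B : u0 ∈ unip n F := mul_mem hu (transv_mem_unip hlt _)
    have hu00 : u0.val i j = 0 := by
      rw [hu0, mul_transv_val, if_pos rfl, hu.2]
      simp [y]
    have hus : permGL F (swap i j) * u0 * permGL F (swap i j) ∈ unip n F := by
      refine ⟨borel_conj_swap hij hu0B.1 hu00, fun k => ?_⟩
      rw [mul_permGL_val, permGL_mul_val, swap_inv]
      exact hu0B.2 _
    have hdec : permGL F (swap i j) * u =
        permGL F (swap i j) * u0 * permGL F (swap i j) *
          (permGL F (swap i j) * transv hlt.ne y) := by
      have h1 : u = u0 * transv hlt.ne y := by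
        rw [hu0, mul_assoc, transv_mul, neg_add_cancel, transv_zero, mul_one]
      calc permGL F (swap i j) * u = permGL F (swap i j) * (u0 * transv hlt.ne y) := by rw [← h1]
        _ = permGL F (swap i j) * u0 * (permGL F (swap i j) * permGL F (swap i j)) *
            transv hlt.ne y := by rw [permGL_swap_mul_self]; group
        _ = _ := by group
    rw [hdec, split]
    by_cases hy : y = 0
    · rw [hy, transv_zero, mul_one, swap_mul_steinbergElt hlt.ne, mul_neg]
      exact neg_mem (hmem _ hus)
    · rw [swap_mul_transv_mul_steinbergElt hlt.ne hy, mul_sub, ← split]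
      exact sub_mem (hmem _ (mul_mem hus (transv_mem_unip hlt _))) (hmem _ hus)

theorem mem_unipSpan (x : lattice n F R) : (x : GroupAlg n F R) ∈ unipSpan n F R := by
  obtain ⟨a, ha⟩ := Submodule.mem_span_singleton.mp x.2
  rw [← ha, smul_eq_mul]
  clear ha
  have hgen : steinbergElt n F R ∈ unipSpan n F R :=
    Submodule.subset_span ⟨1, one_mem _, by rw [← MonoidAlgebra.one_def, one_mul]⟩
  induction a using MonoidAlgebra.induction_linear with
  | zero => rw [zero_mul]; exact zero_mem _
  | add a b ha hb => rw [add_mul]; exact add_mem ha hb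
  | single g r =>
    have : (MonoidAlgebra.single g r : GroupAlg n F R) = r • MonoidAlgebra.single g 1 := by simp
    rw [this, smul_mul_assoc]
    exact Submodule.smul_mem _ _ (single_mul_mem_unipSpan g _ hgen)

end Lattice

end Steinberg

namespace Steinberg

open Matrix MonoidAlgebra

section LinearCharacters

open Equiv

variable {n : ℕ} {F R : Type*} [Field F] [CommRing R]

/-! ## Linear characters of the unipotent group -/

/-- The sum of the superdiagonal entries inside the blocks of `β`. -/
def superdiag (β : Fin n → ℕ) (g : GL (Fin n) F) : F :=
  ∑ i, ∑ j, if i.val + 1 = j.val ∧ β i = β j then g.val i j else 0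

theorem superdiag_mul (β : Fin n → ℕ) {a b : GL (Fin n) F} (ha : a ∈ unip n F) (hb : b ∈ unip n F) :
    superdiag β (a * b) = superdiag β a + superdiag β b := by
  simp only [superdiag, ← Finset.sum_add_distrib]
  refine Finset.sum_congr rfl fun i _ => Finset.sum_congr rfl fun j _ => ?_
  split_ifs with h
  · rw [mul_adjacent_of_mem_borel ha.1 hb.1 h.1, ha.2, hb.2]
    ring
  · simp

theorem superdiag_one (β : Fin n → ℕ) : superdiag β (1 : GL (Fin n) F) = 0 := by
  have := superdiag_mul β (one_mem (unip n F)) (one_mem (unip n F))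
  rw [mul_one] at this
  exact left_eq_add.mp this

theorem superdiag_inv (β : Fin n → ℕ) {a : GL (Fin n) F} (ha : a ∈ unip n F) :
    superdiag β a⁻¹ = - superdiag β a := by
  have := superdiag_mul β ha (inv_mem ha)
  rw [mul_inv_cancel, superdiag_one] at this
  exact (neg_eq_of_add_eq_zero_right this.symm).symm

open Classical in
/-- The function `u ↦ ψ(-superdiag β u)` on the unipotent group, extended by zero. -/
noncomputable def unipChar (ψ : AddChar F R) (β : Fin n → ℕ) (g : GL (Fin n) F) : R :=
  if g ∈ unip n F then ψ (- superdiag β g) else 0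

theorem unipChar_of_mem (ψ : AddChar F R) (β : Fin n → ℕ) {u : GL (Fin n) F} (hu : u ∈ unip n F) :
    unipChar ψ β u = ψ (- superdiag β u) := if_pos hu

theorem unipChar_of_notMem (ψ : AddChar F R) (β : Fin n → ℕ) {u : GL (Fin n) F}
    (hu : u ∉ unip n F) : unipChar ψ β u = 0 := if_neg hu

theorem unipChar_mul_right (ψ : AddChar F R) (β : Fin n → ℕ) {u : GL (Fin n) F}
    (hu : u ∈ unip n F) (g : GL (Fin n) F) :
    unipChar ψ β (g * u) = unipChar ψ β g * ψ (- superdiag β u) := by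
  by_cases hg : g ∈ unip n F
  · rw [unipChar_of_mem _ _ hg, unipChar_of_mem _ _ (mul_mem hg hu), superdiag_mul _ hg hu, neg_add,
      AddChar.map_add_eq_mul]
  · rw [unipChar_of_notMem _ _ hg, unipChar_of_notMem, zero_mul]
    rwa [Subgroup.mul_mem_cancel_right _ hu]

theorem unipChar_mul_left (ψ : AddChar F R) (β : Fin n → ℕ) {u : GL (Fin n) F}
    (hu : u ∈ unip n F) (g : GL (Fin n) F) :
    unipChar ψ β (u * g) = ψ (- superdiag β u) * unipChar ψ β g := by
  by_cases hg : g ∈ unip n F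
  · rw [unipChar_of_mem _ _ hg, unipChar_of_mem _ _ (mul_mem hu hg), superdiag_mul _ hu hg, neg_add,
      AddChar.map_add_eq_mul]
  · rw [unipChar_of_notMem _ _ hg, unipChar_of_notMem, mul_zero]
    rwa [Subgroup.mul_mem_cancel_left _ hu]

theorem unipChar_inv (ψ : AddChar F R) (β : Fin n → ℕ) (g : GL (Fin n) F) :
    unipChar ψ⁻¹ β g⁻¹ = unipChar ψ β g := by
  by_cases hg : g ∈ unip n F
  · rw [unipChar_of_mem _ _ hg, unipChar_of_mem _ _ (inv_mem hg), superdiag_inv _ hg, AddChar.inv_apply,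
      neg_neg]
  · rw [unipChar_of_notMem _ _ hg, unipChar_of_notMem]
    rwa [inv_mem_iff]

theorem addChar_neg_mul_self (ψ : AddChar F R) (y : F) : ψ (-y) * ψ y = 1 := by
  rw [← AddChar.map_add_eq_mul, neg_add_cancel, AddChar.map_zero_eq_one]

variable [Fintype F] [DecidableEq F]

/-- The (unnormalized) idempotent of a linear character of the unipotent group. -/
noncomputable def unipSum (ψ : AddChar F R) (β : Fin n → ℕ) : GroupAlg n F R :=
  ∑ g : GL (Fin n) F, MonoidAlgebra.single g (unipChar ψ β g)

theorem unipSum_mul_single (ψ : AddChar F R) (β : Fin n → ℕ) {u : GL (Fin n) F}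
    (hu : u ∈ unip n F) :
    unipSum ψ β * MonoidAlgebra.single u 1 = ψ (superdiag β u) • unipSum ψ β := by
  rw [unipSum, Finset.sum_mul, Finset.smul_sum]
  refine Fintype.sum_equiv (Equiv.mulRight u) _ _ fun g => ?_
  simp only [MonoidAlgebra.single_mul_single, mul_one, Equiv.coe_mulRight,
    unipChar_mul_right ψ β hu, MonoidAlgebra.smul_single, smul_eq_mul]
  rw [mul_left_comm, mul_comm (ψ _), addChar_neg_mul_self, mul_one]

theorem single_mul_unipSum (ψ : AddChar F R) (β : Fin n → ℕ) {u : GL (Fin n) F}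
    (hu : u ∈ unip n F) :
    MonoidAlgebra.single u 1 * unipSum ψ β = ψ (superdiag β u) • unipSum ψ β := by
  rw [unipSum, Finset.mul_sum, Finset.smul_sum]
  refine Fintype.sum_equiv (Equiv.mulLeft u) _ _ fun g => ?_
  simp only [MonoidAlgebra.single_mul_single, one_mul, Equiv.coe_mulLeft,
    unipChar_mul_left ψ β hu, MonoidAlgebra.smul_single, smul_eq_mul]
  rw [← mul_assoc, mul_comm (ψ (superdiag β u)), addChar_neg_mul_self, one_mul]

theorem sum_unipChar_mul (ψ : AddChar F R) (β : Fin n → ℕ) :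
    ∑ g : GL (Fin n) F, unipChar ψ β g * ψ (superdiag β g) = Nat.card (unip n F) := by
  classical
  have : ∀ g : GL (Fin n) F, unipChar ψ β g * ψ (superdiag β g) =
      if g ∈ unip n F then 1 else 0 := by
    intro g
    split_ifs with h
    · rw [unipChar_of_mem _ _ h, addChar_neg_mul_self]
    · rw [unipChar_of_notMem _ _ h, zero_mul]
  rw [Finset.sum_congr rfl fun g _ => this g, Finset.sum_boole, Nat.card_eq_fintype_card,
    Fintype.card_subtype]

theorem unipSum_mul_self (ψ : AddChar F R) (β : Fin n → ℕ) :
    unipSum ψ β * unipSum ψ β = (Nat.card (unip n F) : R) • unipSum ψ β := by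
  conv_lhs => enter [2]; rw [unipSum]
  rw [Finset.mul_sum, ← sum_unipChar_mul ψ β, Finset.sum_smul]
  refine Finset.sum_congr rfl fun g _ => ?_
  by_cases hg : g ∈ unip n F
  · have : (MonoidAlgebra.single g (unipChar ψ β g) : GroupAlg n F R) =
      unipChar ψ β g • MonoidAlgebra.single g 1 := by simp
    rw [this, mul_smul_comm, unipSum_mul_single ψ β hg, smul_smul]
  · simp [unipChar_of_notMem _ _ hg]

/-! ## The eigenvectors in the Steinberg lattice -/

theorem gen_mem : steinbergElt n F R ∈ lattice n F R := Submodule.mem_span_singleton_self _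

/-- The eigenvector of the unipotent group in the Steinberg lattice with linear character
`ψ ∘ superdiag β`. -/
noncomputable def eigenvec (ψ : AddChar F R) (β : Fin n → ℕ) : lattice n F R :=
  unipSum ψ β • ⟨steinbergElt n F R, gen_mem⟩

theorem eigenvec_coe (ψ : AddChar F R) (β : Fin n → ℕ) :
    (eigenvec ψ β : GroupAlg n F R) = unipSum ψ β * steinbergElt n F R := rfl

theorem unipSum_smul_eigenvec (ψ : AddChar F R) (β : Fin n → ℕ) :
    unipSum ψ β • eigenvec ψ β = (Nat.card (unip n F) : R) • eigenvec ψ β := by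
  rw [eigenvec, smul_smul, unipSum_mul_self, smul_assoc]

/-- Each U-translate of the generator of I is sent to a scalar multiple of the eigenvector, and
these translates span I: every linear character of U contributes at most a line. -/
theorem exists_unipSum_smul_eq (ψ : AddChar F R) (β : Fin n → ℕ) (x : lattice n F R) :
    ∃ r : R, unipSum ψ β • x = r • eigenvec ψ β := by
  suffices h : ∀ y ∈ unipSpan n F R, ∃ r : R,
      unipSum ψ β * y = r • (unipSum ψ β * steinbergElt n F R) by
    obtain ⟨r, hr⟩ := h x (mem_unipSpan x)
    exact ⟨r, Subtype.ext hr⟩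
  intro y hy
  induction hy using Submodule.span_induction with
  | mem y hy =>
    obtain ⟨u, hu, rfl⟩ := hy
    exact ⟨ψ (superdiag β u), by rw [← mul_assoc, unipSum_mul_single ψ β hu, smul_mul_assoc]⟩
  | zero => exact ⟨0, by simp⟩
  | add x y _ _ hx hy =>
    obtain ⟨r, hr⟩ := hx
    obtain ⟨s, hs⟩ := hy
    exact ⟨r + s, by rw [mul_add, hr, hs, add_smul]⟩
  | smul a x _ hx =>
    obtain ⟨r, hr⟩ := hx
    exact ⟨a * r, by rw [mul_smul_comm, hr, smul_smul]⟩

theorem coeff_single_smul (x : lattice n F R) (g h : GL (Fin n) F) :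
    (((MonoidAlgebra.single g 1 : GroupAlg n F R) • x : lattice n F R) : GroupAlg n F R).coeff h =
      (x : GroupAlg n F R).coeff (g⁻¹ * h) := by
  simp [MonoidAlgebra.coeff_single_mul_apply]

theorem coeff_unipSum_smul (ψ : AddChar F R) (β : Fin n → ℕ) (x : lattice n F R)
    (h : GL (Fin n) F) :
    ((unipSum ψ β • x : lattice n F R) : GroupAlg n F R).coeff h =
      ∑ g : GL (Fin n) F, unipChar ψ β g * (x : GroupAlg n F R).coeff (g⁻¹ * h) := by
  simp [unipSum, Finset.sum_mul, MonoidAlgebra.coeff_single_mul_apply, MonoidAlgebra.coeff_sum]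

theorem coeff_eigenvec_mul (ψ : AddChar F R) (β : Fin n → ℕ) {u : GL (Fin n) F}
    (hu : u ∈ unip n F) (g : GL (Fin n) F) :
    (eigenvec ψ β : GroupAlg n F R).coeff (u * g) =
      ψ (- superdiag β u) * (eigenvec ψ β : GroupAlg n F R).coeff g := by
  have h := coeff_single_smul (eigenvec ψ β) u⁻¹ g
  rw [inv_inv] at h
  rw [← h, Submodule.coe_smul, eigenvec_coe, smul_eq_mul, ← mul_assoc,
    single_mul_unipSum ψ β (inv_mem hu), superdiag_inv _ hu, smul_mul_assoc]
  simp

open Classical in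
theorem coeff_steinbergElt (g : GL (Fin n) F) :
    (steinbergElt n F R).coeff g =
      ∑ σ : Perm (Fin n), if (permGL F σ)⁻¹ * g ∈ borel n F then sgn R σ else 0 := by
  rw [steinbergElt, MonoidAlgebra.coeff_sum, Finsupp.finsetSum_apply]
  refine Finset.sum_congr rfl fun σ _ => ?_
  rw [MonoidAlgebra.coeff_sum, Finsupp.finsetSum_apply]
  split_ifs with h
  · rw [Finset.sum_eq_single (⟨_, h⟩ : borel n F)]
    · simp [sgn]
    · intro b _ hb
      rw [MonoidAlgebra.coeff_single, Finsupp.single_apply, if_neg]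
      rintro rfl
      exact hb (Subtype.ext (by simp))
    · simp
  · refine Finset.sum_eq_zero fun b _ => ?_
    rw [MonoidAlgebra.coeff_single, Finsupp.single_apply, if_neg]
    rintro rfl
    exact h (by simp)

theorem eq_of_conj_mem_borel {b : GL (Fin n) F} (hb : b ∈ borel n F) {v w : Perm (Fin n)}
    (h : (permGL F v)⁻¹ * b * permGL F w ∈ borel n F) : v = w := by
  have := comp_eq_of_conj_mem_parabolic hb (β := Fin.val) (v := v) (w := w) h
  have h1 : v⁻¹ * w = 1 := by
    ext j
    exact this j
  exact inv_mul_eq_one.mp h1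

open Classical in
-- By disjointness of Bruhat cells, only the term of the sum over S_n with σ = w can contribute.
theorem coeff_steinbergElt_unip {u : GL (Fin n) F} (hu : u ∈ unip n F) (w : Perm (Fin n)) :
    (steinbergElt n F R).coeff (u⁻¹ * permGL F w) =
      if u ∈ unipInter F w then sgn R w else 0 := by
  rw [coeff_steinbergElt, Finset.sum_eq_single w]
  · refine if_congr ?_ rfl rfl
    rw [mem_unipInter_iff, ← inv_mem_iff (x := _ * _)]
    constructor
    · intro h
      refine ⟨hu, ?_⟩
      convert h using 1
      group
    · intro h
      convert h.2 using 1
      group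
  · intro σ _ hσ
    rw [if_neg]
    intro h
    rw [← mul_assoc] at h
    exact hσ (eq_of_conj_mem_borel (inv_mem hu.1) h)
  · simp

open Classical in
theorem coeff_eigenvec (ψ : AddChar F R) (β : Fin n → ℕ) (w : Perm (Fin n)) :
    (eigenvec ψ β : GroupAlg n F R).coeff (permGL F w) =
      sgn R w * ∑ g : GL (Fin n) F, if g ∈ unipInter F w then unipChar ψ β g else 0 := by
  rw [eigenvec, coeff_unipSum_smul, Finset.mul_sum]
  refine Finset.sum_congr rfl fun g _ => ?_
  by_cases hg : g ∈ unip n F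
  · rw [coeff_steinbergElt_unip hg]
    split_ifs
    · rw [mul_comm]
    · simp
  · rw [unipChar_of_notMem _ _ hg]
    simp

open Classical in
-- Orthogonality on U ∩ w U w⁻¹. The character is trivial there if w⁻¹ reverses the blocks of β.
-- Otherwise some adjacent pair inside a block is kept in order by w⁻¹, and its root subgroup lies
-- in the intersection and carries the nontrivial ψ.
theorem sum_unipChar_unipInter [IsDomain R] {ψ : AddChar F R} (hψ : ψ ≠ 1) {β : Fin n → ℕ}
    (hβ : Monotone β) (w : Perm (Fin n)) :
    ∑ g : GL (Fin n) F, (if g ∈ unipInter F w then unipChar ψ β g else 0) =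
      if ∀ i j, i < j → β i = β j → w⁻¹ j < w⁻¹ i then (Nat.card (unipInter F w) : R) else 0 := by
  split_ifs with hw
  · have : ∀ g : GL (Fin n) F, (if g ∈ unipInter F w then unipChar ψ β g else 0) =
        if g ∈ unipInter F w then 1 else 0 := by
      intro g
      refine if_ctx_congr Iff.rfl (fun hg => ?_) fun _ => rfl
      rw [unipChar_of_mem _ _ (mem_unipInter_iff.mp hg).1]
      have : superdiag β g = 0 := by
        refine Finset.sum_eq_zero fun i _ => Finset.sum_eq_zero fun j _ => ?_
        split_ifs with h
        · have hij : i < j := Fin.lt_def.mpr (by omega)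
          rw [mem_unipInter_iff_val.mp hg i j fun h' => lt_asymm h'.2 (hw i j hij h.2),
            if_neg hij.ne]
        · rfl
      rw [this, neg_zero, AddChar.map_zero_eq_one]
    rw [Finset.sum_congr rfl fun g _ => this g, Finset.sum_boole, Nat.card_eq_fintype_card,
      Fintype.card_subtype]
  · have hex : ∃ i j : Fin n, i.val + 1 = j.val ∧ β i = β j ∧ w⁻¹ i < w⁻¹ j := by
      by_contra! hne
      refine hw (rel_of_rel_adjacent hβ (fun i j k h1 h2 => h2.trans h1) fun i j hij hb =>
        lt_of_le_of_ne (hne i j hij hb) fun he => ?_)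
      have := w⁻¹.injective he
      rw [this] at hij; omega
    obtain ⟨i, j, hij, hb, hlt⟩ := hex
    have hij' : i < j := Fin.lt_def.mpr (by omega)
    obtain ⟨y, hy⟩ := (AddChar.ne_one_iff).mp hψ
    have hmem : transv hij'.ne (-y) ∈ unipInter F w := by
      refine mem_unipInter_iff.mpr ⟨transv_mem_unip hij' _, ?_⟩
      rw [transv_conj_permGL]
      exact transv_mem_borel hlt _
    have hsd : superdiag β (transv hij'.ne (-y)) = -y := by
      rw [superdiag, Finset.sum_eq_single i, Finset.sum_eq_single j]
      · rw [if_pos ⟨hij, hb⟩, transv_val, if_neg hij'.ne, if_pos ⟨rfl, rfl⟩, zero_add]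
      · intro l _ hl
        rw [if_neg fun h => hl (Fin.ext (by omega))]
      · simp
      · intro k _ hk
        refine Finset.sum_eq_zero fun l _ => ?_
        split_ifs with h
        · have hkl : k ≠ l := by rintro rfl; omega
          rw [transv_val, if_neg hkl, if_neg (fun h' => hk h'.1.symm), zero_add]
        · rfl
      · simp
    set S := ∑ g : GL (Fin n) F, (if g ∈ unipInter F w then unipChar ψ β g else 0) with hS
    have h1 : S = S * ψ y := by
      conv_lhs => rw [hS, ← Equiv.sum_comp (Equiv.mulRight (transv hij'.ne (-y)))]
      rw [hS, Finset.sum_mul]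
      refine Finset.sum_congr rfl fun g _ => ?_
      rw [Equiv.coe_mulRight, Subgroup.mul_mem_cancel_right _ hmem,
        unipChar_mul_right ψ β (mem_unipInter_iff.mp hmem).1, hsd, neg_neg, ite_mul, zero_mul]
    have h2 : S * (1 - ψ y) = 0 := by rw [mul_sub, mul_one, ← h1, sub_self]
    exact (mul_eq_zero.mp h2).resolve_right fun h => hy (sub_eq_zero.mp h).symm

/-! ## The form on eigenvectors -/

theorem gowForm_comm (x y : lattice n F R) : gowForm n F R x y = gowForm n F R y x := by
  simp only [gowForm_apply, mul_comm]

theorem gowForm_smul_right (r : R) (x y : lattice n F R) :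
    gowForm n F R x (r • y) = r * gowForm n F R x y :=
  map_smul (gowForm n F R x) r y

theorem single_smul_eq (g : GL (Fin n) F) (r : R) (x : lattice n F R) :
    (MonoidAlgebra.single g r : GroupAlg n F R) • x =
      r • (MonoidAlgebra.single g 1 : GroupAlg n F R) • x := by
  rw [← smul_assoc]
  simp

/-- Invariance of f makes g⁻¹ adjoint to g, and inversion on U replaces the character by its
inverse. -/
theorem gowForm_unipSum_smul (ψ : AddChar F R) (β : Fin n → ℕ) (x y : lattice n F R) :
    gowForm n F R (unipSum ψ β • x) y = gowForm n F R x (unipSum ψ⁻¹ β • y) := by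
  rw [unipSum, unipSum, Finset.sum_smul, Finset.sum_smul, map_sum, map_sum, LinearMap.sum_apply]
  refine Fintype.sum_equiv (Equiv.inv _) _ _ fun g => ?_
  rw [gowForm_single_smul, Equiv.inv_apply, unipChar_inv, single_smul_eq g⁻¹ (unipChar ψ β g),
    gowForm_smul_right]

open Classical in
theorem gowForm_gen (x : lattice n F R) :
    gowForm n F R x ⟨steinbergElt n F R, gen_mem⟩ =
      ∑ σ : Perm (Fin n), sgn R σ * (x : GroupAlg n F R).coeff (permGL F σ) := by
  rw [gowForm_apply]
  simp only [coeff_steinbergElt, Finset.mul_sum]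
  rw [Finset.sum_comm]
  refine Finset.sum_congr rfl fun σ _ => ?_
  rw [Finset.sum_eq_single (permGL F σ : GL (Fin n) F ⧸ borel n F)]
  · have h : (permGL F σ : GL (Fin n) F ⧸ borel n F) =
        ((permGL F σ : GL (Fin n) F ⧸ borel n F).out : GL (Fin n) F) :=
      (QuotientGroup.out_eq' _).symm
    rw [if_pos (QuotientGroup.eq.mp h), coeff_eq_of_mk_eq x h, mul_comm]
  · intro c _ hc
    rw [if_neg, mul_zero]
    intro h
    have := QuotientGroup.eq.mpr h
    rw [QuotientGroup.out_eq'] at this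
    exact hc this.symm
  · simp

/-- Moving the idempotent to the other side costs a factor |U| and leaves the pairing of an
eigenvector with the generator. There the signs cancel and the orders of the groups U ∩ w U w⁻¹
remain, for w⁻¹ reversing the blocks; these add up to the index. -/
theorem gowForm_eigenvec [IsDomain R] {ψ : AddChar F R} (hψ : ψ ≠ 1) {β : Fin n → ℕ}
    (hβ : Monotone β) :
    gowForm n F R (eigenvec ψ β) (eigenvec ψ⁻¹ β) =
      (Nat.card (unip n F) : R) * ((parabolic F β).index : R) := by
  classical
  have hψ' : ψ⁻¹ ≠ 1 := inv_ne_one.mpr hψ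
  conv_lhs => rw [eigenvec]
  rw [gowForm_unipSum_smul, unipSum_smul_eigenvec, map_smul, smul_eq_mul, gowForm_comm, gowForm_gen,
    index_parabolic hβ, Nat.cast_sum]
  congr 1
  refine Finset.sum_congr rfl fun σ _ => ?_
  rw [coeff_eigenvec, ← mul_assoc, sgn_mul_self, one_mul, sum_unipChar_unipInter hψ' hβ]
  split_ifs <;> simp

theorem coeff_eigenvec_decreasing [IsDomain R] {ψ : AddChar F R} (hψ : ψ ≠ 1) {β : Fin n → ℕ}
    (hβ : Monotone β) {w : Perm (Fin n)} (hw : ∀ i j, i < j → β i = β j → w⁻¹ j < w⁻¹ i) :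
    (eigenvec ψ β : GroupAlg n F R).coeff (permGL F w) =
      sgn R w * (Nat.card (unipInter F w) : R) := by
  classical
  rw [coeff_eigenvec, sum_unipChar_unipInter hψ hβ, if_pos hw]

theorem isUnit_coeff_eigenvec [IsDomain R] (hq : IsUnit (Fintype.card F : R)) {ψ : AddChar F R}
    (hψ : ψ ≠ 1) {β : Fin n → ℕ} (hβ : Monotone β) {w : Perm (Fin n)}
    (hw : ∀ i j, i < j → β i = β j → w⁻¹ j < w⁻¹ i) :
    IsUnit ((eigenvec ψ β : GroupAlg n F R).coeff (permGL F w)) := by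
  rw [coeff_eigenvec_decreasing hψ hβ hw, card_unipInter, Nat.cast_pow]
  exact (isUnit_sgn w).mul (hq.pow _)

theorem isUnit_card_unip (hq : IsUnit (Fintype.card F : R)) :
    IsUnit (Nat.card (unip n F) : R) := by
  rw [card_unip, Nat.cast_pow]
  exact hq.pow _

/-! ## Refinements -/

omit [Fintype F] [DecidableEq F] in
-- Projection to the diagonal blocks is multiplicative.
theorem mul_val_of_mem_parabolic {β : Fin n → ℕ} {a b : GL (Fin n) F} (ha : a ∈ parabolic F β)
    (hb : b ∈ parabolic F β) {i j : Fin n} (hij : β i = β j) :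
    (a * b).val i j = ∑ k, if β k = β j then a.val i k * b.val k j else 0 := by
  rw [Units.val_mul, Matrix.mul_apply]
  refine Finset.sum_congr rfl fun k _ => ?_
  split_ifs with h
  · rfl
  · rcases lt_or_gt_of_ne h with h | h
    · rw [ha i k (by rw [hij]; exact h), zero_mul]
    · rw [hb k j h, mul_zero]

omit [Fintype F] [DecidableEq F] in
theorem exists_unip_val (f : Fin n → Fin n → F) :
    ∃ u ∈ unip n F, ∀ i j, i < j → u.val i j = f i j := by
  let M : Matrix (Fin n) (Fin n) F := Matrix.of fun i j =>
    if i < j then f i j else if i = j then 1 else 0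
  have hM : M.det = 1 := by
    rw [det_of_isUpperTriangular (M := M)]
    · simp [M]
    · intro i j hij
      have hij' : j < i := hij
      simp [M, hij'.not_gt, hij'.ne']
  refine ⟨GeneralLinearGroup.mkOfDetNeZero M (by rw [hM]; exact one_ne_zero),
    mem_unip_iff.mpr fun i j hij => ?_, fun i j hij => ?_⟩
  · exact if_neg hij
  · exact if_pos hij

/-- Conjugation by x = w w'⁻¹ carries the block diagonal part of u into U and matches the
superdiagonal entries inside blocks of β' with those inside blocks of β. Hence translating E_β by
x⁻¹ produces the character of β' on the relevant coefficients. -/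
theorem coeff_eigenvec_refine (ψ : AddChar F R) {β β' : Fin n → ℕ} (hβ : Monotone β)
    (hβ' : Monotone β') (href : ∀ i j, β' i = β' j → β i = β j) {w w' : Perm (Fin n)}
    (h1 : ∀ i, β (w i) = β i) (h2 : ∀ i j, i < j → β i = β j → w j < w i)
    (h1' : ∀ i, β' (w' i) = β' i) (h2' : ∀ i j, i < j → β' i = β' j → w' j < w' i)
    {u : GL (Fin n) F} (hu : u ∈ unip n F) :
    (eigenvec ψ β : GroupAlg n F R).coeff (permGL F (w * w'⁻¹) * (u * permGL F w')) =
      ψ (- superdiag β' u) * (eigenvec ψ β : GroupAlg n F R).coeff (permGL F w) := by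
  -- The factor m is the block diagonal part of u with respect to β'.
  obtain ⟨m, hm, hmval⟩ := exists_unip_val fun i j => if β' i = β' j then u.val i j else 0
  have hB := borel_le_parabolic (F := F) hβ'
  have hmu : ∀ i j, β' i = β' j → m.val i j = u.val i j := by
    intro i j hij
    by_cases h : i < j
    · rw [hmval i j h, if_pos hij]
    · rw [mem_unip_iff.mp hm i j h, mem_unip_iff.mp hu i j h]
  set x := w * w'⁻¹ with hx
  have hinv1 := perm_inv_comp_eq h1'
  have hinv2 := inv_decreasing_on_blocks h1' h2'
  -- the part of `u` outside the blocks of `β'` is absorbed by the Borel subgroup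
  have hright : (permGL F w')⁻¹ * (m⁻¹ * u) * permGL F w' ∈ borel n F := by
    intro k l hlk
    rw [permGL_conj_val]
    have hmem : m⁻¹ * u ∈ unip n F := mul_mem (inv_mem hm) hu
    rcases (hβ' hlk.le).lt_or_eq with hlt | he
    · refine hmem.1 _ _ (lt_of_not_ge fun h => ?_)
      have := hβ' h
      rw [h1', h1'] at this
      omega
    · have he' : β' (w' k) = β' (w' l) := by rw [h1', h1', he]
      rw [mul_val_of_mem_parabolic (hB (inv_mem hm).1) (hB hu.1) he']
      have h3 := mul_val_of_mem_parabolic (hB (inv_mem hm).1) (hB hm.1) he'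
      rw [inv_mul_cancel, Units.val_one, Matrix.one_apply_ne fun h => hlk.ne' (w'.injective h)] at h3
      -- Inside a block, m⁻¹ u has the same entries as m⁻¹ m = 1, because u and m agree there.
      refine Eq.trans (Finset.sum_congr rfl fun k' _ => ?_) h3.symm
      split_ifs with h
      · rw [hmu _ _ h]
      · rfl
  have hpos : ∀ i j, i ≠ j → m.val (x⁻¹ i) (x⁻¹ j) ≠ 0 → i < j := by
    intro i j hij hne
    have hlt : x⁻¹ i < x⁻¹ j := by
      by_contra h
      rw [mem_unip_iff.mp hm _ _ h, if_neg fun he => hij (x⁻¹.injective he)] at hne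
      exact hne rfl
    have hb : β' (x⁻¹ i) = β' (x⁻¹ j) := by
      by_contra h
      rw [hmval _ _ hlt, if_neg h] at hne
      exact hne rfl
    have h3 := h2 _ _ (hinv2 _ _ hlt hb) (href _ _ (by rw [hinv1, hinv1, hb]))
    have hxx : ∀ k, w (w'⁻¹ (x⁻¹ k)) = k := fun k => perm_apply_inv_self x k
    rwa [hxx, hxx] at h3
  have hconj : ∀ i j, (permGL F x * m * (permGL F x)⁻¹).val i j = m.val (x⁻¹ i) (x⁻¹ j) := by
    intro i j
    have := permGL_conj_val (F := F) x⁻¹ x⁻¹ m i j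
    rwa [permGL_inv, inv_inv] at this
  have hm' : permGL F x * m * (permGL F x)⁻¹ ∈ unip n F := by
    rw [mem_unip_iff]
    intro i j hij
    rw [hconj]
    split_ifs with h
    · rw [h]; exact hm.2 _
    · by_contra hne
      exact hij (hpos i j h hne)
  have hsd : superdiag β (permGL F x * m * (permGL F x)⁻¹) = superdiag β' u := by
    simp only [superdiag, hconj]
    rw [← Equiv.sum_comp x]
    refine Finset.sum_congr rfl fun a _ => ?_
    rw [← Equiv.sum_comp x]
    refine Finset.sum_congr rfl fun b _ => ?_
    rw [inv_perm_apply_self, inv_perm_apply_self]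
    have hiff : a < b → β' a = β' b → (((x a).val + 1 = (x b).val ∧ β (x a) = β (x b)) ↔
        a.val + 1 = b.val) := fun hab hb =>
      adjacent_reversal_iff hβ hβ' href h1 h2 hinv1 hinv2 hab hb
    by_cases hab : a < b
    · by_cases hb : β' a = β' b
      · simp only [hiff hab hb, hb, and_true, hmu a b hb]
      · rw [hmval a b hab]
        simp [hb]
    · rw [mem_unip_iff.mp hm a b hab]
      have h3 : ¬ (a.val + 1 = b.val ∧ β' a = β' b) := fun h => hab (Fin.lt_def.mpr (by omega))
      rw [if_neg h3]
      split_ifs with h4 h5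
      · rw [h5] at h4; omega
      · rfl
      · rfl
  have hdecomp : permGL F x * (u * permGL F w') =
      permGL F x * m * (permGL F x)⁻¹ * (permGL F w * ((permGL F w')⁻¹ * (m⁻¹ * u) * permGL F w')) := by
    rw [hx, permGL_mul, permGL_inv]
    group
  rw [hdecomp, coeff_eigenvec_mul ψ β hm', hsd, coeff_mul_borel _ _ _ hright]

/-- Compare coefficients at w': on the left stands |U| times the coefficient of E_β at w, which is a
unit because it is a power of q up to sign. -/
theorem exists_smul_eigenvec_refine [IsDomain R] (hq : IsUnit (Fintype.card F : R))
    {ψ : AddChar F R} (hψ : ψ ≠ 1) {β β' : Fin n → ℕ} (hβ : Monotone β) (hβ' : Monotone β')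
    (href : ∀ i j, β' i = β' j → β i = β j) :
    ∃ x : GL (Fin n) F, ∃ κ : R, IsUnit κ ∧
      unipSum ψ β' • (MonoidAlgebra.single x⁻¹ 1 : GroupAlg n F R) • eigenvec ψ β =
        κ • eigenvec ψ β' := by
  obtain ⟨w, h1, h2⟩ := exists_block_reversal hβ
  obtain ⟨w', h1', h2'⟩ := exists_block_reversal hβ'
  refine ⟨permGL F (w * w'⁻¹), ?_⟩
  obtain ⟨κ, hκ⟩ := exists_unipSum_smul_eq ψ β'
    ((MonoidAlgebra.single (permGL F (w * w'⁻¹))⁻¹ 1 : GroupAlg n F R) • eigenvec ψ β)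
  refine ⟨κ, ?_, hκ⟩
  have h3 := congrArg (fun y : lattice n F R => (y : GroupAlg n F R).coeff (permGL F w')) hκ
  simp only [coeff_unipSum_smul, coeff_single_smul, inv_inv] at h3
  have h4 : ∀ g : GL (Fin n) F, unipChar ψ β' g * (eigenvec ψ β : GroupAlg n F R).coeff
      (permGL F (w * w'⁻¹) * (g⁻¹ * permGL F w')) = unipChar ψ β' g * ψ (superdiag β' g) *
        (eigenvec ψ β : GroupAlg n F R).coeff (permGL F w) := by
    intro g
    by_cases hg : g ∈ unip n F
    · rw [coeff_eigenvec_refine ψ hβ hβ' href h1 h2 h1' h2' (inv_mem hg), superdiag_inv _ hg,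
        neg_neg, mul_assoc]
    · rw [unipChar_of_notMem _ _ hg]
      simp
  rw [Finset.sum_congr rfl fun g _ => h4 g, ← Finset.sum_mul, sum_unipChar_mul] at h3
  have h5 : IsUnit (κ * (eigenvec ψ β' : GroupAlg n F R).coeff (permGL F w')) := by
    have h6 : ((κ • eigenvec ψ β' : lattice n F R) : GroupAlg n F R).coeff (permGL F w') =
        κ * (eigenvec ψ β' : GroupAlg n F R).coeff (permGL F w') := by simp
    rw [← h6, ← h3]
    exact (isUnit_card_unip hq).mul
      (isUnit_coeff_eigenvec hq hψ hβ (inv_decreasing_on_blocks h1 h2))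
  exact isUnit_of_mul_isUnit_left h5

/-- The coefficient of the transition from a refinement back, in terms of the indices. -/
theorem exists_smul_eigenvec_coarsen [IsDomain R] (hq : IsUnit (Fintype.card F : R))
    {ψ : AddChar F R} (hψ : ψ ≠ 1) {β β' : Fin n → ℕ} (hβ : Monotone β) (hβ' : Monotone β')
    (href : ∀ i j, β' i = β' j → β i = β j) :
    ∃ a : GroupAlg n F R, ∃ κ κ' : R, IsUnit κ' ∧
      a • eigenvec ψ β' = κ • eigenvec ψ β ∧
      κ * ((parabolic F β).index : R) = κ' * ((parabolic F β').index : R) := by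
  have hψ' : ψ⁻¹ ≠ 1 := inv_ne_one.mpr hψ
  obtain ⟨x, κ', hκ', h⟩ := exists_smul_eigenvec_refine hq hψ' hβ hβ' href
  obtain ⟨κ, hκ⟩ := exists_unipSum_smul_eq ψ β
    ((MonoidAlgebra.single x 1 : GroupAlg n F R) • eigenvec ψ β')
  refine ⟨unipSum ψ β * MonoidAlgebra.single x 1, κ, κ', hκ', by rw [mul_smul, hκ], ?_⟩
  have hc := isUnit_card_unip (n := n) hq
  set c : R := (Nat.card (unip n F) : R)
  have e1 := gowForm_eigenvec hψ' hβ'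
  have e2 := gowForm_eigenvec hψ' hβ
  rw [inv_inv] at e1 e2
  -- The same value of the form is computed twice: through the line of β' it gives κ' [G : P_β'],
  -- and after moving operators across through the line of β it gives κ [G : P_β], up to a common
  -- factor |U|.
  have h1 : gowForm n F R (unipSum ψ⁻¹ β' • (MonoidAlgebra.single x⁻¹ 1 : GroupAlg n F R) •
      eigenvec ψ⁻¹ β) (eigenvec ψ β') = κ' * (c * ((parabolic F β').index : R)) := by
    rw [h, map_smul, LinearMap.smul_apply, e1, smul_eq_mul]
  have h2 : gowForm n F R (unipSum ψ⁻¹ β' • (MonoidAlgebra.single x⁻¹ 1 : GroupAlg n F R) •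
      eigenvec ψ⁻¹ β) (eigenvec ψ β') =
      c * gowForm n F R (eigenvec ψ⁻¹ β)
        ((MonoidAlgebra.single x 1 : GroupAlg n F R) • eigenvec ψ β') := by
    rw [gowForm_unipSum_smul, inv_inv, unipSum_smul_eigenvec, map_smul, smul_eq_mul,
      gowForm_single_smul, inv_inv, one_mul]
  have h3 : c * gowForm n F R (eigenvec ψ⁻¹ β)
      ((MonoidAlgebra.single x 1 : GroupAlg n F R) • eigenvec ψ β') =
      κ * (c * ((parabolic F β).index : R)) := by
    have h4 := gowForm_unipSum_smul ψ⁻¹ β (eigenvec ψ⁻¹ β)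
      ((MonoidAlgebra.single x 1 : GroupAlg n F R) • eigenvec ψ β')
    rw [unipSum_smul_eigenvec, map_smul (gowForm n F R), LinearMap.smul_apply, smul_eq_mul, inv_inv,
      hκ, gowForm_smul_right, e2] at h4
    exact h4
  rw [h2, h3] at h1
  refine hc.mul_left_cancel ?_
  linear_combination h1

end LinearCharacters

end Steinberg

namespace Steinberg

open Matrix MonoidAlgebra

section Whittaker

open Equiv

variable {n : ℕ} {F : Type*} [Field F]

/-! ## Linear characters of the unipotent group in modules over the group algebra -/

/-- The column `y`, extended by zero to rows from `k` on. -/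
def extCol {k : Fin n} (y : {i : Fin n // i < k} → F) (i : Fin n) : F :=
  if h : i < k then y ⟨i, h⟩ else 0

theorem extCol_of_le {k : Fin n} (y : {i : Fin n // i < k} → F) {i : Fin n} (h : k ≤ i) :
    extCol y i = 0 := dif_neg h.not_gt

theorem extCol_of_lt {k : Fin n} (y : {i : Fin n // i < k} → F) {i : Fin n} (h : i < k) :
    extCol y i = y ⟨i, h⟩ := dif_pos h

theorem extCol_add {k : Fin n} (y z : {i : Fin n // i < k} → F) (i : Fin n) :
    extCol (y + z) i = extCol y i + extCol z i := by
  simp only [extCol]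
  split_ifs <;> simp

theorem col_mul_val {k : Fin n} (y : {i : Fin n // i < k} → F) (M : Matrix (Fin n) (Fin n) F)
    (i l : Fin n) :
    ((1 + vecMulVec (extCol y) (Pi.single k 1)) * M) i l = M i l + extCol y i * M k l := by
  rw [add_mul, one_mul, Matrix.add_apply, vecMulVec_mul, vecMulVec_apply, single_one_vecMul]
  rfl

theorem col_mul_col {k : Fin n} (y z : {i : Fin n // i < k} → F) :
    ((1 + vecMulVec (extCol y) (Pi.single k 1)) * (1 + vecMulVec (extCol z) (Pi.single k 1)) :
      Matrix (Fin n) (Fin n) F) = 1 + vecMulVec (extCol (y + z)) (Pi.single k 1) := by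
  ext i l
  rw [col_mul_val]
  simp only [Matrix.add_apply, vecMulVec_apply, extCol_add, extCol_of_le z le_rfl, Matrix.one_apply,
    Pi.single_apply]
  by_cases h : k = l
  · subst h; simp; ring
  · simp [h, Ne.symm h]

theorem col_zero (k : Fin n) :
    (1 + vecMulVec (extCol (0 : {i : Fin n // i < k} → F)) (Pi.single k 1) :
      Matrix (Fin n) (Fin n) F) = 1 := by
  ext i l
  simp [vecMulVec_apply, extCol]

/-- The unitriangular matrix whose only nontrivial column is the `k`-th one. -/
def colGL {k : Fin n} (y : {i : Fin n // i < k} → F) : GL (Fin n) F where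
  val := 1 + vecMulVec (extCol y) (Pi.single k 1)
  inv := 1 + vecMulVec (extCol (-y)) (Pi.single k 1)
  val_inv := by rw [col_mul_col, add_neg_cancel, col_zero]
  inv_val := by rw [col_mul_col, neg_add_cancel, col_zero]

theorem colGL_val {k : Fin n} (y : {i : Fin n // i < k} → F) (i l : Fin n) :
    (colGL y).val i l = (if i = l then 1 else 0) + if l = k then extCol y i else 0 := by
  simp [colGL, vecMulVec_apply, Matrix.one_apply, Pi.single_apply]

theorem colGL_mul_val {k : Fin n} (y : {i : Fin n // i < k} → F) (g : GL (Fin n) F)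
    (i l : Fin n) : (colGL y * g).val i l = g.val i l + extCol y i * g.val k l :=
  col_mul_val y g.val i l

theorem colGL_mul {k : Fin n} (y z : {i : Fin n // i < k} → F) :
    colGL y * colGL z = colGL (y + z) := Units.ext (col_mul_col y z)

theorem colGL_zero (k : Fin n) : colGL (0 : {i : Fin n // i < k} → F) = 1 := Units.ext (col_zero k)

theorem colGL_mem_unip {k : Fin n} (y : {i : Fin n // i < k} → F) : colGL y ∈ unip n F := by
  rw [mem_unip_iff]
  intro i l hil
  rw [colGL_val, add_eq_left]
  split_ifs with h
  · exact extCol_of_le y (h ▸ not_lt.mp hil)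
  · rfl

/-- Conjugation by matrices with trivial rows from `k` on and trivial columns from `t ≥ k` on
preserves the unitriangular matrices with trivial columns before `t`. -/
theorem conj_val_of_trivial {k t : ℕ} (hkt : k ≤ t) {h u : GL (Fin n) F}
    (hrow : ∀ i j : Fin n, k ≤ i.val → h.val i j = if i = j then 1 else 0)
    (hcol : ∀ i j : Fin n, t ≤ j.val → h.val i j = if i = j then 1 else 0)
    (hu : ∀ i j : Fin n, j.val < t → u.val i j = if i = j then 1 else 0) :
    (∀ i j : Fin n, j.val < t → (h⁻¹ * u * h).val i j = if i = j then 1 else 0) ∧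
    (∀ i j : Fin n, t ≤ j.val → (h⁻¹ * u * h).val i j = (h⁻¹ * u).val i j) ∧
    (∀ i j : Fin n, k ≤ i.val → t ≤ j.val → (h⁻¹ * u * h).val i j = u.val i j) := by
  have hinv : ∀ i j : Fin n, k ≤ i.val → (h⁻¹).val i j = if i = j then 1 else 0 := by
    intro i j hi
    have h1 : (h * h⁻¹).val i j = (h⁻¹).val i j := by
      rw [Units.val_mul, Matrix.mul_apply, Finset.sum_eq_single i]
      · rw [hrow i i hi, if_pos rfl, one_mul]
      · intro l _ hl
        rw [hrow i l hi, if_neg hl.symm, zero_mul]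
      · simp
    rw [← h1, mul_inv_cancel, Units.val_one, Matrix.one_apply]
  have h2 : ∀ i j : Fin n, t ≤ j.val → (h⁻¹ * u * h).val i j = (h⁻¹ * u).val i j := by
    intro i j hj
    rw [Units.val_mul, Matrix.mul_apply, Finset.sum_eq_single j]
    · rw [hcol j j hj, if_pos rfl, mul_one]
    · intro l _ hl
      rw [hcol l j hj, if_neg hl, mul_zero]
    · simp
  refine ⟨fun i j hj => ?_, h2, fun i j hi hj => ?_⟩
  · have h3 : ∀ m, (u * h).val m j = h.val m j := by
      intro m
      rw [Units.val_mul, Matrix.mul_apply, Finset.sum_eq_single m]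
      · by_cases hm : m.val < t
        · rw [hu m m hm, if_pos rfl, one_mul]
        · rw [hrow m j (by omega), if_neg (fun he : m = j => hm (he ▸ hj)), mul_zero]
      · intro l _ hl
        by_cases hlt : l.val < t
        · rw [hu m l hlt, if_neg hl.symm, zero_mul]
        · rw [hrow l j (by omega), if_neg (fun he : l = j => hlt (he ▸ hj)), mul_zero]
      · simp
    rw [mul_assoc, Units.val_mul, Matrix.mul_apply]
    simp only [h3]
    rw [← Matrix.mul_apply, ← Units.val_mul, inv_mul_cancel, Units.val_one, Matrix.one_apply]
  · rw [h2 i j hj, Units.val_mul, Matrix.mul_apply, Finset.sum_eq_single i]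
    · rw [hinv i i hi, if_pos rfl, one_mul]
    · intro l _ hl
      rw [hinv i l hi, if_neg hl.symm, zero_mul]
    · simp

theorem conj_mem_unip_of_trivial {k t : ℕ} (hkt : k ≤ t) {h u : GL (Fin n) F}
    (hrow : ∀ i j : Fin n, k ≤ i.val → h.val i j = if i = j then 1 else 0)
    (hcol : ∀ i j : Fin n, t ≤ j.val → h.val i j = if i = j then 1 else 0)
    (hu : ∀ i j : Fin n, j.val < t → u.val i j = if i = j then 1 else 0) (huU : u ∈ unip n F) :
    h⁻¹ * u * h ∈ unip n F := by
  obtain ⟨h1, -, h3⟩ := conj_val_of_trivial hkt hrow hcol hu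
  rw [mem_unip_iff] at huU ⊢
  intro i j hij
  by_cases hj : j.val < t
  · exact h1 i j hj
  · have : j.val ≤ i.val := not_lt.mp hij
    rw [h3 i j (by omega) (by omega), huU i j hij]

/-- The nonzero row a is completed to an invertible matrix acting on the first k coordinates, with a
as its last row r = k - 1. Such a matrix carries the character a of the k-th column group to the one
that reads only the superdiagonal entry (k - 1, k). -/
theorem exists_row_eq {k : Fin n} {a : {i : Fin n // i < k} → F} (ha : a ≠ 0) :
    ∃ (g : GL (Fin n) F) (r : Fin n), r.val + 1 = k.val ∧
      (∀ i j : Fin n, k ≤ i → g.val i j = if i = j then 1 else 0) ∧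
      (∀ i j : Fin n, k ≤ j → g.val i j = if i = j then 1 else 0) ∧
      ∀ j, g.val r j = extCol a j := by
  obtain ⟨⟨i0, hi0⟩, ha0⟩ := Function.ne_iff.mp ha
  have hk : 0 < k.val := by
    have : i0.val < k.val := hi0
    omega
  let r : Fin n := ⟨k.val - 1, by omega⟩
  have hr : r < k := Fin.lt_def.mpr (by simp [r]; omega)
  let M : Matrix (Fin n) (Fin n) F := (1 : Matrix (Fin n) (Fin n) F).updateRow i0 (extCol a)
  have hM : M.det ≠ 0 := by
    have h1 : M.det = extCol a i0 := by
      rw [← cramer_transpose_apply, transpose_one, cramer_one]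
      rfl
    rw [h1, extCol_of_lt a hi0]
    exact ha0
  let R : GL (Fin n) F := GeneralLinearGroup.mkOfDetNeZero M hM
  have hR : ∀ i j, R.val i j = if i = i0 then extCol a j else if i = j then 1 else 0 := by
    intro i j
    change M i j = _
    simp only [M, updateRow_apply, Matrix.one_apply]
  refine ⟨permGL F (swap i0 r) * R, r, by simp [r]; omega, fun i j hi => ?_, fun i j hj => ?_,
    fun j => ?_⟩
  · have h1 : i ≠ i0 := (hi0.trans_le hi).ne'
    have h2 : i ≠ r := (hr.trans_le hi).ne'
    rw [permGL_mul_val, swap_inv, swap_apply_of_ne_of_ne h1 h2, hR, if_neg h1]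
  · have h1 : j ≠ i0 := (hi0.trans_le hj).ne'
    have h2 : j ≠ r := (hr.trans_le hj).ne'
    rw [permGL_mul_val, swap_inv, hR]
    rcases eq_or_ne i r with rfl | hir
    · rw [swap_apply_right, if_pos rfl, extCol_of_le a hj, if_neg h2.symm]
    · have h3 : swap i0 r i ≠ i0 := by
        intro h
        exact hir ((swap i0 r).injective (h.trans (swap_apply_right i0 r).symm))
      rw [if_neg h3]
      refine if_congr ?_ rfl rfl
      rw [swap_apply_eq_iff, swap_apply_of_ne_of_ne h1 h2]
  · rw [permGL_mul_val, swap_inv, swap_apply_right, hR, if_pos rfl]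

variable [Fintype F] [DecidableEq F] {S : Type*} [CommRing S]

theorem map_sum_addChar {ι : Type*} (ψ : AddChar F S) (s : Finset ι) (f : ι → F) :
    ψ (∑ i ∈ s, f i) = ∏ i ∈ s, ψ (f i) := by
  classical
  induction s using Finset.induction_on with
  | empty => simp
  | insert i s hi h => rw [Finset.sum_insert hi, Finset.prod_insert hi, AddChar.map_add_eq_mul, h]

theorem sum_single (g : GL (Fin n) F) {ι : Type*} (s : Finset ι) (f : ι → S) :
    ∑ i ∈ s, (MonoidAlgebra.single g (f i) : GroupAlg n F S) =
      MonoidAlgebra.single g (∑ i ∈ s, f i) := by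
  classical
  induction s using Finset.induction_on with
  | empty => simp
  | insert i s hi h => rw [Finset.sum_insert hi, Finset.sum_insert hi, MonoidAlgebra.single_add, h]

/-- The sum factors over the coordinates. Vanishing of the one-variable sums is a hypothesis, so
that no domain assumption on S is needed. -/
theorem sum_addChar_dotProduct {ψ : AddChar F S} (hsum : ∀ y : F, y ≠ 0 → ∑ a, ψ (a * y) = 0)
    {ι : Type*} [Fintype ι] [DecidableEq ι] (y : ι → F) :
    ∑ a : ι → F, ψ (∑ i, a i * y i) = if y = 0 then (Fintype.card F : S) ^ Fintype.card ι else 0 := by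
  have h1 : ∀ a : ι → F, ψ (∑ i, a i * y i) = ∏ i, ψ (a i * y i) := fun a =>
    map_sum_addChar ψ _ _
  simp only [h1]
  rw [← Fintype.piFinset_univ, ← Finset.prod_univ_sum (fun _ => Finset.univ) fun i a => ψ (a * y i)]
  split_ifs with h
  · simp [h]
  · obtain ⟨i, hi⟩ := Function.ne_iff.mp h
    exact Finset.prod_eq_zero (Finset.mem_univ i) (hsum _ hi)

/-- The sum of the superdiagonal entries in the columns belonging to `c`. -/
def superdiagOn (c : Fin n → Bool) (g : GL (Fin n) F) : F :=
  ∑ i, ∑ j, if i.val + 1 = j.val ∧ c j = true then g.val i j else 0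

variable {X : Type*} [AddCommGroup X] [Module (GroupAlg n F S) X]

/-- `v` is an eigenvector with character `ψ ∘ superdiagOn c` of the group of unitriangular
matrices with trivial columns before `k`. -/
def IsEigenFrom (ψ : AddChar F S) (k : ℕ) (c : Fin n → Bool) (v : X) : Prop :=
  ∀ u ∈ unip n F, (∀ i j : Fin n, j.val < k → u.val i j = if i = j then 1 else 0) →
    (MonoidAlgebra.single u 1 : GroupAlg n F S) • v =
      (MonoidAlgebra.single 1 (ψ (superdiagOn c u)) : GroupAlg n F S) • v

theorem single_smul_single_smul (g h : GL (Fin n) F) (r s : S) (v : X) :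
    (MonoidAlgebra.single g r : GroupAlg n F S) • (MonoidAlgebra.single h s : GroupAlg n F S) • v =
      (MonoidAlgebra.single (g * h) (r * s) : GroupAlg n F S) • v := by
  rw [smul_smul, MonoidAlgebra.single_mul_single]

/-- The group of k-th columns is abelian, so v splits into its eigencomponents. On a nonzero
component with character a, the matrices with later columns only still act as before. If a = 0,
column k is ignored. Otherwise GL_k, acting on the first k coordinates, moves a to the last
coordinate without affecting the later superdiagonal entries. -/
theorem exists_isEigenFrom_pred {ψ : AddChar F S} (hsum : ∀ y : F, y ≠ 0 → ∑ a, ψ (a * y) = 0)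
    (hq : IsUnit (Fintype.card F : S)) (k : Fin n) {c : Fin n → Bool} {v : X} (hv : v ≠ 0)
    (hc : IsEigenFrom ψ (k.val + 1) c v) :
    ∃ (c' : Fin n → Bool) (a : GroupAlg n F S), a • v ≠ 0 ∧ IsEigenFrom ψ k.val c' (a • v) := by
  let I := {i : Fin n // i < k}
  let P : (I → F) → GroupAlg n F S := fun a =>
    ∑ y : I → F, MonoidAlgebra.single (colGL y) (ψ (- ∑ i, a i * y i))
  -- the projections add up to a unit multiple of the identity
  have hP : ∑ a, P a = MonoidAlgebra.single 1 ((Fintype.card F : S) ^ Fintype.card I) := by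
    simp only [P]
    rw [Finset.sum_comm, Finset.sum_eq_single 0]
    · rw [colGL_zero, sum_single]
      simp
    · intro y _ hy
      rw [sum_single]
      have h1 := sum_addChar_dotProduct hsum (-y)
      rw [if_neg (neg_ne_zero.mpr hy)] at h1
      have h2 : ∀ a : I → F, ψ (- ∑ i, a i * y i) = ψ (∑ i, a i * (-y) i) := fun a => by
        congr 1
        simp [Finset.sum_neg_distrib]
      rw [Finset.sum_congr rfl fun a _ => h2 a, h1, MonoidAlgebra.single_zero]
    · simp
  obtain ⟨a, ha⟩ : ∃ a, P a • v ≠ 0 := by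
    by_contra! h
    have h1 : (∑ a, P a) • v = 0 := by rw [Finset.sum_smul]; exact Finset.sum_eq_zero fun a _ => h a
    rw [hP] at h1
    obtain ⟨r, hr⟩ := (hq.pow (Fintype.card I)).exists_left_inv
    have h2 := congrArg (fun z => (MonoidAlgebra.single 1 r : GroupAlg n F S) • z) h1
    simp only [single_smul_single_smul, smul_zero, one_mul, hr, ← MonoidAlgebra.one_def,
      one_smul] at h2
    exact hv h2
  -- the eigenvalue of the column group
  have hcol : ∀ z : I → F, (MonoidAlgebra.single (colGL z) 1 : GroupAlg n F S) • P a • v =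
      (MonoidAlgebra.single 1 (ψ (∑ i, a i * z i)) : GroupAlg n F S) • P a • v := by
    intro z
    rw [smul_smul, smul_smul]
    congr 1
    simp only [P, Finset.mul_sum, MonoidAlgebra.single_mul_single, one_mul, colGL_mul]
    refine Fintype.sum_equiv (Equiv.addLeft z) _ _ fun y => ?_
    rw [Equiv.coe_addLeft]
    congr 1
    rw [← AddChar.map_add_eq_mul]
    congr 1
    simp only [Pi.add_apply, mul_add, Finset.sum_add_distrib]
    ring
  -- The eigenvector condition at k + 1 says nothing about column k, so the value of c at k is
  -- arbitrary and is reset.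
  set c0 : Fin n → Bool := Function.update c k false with hc0
  have hsd : ∀ {u u' : GL (Fin n) F},
      (∀ i j : Fin n, j ≤ k → u.val i j = if i = j then 1 else 0) →
      (∀ i j : Fin n, k ≤ i → k < j → u.val i j = u'.val i j) →
      (∀ i j : Fin n, j < k → u'.val i j = if i = j then 1 else 0) →
      superdiagOn c u = superdiagOn c0 u' := by
    intro u u' h1 h2 h3
    refine Finset.sum_congr rfl fun i _ => Finset.sum_congr rfl fun j _ => ?_
    rcases lt_trichotomy j k with hj | hj | hj
    · rw [h1 i j hj.le, h3 i j hj, hc0, Function.update_of_ne hj.ne]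
    · subst hj
      rw [h1 i j le_rfl, hc0, Function.update_self]
      by_cases hij : i.val + 1 = j.val
      · have : i ≠ j := by rintro rfl; omega
        simp [this]
      · simp [hij]
    · rw [hc0, Function.update_of_ne hj.ne']
      refine if_ctx_congr Iff.rfl (fun hij => ?_) fun _ => rfl
      refine h2 i j (Fin.le_def.mpr ?_) hj
      have : k.val < j.val := hj
      omega
  have hinner : ∀ u ∈ unip n F, (∀ i j : Fin n, j ≤ k → u.val i j = if i = j then 1 else 0) →
      (MonoidAlgebra.single u 1 : GroupAlg n F S) • P a • v =
      (MonoidAlgebra.single 1 (ψ (superdiagOn c0 u)) : GroupAlg n F S) • P a • v := by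
    intro u hu hucol
    simp only [P, Finset.sum_smul, Finset.smul_sum]
    refine Finset.sum_congr rfl fun y _ => ?_
    have hrow : ∀ i j : Fin n, k.val ≤ i.val → (colGL y).val i j = if i = j then 1 else 0 := by
      intro i j hi
      rw [colGL_val, extCol_of_le y hi]
      simp
    have hcl : ∀ i j : Fin n, k.val + 1 ≤ j.val → (colGL y).val i j = if i = j then 1 else 0 := by
      intro i j hj
      rw [colGL_val, if_neg (fun h : j = k => by rw [h] at hj; omega), add_zero]
    have hu' : ∀ i j : Fin n, j.val < k.val + 1 → u.val i j = if i = j then 1 else 0 :=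
      fun i j hj => hucol i j (Fin.le_def.mpr (by omega))
    obtain ⟨e1, -, e3⟩ := conj_val_of_trivial (Nat.le_succ _) hrow hcl hu'
    have hmem := conj_mem_unip_of_trivial (Nat.le_succ _) hrow hcl hu' hu
    have h1 := hc _ hmem e1
    rw [hsd (u' := u) (fun i j hj => e1 i j (by have : j.val ≤ k.val := hj; omega))
      (fun i j hi hj => e3 i j hi hj) (fun i j hj => hucol i j hj.le)] at h1
    have h2 : (MonoidAlgebra.single u 1 : GroupAlg n F S) •
        (MonoidAlgebra.single (colGL y) (ψ (- ∑ i, a i * y i)) : GroupAlg n F S) • v =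
        (MonoidAlgebra.single (colGL y) (ψ (- ∑ i, a i * y i)) : GroupAlg n F S) •
        (MonoidAlgebra.single ((colGL y)⁻¹ * u * colGL y) 1 : GroupAlg n F S) • v := by
      rw [single_smul_single_smul, single_smul_single_smul, one_mul, mul_one]
      congr 2
      group
    rw [h2, h1, single_smul_single_smul, single_smul_single_smul, mul_one, one_mul, mul_comm]
  have hfull : ∀ u ∈ unip n F, (∀ i j : Fin n, j < k → u.val i j = if i = j then 1 else 0) →
      (MonoidAlgebra.single u 1 : GroupAlg n F S) • P a • v =
      (MonoidAlgebra.single 1 (ψ (∑ i : I, a i * u.val i.1 k + superdiagOn c0 u)) :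
        GroupAlg n F S) • P a • v := by
    -- Split off the k-th column of u. The remaining factor has trivial columns up to k and the same
    -- superdiagonal entries beyond k.
    intro u hu hucol
    let y : I → F := fun i => u.val i.1 k
    have hyv : ∀ i l, (colGL (-y) * u).val i l = u.val i l + extCol (-y) i * u.val k l :=
      colGL_mul_val _ _
    have hmem : colGL (-y) * u ∈ unip n F := mul_mem (colGL_mem_unip _) hu
    have hcols : ∀ i j : Fin n, j ≤ k →
        (colGL (-y) * u).val i j = if i = j then 1 else 0 := by
      intro i j hj
      rw [hyv]
      rcases hj.lt_or_eq with hlt | rfl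
      · rw [hucol i j hlt, hucol k j hlt, if_neg hlt.ne', mul_zero, add_zero]
      · by_cases hij : i < j
        · rw [extCol_of_lt _ hij, hu.2, if_neg hij.ne]
          simp [y]
        · rw [extCol_of_le _ (not_lt.mp hij), zero_mul, add_zero, mem_unip_iff.mp hu i j hij]
    have h1 := hinner _ hmem hcols
    have h2 : superdiagOn c0 (colGL (-y) * u) = superdiagOn c0 u := by
      refine Finset.sum_congr rfl fun i _ => Finset.sum_congr rfl fun j _ => ?_
      refine if_ctx_congr Iff.rfl (fun hij => ?_) fun _ => rfl
      have hjk : j ≠ k := by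
        rintro rfl
        rw [hc0, Function.update_self] at hij
        exact absurd hij.2 (by simp)
      rcases lt_or_gt_of_ne hjk with h | h
      · rw [hcols i j h.le, hucol i j h]
      · have hki : k ≤ i := Fin.le_def.mpr (by have : k.val < j.val := h; omega)
        rw [hyv, extCol_of_le _ hki, zero_mul, add_zero]
    have h3 : u = colGL y * (colGL (-y) * u) := by
      rw [← mul_assoc, colGL_mul, add_neg_cancel, colGL_zero, one_mul]
    have h4 : (MonoidAlgebra.single u 1 : GroupAlg n F S) • P a • v =
        (MonoidAlgebra.single (colGL y) 1 : GroupAlg n F S) •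
        (MonoidAlgebra.single (colGL (-y) * u) 1 : GroupAlg n F S) • P a • v := by
      rw [single_smul_single_smul, ← h3, one_mul]
    rw [h4, h1, h2, single_smul_single_smul, one_mul, mul_one, AddChar.map_add_eq_mul]
    have h5 : (MonoidAlgebra.single (colGL y) (ψ (superdiagOn c0 u)) : GroupAlg n F S) • P a • v =
        (MonoidAlgebra.single 1 (ψ (superdiagOn c0 u)) : GroupAlg n F S) •
        (MonoidAlgebra.single (colGL y) 1 : GroupAlg n F S) • P a • v := by
      rw [single_smul_single_smul, mul_one, one_mul]
    rw [h5, hcol, single_smul_single_smul, one_mul, mul_comm]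
  by_cases ha0 : a = 0
  · refine ⟨c0, P a, ha, fun u hu hucol => ?_⟩
    rw [hfull u hu hucol, ha0]
    simp
  · obtain ⟨g, r, hr, hgrow, hgcol, hgr⟩ := exists_row_eq ha0
    refine ⟨Function.update c0 k true, MonoidAlgebra.single g 1 * P a, ?_, ?_⟩
    · intro h
      apply ha
      have := congrArg (fun z => (MonoidAlgebra.single g⁻¹ 1 : GroupAlg n F S) • z) h
      simpa only [mul_smul, single_smul_single_smul, inv_mul_cancel, one_mul, smul_zero,
        ← MonoidAlgebra.one_def, one_smul] using this
    · intro u hu hucol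
      obtain ⟨e1, e2, e3⟩ := conj_val_of_trivial le_rfl hgrow hgcol hucol
      have hmem := conj_mem_unip_of_trivial le_rfl hgrow hgcol hucol hu
      have h1 := hfull _ hmem e1
      -- Row r of g is a, so pairing a with the k-th column of g⁻¹ u is reading the (r, k) entry of
      -- g g⁻¹ u = u.
      have h2 : ∑ i : I, a i * (g⁻¹ * u * g).val i.1 k = u.val r k := by
        have h3 : (g * (g⁻¹ * u)).val r k = u.val r k := by rw [mul_inv_cancel_left]
        have h3' : (g * (g⁻¹ * u)).val r k = ∑ i, g.val r i * (g⁻¹ * u).val i k := by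
          rw [Units.val_mul g, Matrix.mul_apply]
        rw [← h3, h3',
          ← Finset.sum_filter_add_sum_filter_not Finset.univ (fun i : Fin n => i < k)]
        have h4 : ∑ i : Fin n with ¬ i < k, g.val r i * (g⁻¹ * u).val i k = 0 := by
          refine Finset.sum_eq_zero fun i hi => ?_
          rw [Finset.mem_filter] at hi
          rw [hgr, extCol_of_le a (not_lt.mp hi.2), zero_mul]
        rw [h4, add_zero, ← Finset.sum_subtype_eq_sum_filter, Finset.subtype_univ]
        refine Finset.sum_congr rfl fun i _ => ?_
        rw [hgr, extCol_of_lt a i.2, e2 _ _ le_rfl]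
      have h5 : u.val r k + superdiagOn c0 (g⁻¹ * u * g) =
          superdiagOn (Function.update c0 k true) u := by
        have h6 : u.val r k = ∑ i : Fin n, ∑ j : Fin n,
            if i.val + 1 = j.val ∧ j = k then u.val i j else 0 := by
          rw [Finset.sum_eq_single r, Finset.sum_eq_single k]
          · rw [if_pos ⟨hr, rfl⟩]
          · intro j _ hj
            rw [if_neg fun h => hj h.2]
          · simp
          · intro i _ hi
            refine Finset.sum_eq_zero fun j _ => if_neg ?_
            rintro ⟨h, rfl⟩
            exact hi (Fin.ext (by omega))
          · simp
        rw [h6, superdiagOn, superdiagOn, ← Finset.sum_add_distrib]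
        refine Finset.sum_congr rfl fun i _ => ?_
        rw [← Finset.sum_add_distrib]
        refine Finset.sum_congr rfl fun j _ => ?_
        by_cases hj : j = k
        · subst hj
          simp [hc0]
        · rw [if_neg fun h => hj h.2, zero_add, Function.update_of_ne hj]
          refine if_ctx_congr Iff.rfl (fun hij => ?_) fun _ => rfl
          rcases lt_or_gt_of_ne hj with h | h
          · rw [e1 i j h, hucol i j h]
          · have : k.val < j.val := h
            exact e3 i j (by omega) (by omega)
      rw [h2, h5] at h1
      have h7 : (MonoidAlgebra.single u 1 : GroupAlg n F S) •
          (MonoidAlgebra.single g 1 : GroupAlg n F S) • P a • v =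
          (MonoidAlgebra.single g 1 : GroupAlg n F S) •
          (MonoidAlgebra.single (g⁻¹ * u * g) 1 : GroupAlg n F S) • P a • v := by
        rw [single_smul_single_smul, single_smul_single_smul]
        congr 2
        group
      rw [mul_smul, h7, h1, single_smul_single_smul, single_smul_single_smul]
      simp

/-- A nonzero module over the group algebra contains an eigenvector of the unipotent group for one
of the linear characters `ψ ∘ superdiag β`. -/
theorem exists_unipSum_smul_ne_zero {ψ : AddChar F S}
    (hsum : ∀ y : F, y ≠ 0 → ∑ a, ψ (a * y) = 0) (hq : IsUnit (Fintype.card F : S)) {x : X}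
    (hx : x ≠ 0) :
    ∃ β : Fin n → ℕ, Monotone β ∧ ∃ a : GroupAlg n F S, unipSum ψ β • a • x ≠ 0 := by
  have key : ∀ m ≤ n, ∃ (c : Fin n → Bool) (a : GroupAlg n F S),
      a • x ≠ 0 ∧ IsEigenFrom ψ (n - m) c (a • x) := by
    intro m
    induction m with
    | zero =>
      refine fun _ => ⟨fun _ => false, 1, by rwa [one_smul], fun u _ hu => ?_⟩
      have h1 : u = 1 := by
        ext i j
        rw [hu i j (by have := j.2; omega), Units.val_one, Matrix.one_apply]
      have h2 : superdiagOn (fun _ => false) u = 0 := by simp [superdiagOn]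
      rw [h1] at h2 ⊢
      rw [h2, AddChar.map_zero_eq_one]
    | succ m ih =>
      intro hm
      obtain ⟨c, a, ha, hc⟩ := ih (by omega)
      have hk : n - (m + 1) < n := by omega
      have h1 : n - m = (⟨n - (m + 1), hk⟩ : Fin n).val + 1 := by simp; omega
      rw [h1] at hc
      obtain ⟨c', b, hb, hc'⟩ := exists_isEigenFrom_pred hsum hq ⟨n - (m + 1), hk⟩ ha hc
      exact ⟨c', b * a, by rwa [mul_smul], by rwa [mul_smul]⟩
  obtain ⟨c, a, ha, hc⟩ := key n le_rfl
  rw [Nat.sub_self] at hc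
  -- A new block begins at each column whose superdiagonal entry is not seen by the character.
  let β : Fin n → ℕ := fun i => (Finset.univ.filter fun j : Fin n => j ≤ i ∧ c j = false).card
  have hβ : Monotone β := fun i j hij => Finset.card_le_card fun l hl => by
    simp only [Finset.mem_filter, Finset.mem_univ, true_and] at hl ⊢
    exact ⟨hl.1.trans hij, hl.2⟩
  have hlink : ∀ i j : Fin n, i.val + 1 = j.val → (β i = β j ↔ c j = true) := by
    intro i j hij
    have hlt : i < j := Fin.lt_def.mpr (by omega)
    cases hcj : c j with
    | false =>
      simp only [Bool.false_eq_true, iff_false]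
      refine (Finset.card_lt_card ((Finset.ssubset_iff).mpr ⟨j, ?_, fun l hl => ?_⟩)).ne
      · simp [hlt]
      · simp only [Finset.mem_insert, Finset.mem_filter, Finset.mem_univ, true_and] at hl ⊢
        rcases hl with rfl | hl
        · exact ⟨le_rfl, hcj⟩
        · exact ⟨hl.1.trans hlt.le, hl.2⟩
    | true =>
      simp only [iff_true]
      refine congrArg Finset.card (Finset.filter_congr fun l _ => ?_)
      refine and_congr_left fun hl => ?_
      have hlj : l.val ≠ j.val := fun h => by
        rw [Fin.ext h, hcj] at hl
        exact absurd hl (by simp)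
      rw [Fin.le_def, Fin.le_def]
      omega
  have hsd : ∀ u : GL (Fin n) F, superdiagOn c u = superdiag β u := by
    intro u
    refine Finset.sum_congr rfl fun i _ => Finset.sum_congr rfl fun j _ => ?_
    refine if_congr (and_congr_right fun hij => ?_) rfl rfl
    exact (hlink i j hij).symm
  refine ⟨β, hβ, a, ?_⟩
  have h1 : unipSum ψ β • a • x =
      (MonoidAlgebra.single 1 (Nat.card (unip n F) : S) : GroupAlg n F S) • a • x := by
    rw [unipSum, Finset.sum_smul, ← sum_unipChar_mul ψ β, ← sum_single, Finset.sum_smul]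
    refine Finset.sum_congr rfl fun g _ => ?_
    by_cases hg : g ∈ unip n F
    · have h2 := hc g hg fun i j h => absurd h (Nat.not_lt_zero _)
      have h3 : (MonoidAlgebra.single g (unipChar ψ β g) : GroupAlg n F S) • a • x =
          (MonoidAlgebra.single 1 (unipChar ψ β g) : GroupAlg n F S) •
          (MonoidAlgebra.single g 1 : GroupAlg n F S) • a • x := by
        rw [single_smul_single_smul, one_mul, mul_one]
      rw [h3, h2, single_smul_single_smul, one_mul, hsd]
    · rw [unipChar_of_notMem _ _ hg, zero_mul, MonoidAlgebra.single_zero, MonoidAlgebra.single_zero]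
  rw [h1]
  intro h2
  obtain ⟨r, hr⟩ := (isUnit_card_unip (n := n) hq).exists_left_inv
  have h3 := congrArg (fun z => (MonoidAlgebra.single 1 r : GroupAlg n F S) • z) h2
  simp only [single_smul_single_smul, smul_zero, one_mul, hr, ← MonoidAlgebra.one_def,
    one_smul] at h3
  exact ha h3

end Whittaker

end Steinberg

namespace Steinberg

open Matrix MonoidAlgebra

/-! ### Additive characters of F and units of R -/

section Characters

/-- Compose an F_p-linear functional that is nonzero at 1 with the character of F_p sending 1 to ζ.
-/
theorem exists_addChar_ne_one {F R : Type*} [Field F] [Finite F] [CommRing R] {p : ℕ} [CharP F p]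
    {ζ : R} (hζ : IsPrimitiveRoot ζ p) : ∃ ψ : AddChar F R, ψ ≠ 1 := by
  have hp : Fact p.Prime := ⟨CharP.char_is_prime F p⟩
  let _ : Algebra (ZMod p) F := ZMod.algebra F p
  obtain ⟨f, hf⟩ : ∃ f : Module.Dual (ZMod p) F, f 1 ≠ 0 := by
    by_contra! h
    exact one_ne_zero ((Module.forall_dual_apply_eq_zero_iff (ZMod p) (1 : F)).mp h)
  let χ : AddChar (ZMod p) R := AddChar.zmodChar p hζ.pow_eq_one
  refine ⟨χ.compAddMonoidHom f.toAddMonoidHom, fun h => ?_⟩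
  have h1 := DFunLike.congr_fun h ((f 1)⁻¹ • (1 : F))
  have h2 : f ((f 1)⁻¹ • (1 : F)) = 1 := by rw [map_smul, smul_eq_mul, inv_mul_cancel₀ hf]
  have h3 : χ 1 = 1 := by
    rw [← h2]
    exact h1
  rw [AddChar.zmodChar_apply, ZMod.val_one, pow_one] at h3
  exact hζ.ne_one hp.out.one_lt h3

theorem sum_addChar_mul_eq_zero {F R : Type*} [Field F] [Fintype F] [CommRing R] [IsDomain R]
    {ψ : AddChar F R} (hψ : ψ ≠ 1) (y : F) (hy : y ≠ 0) : ∑ a, ψ (a * y) = 0 := by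
  rw [← AddChar.sum_eq_zero_of_ne_one hψ]
  exact Fintype.sum_equiv (Equiv.mulRight₀ y hy) _ _ fun a => rfl

/-- A Bézout relation between ℓ and k would put 1 into the maximal ideal. -/
theorem isUnit_natCast_of_not_dvd {R : Type*} [CommRing R] [IsLocalRing R] {ℓ : ℕ}
    (hℓ : ℓ.Prime) (hmax : IsLocalRing.maximalIdeal R = Ideal.span {(ℓ : R)}) {k : ℕ}
    (hk : ¬ ℓ ∣ k) : IsUnit (k : R) := by
  by_contra h
  have h1 : (k : R) ∈ IsLocalRing.maximalIdeal R := (IsLocalRing.mem_maximalIdeal _).mpr h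
  have h2 : (ℓ : R) ∈ IsLocalRing.maximalIdeal R := hmax ▸ Ideal.mem_span_singleton_self _
  have h3 : IsCoprime (ℓ : ℤ) (k : ℤ) :=
    Nat.isCoprime_iff_coprime.mpr ((Nat.Prime.coprime_iff_not_dvd hℓ).mpr hk)
  obtain ⟨a, b, hab⟩ := h3.map (Int.castRingHom R)
  refine (IsLocalRing.mem_maximalIdeal (1 : R)).mp ?_ isUnit_one
  rw [← hab]
  simp only [eq_intCast, Int.cast_natCast]
  exact Ideal.add_mem _ (Ideal.mul_mem_left _ _ h2) (Ideal.mul_mem_left _ _ h1)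

theorem not_isUnit_natCast {R : Type*} [CommRing R] [IsLocalRing R] {ℓ : ℕ}
    (hmax : IsLocalRing.maximalIdeal R = Ideal.span {(ℓ : R)}) : ¬ IsUnit (ℓ : R) := by
  rw [← mem_nonunits_iff, ← IsLocalRing.mem_maximalIdeal, hmax]
  exact Ideal.mem_span_singleton_self _

theorem exists_pow_mul_unit_eq {R : Type*} [CommRing R] [IsLocalRing R] {ℓ : ℕ}
    (hℓ : ℓ.Prime) (hmax : IsLocalRing.maximalIdeal R = Ideal.span {(ℓ : R)}) {k : ℕ}
    (hk : k ≠ 0) : ∃ u : R, IsUnit u ∧ (k : R) = (ℓ : R) ^ padicValNat ℓ k * u := by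
  have : Fact ℓ.Prime := ⟨hℓ⟩
  obtain ⟨m, hm⟩ := pow_padicValNat_dvd (p := ℓ) (n := k)
  refine ⟨m, isUnit_natCast_of_not_dvd hℓ hmax fun ⟨t, ht⟩ => ?_, ?_⟩
  · apply pow_succ_padicValNat_not_dvd hk (p := ℓ)
    exact ⟨t, by rw [pow_succ, mul_assoc, ← ht]; exact hm⟩
  · conv_lhs => rw [hm]
    push_cast
    rfl

end Characters

/-! ### Passage from the lattice I to its reduction L -/

section Transfer

variable {n : ℕ} {F R : Type*} [Field F] [Fintype F] [DecidableEq F] [CommRing R] {ℓ : ℕ}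

theorem toReduction_surjective : Function.Surjective (toReduction n F R ℓ) := by
  intro y
  obtain ⟨x, hx⟩ := Submodule.Quotient.mk_surjective _ ((reductionRep n F R ℓ).asModuleEquiv y)
  refine ⟨x, ?_⟩
  change (reductionRep n F R ℓ).asModuleEquiv.symm (Submodule.Quotient.mk x) = y
  rw [hx, LinearEquiv.symm_apply_apply]

theorem toReduction_eq_zero_iff (x : lattice n F R) :
    toReduction n F R ℓ x = 0 ↔ ∃ z : lattice n F R, x = (ℓ : R) • z := by
  have h1 : toReduction n F R ℓ x =
    (reductionRep n F R ℓ).asModuleEquiv.symm (Submodule.Quotient.mk x) := rfl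
  rw [h1, map_eq_zero_iff _ (LinearEquiv.injective _), Submodule.Quotient.mk_eq_zero,
    Submodule.ideal_span_singleton_smul, Submodule.mem_smul_pointwise_iff_exists]
  simp only [Submodule.mem_top, true_and, eq_comm]

theorem toReduction_smul (r : R) (x : lattice n F R) :
    toReduction n F R ℓ (r • x) =
      (MonoidAlgebra.single 1 (Ideal.Quotient.mk _ r) : ResGroupAlg n F R ℓ) •
        toReduction n F R ℓ x := by
  have h1 : r • x = (MonoidAlgebra.single 1 r : GroupAlg n F R) • x := by
    rw [single_smul_eq, ← MonoidAlgebra.one_def, one_smul]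
  rw [h1, LinearMap.map_smulₛₗ]
  congr 1
  simp

theorem toReduction_mem_of_isUnit_smul {M : Submodule (ResGroupAlg n F R ℓ) (Reduction n F R ℓ)}
    {r : R} (hr : IsUnit r) {x : lattice n F R} (h : toReduction n F R ℓ (r • x) ∈ M) :
    toReduction n F R ℓ x ∈ M := by
  obtain ⟨s, hs⟩ := hr.exists_left_inv
  have h1 : x = s • r • x := by rw [smul_smul, hs, one_smul]
  rw [h1, toReduction_smul]
  exact M.smul_mem _ h

theorem toReduction_smul_mem {M : Submodule (ResGroupAlg n F R ℓ) (Reduction n F R ℓ)}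
    (a : GroupAlg n F R) {x : lattice n F R} (h : toReduction n F R ℓ x ∈ M) :
    toReduction n F R ℓ (a • x) ∈ M := by
  rw [LinearMap.map_smulₛₗ]
  exact M.smul_mem _ h

/-- The reduction modulo `ℓ` of the character `ψ`. -/
def redChar (ℓ : ℕ) (ψ : AddChar F R) : AddChar F (ResField R ℓ) :=
  (Ideal.Quotient.mk (Ideal.span {(ℓ : R)})).toMonoidHom.compAddChar ψ

theorem redChar_apply (ψ : AddChar F R) (y : F) :
    redChar ℓ ψ y = Ideal.Quotient.mk _ (ψ y) := rfl

theorem reduceCoeff_unipSum (ψ : AddChar F R) (β : Fin n → ℕ) :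
    reduceCoeff n F R ℓ (unipSum ψ β) = unipSum (redChar ℓ ψ) β := by
  rw [unipSum, unipSum, map_sum]
  refine Finset.sum_congr rfl fun g _ => ?_
  rw [MonoidAlgebra.mapRingHom_single]
  congr 1
  rw [unipChar, unipChar]
  split_ifs
  · rfl
  · exact map_zero _

variable (F) in
/-- The `ℓ`-adic valuation of the index of the parabolic subgroup with block function `β`. -/
noncomputable def parabolicVal (ℓ : ℕ) (β : Fin n → ℕ) : ℕ := padicValNat ℓ (parabolic F β).index

theorem theta_parabolic {β : Fin n → ℕ} (hβ : Monotone β) :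
    theta ℓ (⟨parabolic F β, borel_le_parabolic hβ⟩ : StdParabolic n F) = parabolicVal F ℓ β := rfl

theorem exists_parabolicVal_eq_theta (P : StdParabolic n F) :
    ∃ β : Fin n → ℕ, Monotone β ∧ theta ℓ P = parabolicVal F ℓ β := by
  obtain ⟨β, hβ, h⟩ := eq_parabolic_of_borel_le P.2
  exact ⟨β, hβ, by rw [theta, h, parabolicVal]⟩

theorem index_parabolic_ne_zero (β : Fin n → ℕ) : (parabolic F β).index ≠ 0 :=
  Subgroup.index_ne_zero_of_finite

variable [IsDomain R] [IsLocalRing R]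

/-- A submodule of `L` is determined by the eigenvectors it contains. -/
theorem le_of_eigenvec_mem (hmax : IsLocalRing.maximalIdeal R = Ideal.span {(ℓ : R)})
    (hq : IsUnit (Fintype.card F : R)) {ψ : AddChar F R} (hψ : ψ ≠ 1)
    {M N : Submodule (ResGroupAlg n F R ℓ) (Reduction n F R ℓ)}
    (h : ∀ β : Fin n → ℕ, Monotone β → toReduction n F R ℓ (eigenvec ψ β) ∈ M →
      toReduction n F R ℓ (eigenvec ψ β) ∈ N) : M ≤ N := by
  intro x hxM
  by_contra hxN
  -- The character sums vanish in the domain R, and this survives reduction.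
  have hsum : ∀ y : F, y ≠ 0 → ∑ a, redChar ℓ ψ (a * y) = 0 := by
    intro y hy
    simp only [redChar_apply]
    rw [← map_sum, sum_addChar_mul_eq_zero hψ y hy, map_zero]
  have hq' : IsUnit (Fintype.card F : ResField R ℓ) := by
    have := hq.map (Ideal.Quotient.mk (Ideal.span {(ℓ : R)}))
    rwa [map_natCast] at this
  have hx : N.mkQ x ≠ 0 := by
    rw [Submodule.mkQ_apply]
    exact fun h => hxN ((Submodule.Quotient.mk_eq_zero N).mp h)
  obtain ⟨β, hβ, a, ha⟩ := exists_unipSum_smul_ne_zero (n := n) hsum hq' hx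
  rw [← map_smul, ← map_smul, Submodule.mkQ_apply] at ha
  have ha' : unipSum (redChar ℓ ψ) β • a • x ∉ N :=
    fun h => ha ((Submodule.Quotient.mk_eq_zero N).mpr h)
  obtain ⟨y, hy⟩ := toReduction_surjective (a • x)
  obtain ⟨r, hr⟩ := exists_unipSum_smul_eq ψ β y
  have h1 : unipSum (redChar ℓ ψ) β • a • x = toReduction n F R ℓ (r • eigenvec ψ β) := by
    rw [← hr, LinearMap.map_smulₛₗ, reduceCoeff_unipSum, hy]
  -- The eigencomponent found is r times the reduction of E_β. Either r is a unit, and E_β itself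
  -- lies in M and so in N, or ℓ divides r and the component is zero.
  by_cases hru : IsUnit r
  · apply ha'
    rw [h1, toReduction_smul]
    refine N.smul_mem _ (h β hβ (toReduction_mem_of_isUnit_smul hru ?_))
    rw [← h1]
    exact M.smul_mem _ (M.smul_mem _ hxM)
  · apply ha'
    rw [← mem_nonunits_iff, ← IsLocalRing.mem_maximalIdeal, hmax,
      Ideal.mem_span_singleton] at hru
    obtain ⟨t, rfl⟩ := hru
    rw [h1, mul_smul, (toReduction_eq_zero_iff _).mpr ⟨_, rfl⟩]
    exact N.zero_mem

theorem eigenvec_mem_of_refine (hq : IsUnit (Fintype.card F : R)) {ψ : AddChar F R} (hψ : ψ ≠ 1)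
    {M : Submodule (ResGroupAlg n F R ℓ) (Reduction n F R ℓ)} {β β' : Fin n → ℕ}
    (hβ : Monotone β) (hβ' : Monotone β') (href : ∀ i j, β' i = β' j → β i = β j)
    (h : toReduction n F R ℓ (eigenvec ψ β) ∈ M) : toReduction n F R ℓ (eigenvec ψ β') ∈ M := by
  obtain ⟨x, κ, hκ, hx⟩ := exists_smul_eigenvec_refine hq hψ hβ hβ' href
  refine toReduction_mem_of_isUnit_smul hκ ?_
  rw [← hx]
  exact toReduction_smul_mem _ (toReduction_smul_mem _ h)

/-- Equal valuations of the two indices make the transition coefficient κ a unit, so the passage to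
a refinement can be undone modulo ℓ. -/
theorem eigenvec_mem_of_coarsen [CharZero R] (hℓ : ℓ.Prime)
    (hmax : IsLocalRing.maximalIdeal R = Ideal.span {(ℓ : R)})
    (hq : IsUnit (Fintype.card F : R)) {ψ : AddChar F R} (hψ : ψ ≠ 1)
    {M : Submodule (ResGroupAlg n F R ℓ) (Reduction n F R ℓ)} {β β' : Fin n → ℕ}
    (hβ : Monotone β) (hβ' : Monotone β') (href : ∀ i j, β' i = β' j → β i = β j)
    (hval : parabolicVal F ℓ β = parabolicVal F ℓ β')
    (h : toReduction n F R ℓ (eigenvec ψ β') ∈ M) : toReduction n F R ℓ (eigenvec ψ β) ∈ M := by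
  obtain ⟨a, κ, κ', hκ', ha, hκ⟩ := exists_smul_eigenvec_coarsen hq hψ hβ hβ' href
  obtain ⟨u, hu, h1⟩ := exists_pow_mul_unit_eq hℓ hmax (index_parabolic_ne_zero (F := F) β)
  obtain ⟨u', hu', h2⟩ := exists_pow_mul_unit_eq hℓ hmax (index_parabolic_ne_zero (F := F) β')
  change _ = (ℓ : R) ^ parabolicVal F ℓ β * u at h1
  change _ = (ℓ : R) ^ parabolicVal F ℓ β' * u' at h2
  rw [h1, h2, hval, mul_left_comm, mul_left_comm κ'] at hκ
  have h3 := mul_left_cancel₀ (pow_ne_zero _ (Nat.cast_ne_zero.mpr hℓ.ne_zero)) hκ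
  have h4 : IsUnit (κ * u) := h3 ▸ hκ'.mul hu'
  refine toReduction_mem_of_isUnit_smul (isUnit_of_mul_isUnit_left h4) ?_
  rw [← ha]
  exact toReduction_smul_mem _ h

/-- If E_β is congruent modulo ℓ to an element of I(c), projecting that element to the line of E_β
puts a unit multiple of E_β into I(c). Pairing with the eigenvector of ψ⁻¹ shows that ℓ^c divides
the index up to units. Conversely, every value f(E_β, y) is a multiple of the index. -/
theorem eigenvec_mem_gowFiltration_iff [CharZero R] (hℓ : ℓ.Prime)
    (hmax : IsLocalRing.maximalIdeal R = Ideal.span {(ℓ : R)})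
    (hq : IsUnit (Fintype.card F : R)) {ψ : AddChar F R} (hψ : ψ ≠ 1)
    {β : Fin n → ℕ} (hβ : Monotone β) (c : ℕ) :
    toReduction n F R ℓ (eigenvec ψ β) ∈ gowFiltration n F R ℓ c ↔ c ≤ parabolicVal F ℓ β := by
  have hU : IsUnit (Nat.card (unip n F) : R) := isUnit_card_unip hq
  obtain ⟨u, hu, hidx⟩ := exists_pow_mul_unit_eq hℓ hmax (index_parabolic_ne_zero (F := F) β)
  change _ = (ℓ : R) ^ parabolicVal F ℓ β * u at hidx
  have hform := gowForm_eigenvec (n := n) hψ hβ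
  have hl0 : (ℓ : R) ≠ 0 := Nat.cast_ne_zero.mpr hℓ.ne_zero
  constructor
  · rintro ⟨x, hx, hxE⟩
    rw [← sub_eq_zero, ← map_sub, toReduction_eq_zero_iff] at hxE
    obtain ⟨z, hz⟩ := hxE
    obtain ⟨r, hr⟩ := exists_unipSum_smul_eq ψ β x
    obtain ⟨s, hs⟩ := exists_unipSum_smul_eq ψ β z
    have h1 : r • eigenvec ψ β - (Nat.card (unip n F) : R) • eigenvec ψ β =
        (ℓ : R) • s • eigenvec ψ β := by
      have h0 := smul_sub (unipSum ψ β) x (eigenvec ψ β)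
      rw [hz, hr, unipSum_smul_eigenvec] at h0
      rw [← h0, ← hs, smul_comm]
    obtain ⟨w, hw1, hw2⟩ := exists_block_reversal hβ
    have hcu := isUnit_coeff_eigenvec hq hψ hβ (inv_decreasing_on_blocks hw1 hw2)
    have h2 : (r - (Nat.card (unip n F) : R)) *
        (eigenvec ψ β : GroupAlg n F R).coeff (permGL F w) =
        (ℓ * s) * (eigenvec ψ β : GroupAlg n F R).coeff (permGL F w) := by
      have := congrArg (fun y : lattice n F R => (y : GroupAlg n F R).coeff (permGL F w)) h1
      simpa [sub_mul, mul_assoc] using this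
    have h3 := hcu.mul_right_cancel h2
    -- r is congruent to the unit |U| modulo ℓ.
    have hru : IsUnit r := by
      by_contra hru
      rw [← mem_nonunits_iff, ← IsLocalRing.mem_maximalIdeal] at hru
      have h4 : (ℓ : R) * s ∈ IsLocalRing.maximalIdeal R := by
        rw [hmax]
        exact Ideal.mul_mem_right _ _ (Ideal.mem_span_singleton_self _)
      have h5 : (Nat.card (unip n F) : R) ∈ IsLocalRing.maximalIdeal R := by
        have := Ideal.sub_mem _ hru h4
        rwa [← h3, sub_sub_cancel] at this
      exact (IsLocalRing.mem_maximalIdeal _).mp h5 hU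
    have h6 : r • eigenvec ψ β ∈ latticeFiltration n F R ℓ c := by
      rw [← hr]
      exact Submodule.smul_mem _ _ hx
    have h7 := h6 (eigenvec ψ⁻¹ β)
    rw [map_smul, LinearMap.smul_apply, smul_eq_mul, hform, hidx, Ideal.mem_span_singleton] at h7
    have h8 : (ℓ : R) ^ c ∣ (ℓ : R) ^ parabolicVal F ℓ β := by
      have h9 : IsUnit (r * (Nat.card (unip n F) : R) * u) := (hru.mul hU).mul hu
      refine (IsUnit.dvd_mul_left h9).mp (h7.trans (dvd_of_eq ?_))
      ring
    exact (pow_dvd_pow_iff hl0 (not_isUnit_natCast hmax)).mp h8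
  · intro hc
    refine ⟨eigenvec ψ β, fun y => ?_, rfl⟩
    rw [Ideal.mem_span_singleton]
    obtain ⟨r, hr⟩ := exists_unipSum_smul_eq ψ⁻¹ β y
    have h1 : (Nat.card (unip n F) : R) * gowForm n F R (eigenvec ψ β) y =
        r * ((Nat.card (unip n F) : R) * (parabolic F β).index) := by
      rw [← hform, ← gowForm_smul_right r, ← hr, ← gowForm_unipSum_smul, unipSum_smul_eigenvec,
        map_smul, LinearMap.smul_apply, smul_eq_mul]
    rw [mul_left_comm] at h1
    rw [hU.mul_left_cancel h1, hidx]
    exact Dvd.dvd.mul_left (Dvd.dvd.mul_right (pow_dvd_pow _ hc) _) _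

end Transfer

end Steinberg

namespace Steinberg

/-! ### Valuations of q-integers and q-factorials -/

section Arithmetic

open Finset

theorem dvd_geomSum_add_iff {q ℓ : ℕ} (hℓ : ℓ.Prime) (hq : ¬ ℓ ∣ q) {a : ℕ}
    (ha : ℓ ∣ ∑ j ∈ range a, q ^ j) (b : ℕ) :
    ℓ ∣ ∑ j ∈ range (a + b), q ^ j ↔ ℓ ∣ ∑ j ∈ range b, q ^ j := by
  have h1 : ∑ j ∈ range (a + b), q ^ j = ∑ j ∈ range a, q ^ j + q ^ a * ∑ j ∈ range b, q ^ j := by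
    rw [sum_range_add, mul_sum]
    simp only [pow_add]
  rw [h1, Nat.dvd_add_right ha, hℓ.dvd_mul]
  exact or_iff_right fun h => hq (hℓ.dvd_of_dvd_pow h)

/-- Take i = ℓ if q ≡ 1 modulo ℓ, and i = ℓ - 1 by Fermat otherwise. Thus the infimum defining
`eNumber` is attained. -/
theorem exists_dvd_geomSum {q ℓ : ℕ} (hℓ : ℓ.Prime) (hq : ¬ ℓ ∣ q) :
    ∃ i, 2 ≤ i ∧ ℓ ∣ ∑ j ∈ range i, q ^ j := by
  have : Fact ℓ.Prime := ⟨hℓ⟩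
  have hq0 : (q : ZMod ℓ) ≠ 0 := fun h => hq ((ZMod.natCast_eq_zero_iff q ℓ).mp h)
  by_cases h1 : (q : ZMod ℓ) = 1
  · refine ⟨ℓ, hℓ.two_le, (ZMod.natCast_eq_zero_iff _ ℓ).mp ?_⟩
    push_cast
    simp [h1]
  · refine ⟨ℓ - 1, ?_, (ZMod.natCast_eq_zero_iff _ ℓ).mp ?_⟩
    · rcases hℓ.two_le.eq_or_lt with h2 | h2
      · exfalso
        have h3 : ∀ x : ZMod 2, x ≠ 0 → x = 1 := by decide
        subst h2
        exact h1 (h3 _ hq0)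
      · omega
    · push_cast
      have h2 := geom_sum_mul (q : ZMod ℓ) (ℓ - 1)
      rw [ZMod.pow_card_sub_one_eq_one hq0, sub_self] at h2
      exact (mul_eq_zero.mp h2).resolve_right (sub_ne_zero.mpr h1)

theorem eNumber_mem {q ℓ : ℕ} (hq2 : 2 ≤ q) (hℓ : ℓ.Prime) (hq : ¬ ℓ ∣ q) :
    2 ≤ eNumber q ℓ ∧ ℓ ∣ ∑ j ∈ range (eNumber q ℓ), q ^ j := by
  have h := Nat.sInf_mem (s := {i : ℕ | 2 ≤ i ∧ ℓ ∣ (q ^ i - 1) / (q - 1)}) (by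
    obtain ⟨i, hi⟩ := exists_dvd_geomSum hℓ hq
    refine ⟨i, ?_⟩
    rwa [Set.mem_ofPred_eq, ← Nat.geomSum_eq hq2])
  rwa [Set.mem_ofPred_eq, ← Nat.geomSum_eq hq2] at h

/-- Since [e + k]_q = [e]_q + q^e [k]_q with ℓ prime to q, divisibility by ℓ is periodic with period
e. The index 1 never qualifies, so minimality among i ≥ 2 suffices. -/
theorem dvd_geomSum_iff {q ℓ : ℕ} (hq2 : 2 ≤ q) (hℓ : ℓ.Prime) (hq : ¬ ℓ ∣ q) (i : ℕ) :
    ℓ ∣ ∑ j ∈ range i, q ^ j ↔ eNumber q ℓ ∣ i := by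
  obtain ⟨h2, he⟩ := eNumber_mem hq2 hℓ hq
  induction i using Nat.strong_induction_on with
  | _ i ih =>
    rcases lt_or_ge i (eNumber q ℓ) with hi | hi
    · constructor
      · intro h
        rcases Nat.lt_or_ge i 2 with h3 | h3
        · interval_cases i
          · exact dvd_zero _
          · simp only [range_one, sum_singleton, pow_zero] at h
            exact absurd (Nat.dvd_one.mp h) hℓ.ne_one
        · have h4 : i ∈ {i : ℕ | 2 ≤ i ∧ ℓ ∣ (q ^ i - 1) / (q - 1)} :=
            ⟨h3, by rwa [← Nat.geomSum_eq hq2]⟩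
          exact absurd (Nat.sInf_le h4) (not_le.mpr hi)
      · intro h
        rw [Nat.eq_zero_of_dvd_of_lt h hi]
        simp
    · obtain ⟨k, rfl⟩ := Nat.exists_eq_add_of_le hi
      rw [dvd_geomSum_add_iff hℓ hq he, ih k (by omega), Nat.dvd_add_right dvd_rfl]

theorem padicValNat_pow_sub_one {q ℓ : ℕ} (hq2 : 2 ≤ q) [Fact ℓ.Prime] {i : ℕ} (hi : i ≠ 0) :
    padicValNat ℓ (q ^ i - 1) =
      padicValNat ℓ (q - 1) + padicValNat ℓ (∑ j ∈ range i, q ^ j) := by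
  have h1 : (∑ j ∈ range i, q ^ j) * (q - 1) = q ^ i - 1 := by
    have h0 : 1 ≤ q ^ i := Nat.one_le_pow _ _ (by omega)
    zify [h0, show 1 ≤ q by omega]
    exact geom_sum_mul _ _
  have h2 : ∑ j ∈ range i, q ^ j ≠ 0 := by
    intro h
    rw [h, zero_mul] at h1
    have := Nat.one_lt_pow hi (show 1 < q by omega)
    omega
  rw [← h1, padicValNat.mul h2 (by omega), add_comm]

/-- Lifting the exponent. For ℓ = 2, q is odd and e = 2, so the exponents are even, as the 2-adic
version requires. -/
theorem padicValNat_pow_mul_sub_one {q ℓ : ℕ} (hq2 : 2 ≤ q) (hℓ : ℓ.Prime) (hq : ¬ ℓ ∣ q) {k : ℕ}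
    (hk : k ≠ 0) : padicValNat ℓ (q ^ (eNumber q ℓ * k) - 1) =
      padicValNat ℓ (q ^ eNumber q ℓ - 1) + padicValNat ℓ k := by
  have : Fact ℓ.Prime := ⟨hℓ⟩
  obtain ⟨h2, he⟩ := eNumber_mem hq2 hℓ hq
  rcases hℓ.eq_two_or_odd' with rfl | hodd
  · have h3 : eNumber q 2 = 2 := by
      have h4 : (2 : ℕ) ∣ ∑ j ∈ range 2, q ^ j := by
        simp only [sum_range_succ, sum_range_zero, pow_zero, pow_one]
        omega
      exact le_antisymm (Nat.le_of_dvd two_pos ((dvd_geomSum_iff hq2 hℓ hq 2).mp h4)) h2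
    have hd : 2 ∣ q - 1 := by omega
    have h5 := padicValNat.pow_two_sub_pow (x := q) (y := 1) (by omega) hd hq (n := 2 * k)
      (by omega) (even_two_mul k)
    have h6 := padicValNat.pow_two_sub_pow (x := q) (y := 1) (by omega) hd hq (n := 2)
      (by omega) even_two
    rw [one_pow] at h5 h6
    rw [padicValNat.mul two_ne_zero hk] at h5
    rw [h3]
    omega
  · have h3 : ℓ ∣ q ^ eNumber q ℓ - 1 := by
      refine he.trans ⟨q - 1, ?_⟩
      have h0 : 1 ≤ q ^ eNumber q ℓ := Nat.one_le_pow _ _ (by omega)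
      zify [h0, show 1 ≤ q by omega]
      exact (geom_sum_mul _ _).symm
    have h4 : 1 < q ^ eNumber q ℓ := Nat.one_lt_pow (by omega) (by omega)
    have h5 := padicValNat.pow_sub_pow hodd h4 h3 (fun h => hq (hℓ.dvd_of_dvd_pow h)) hk
    rwa [one_pow, ← pow_mul] at h5

/-- The `ℓ`-adic valuation of `[m]_q!` is `blockVal e d ℓ m` with `e = eNumber q ℓ` and
`d = ν_ℓ([e]_q)`. -/
def blockVal (e d ℓ m : ℕ) : ℕ := d * (m / e) + padicValNat ℓ (m / e).factorial

/-- Beyond the common contribution ν_ℓ(q - 1), only the factors with exponent divisible by e matter.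
The term linear in m cancels from indices of parabolic subgroups, as block sizes add up to n. -/
theorem exists_glVal_eq {q ℓ : ℕ} (hq2 : 2 ≤ q) (hℓ : ℓ.Prime) (hq : ¬ ℓ ∣ q) :
    ∃ d, 1 ≤ d ∧ ∀ m, glVal ℓ q m =
      m * padicValNat ℓ (q - 1) + blockVal (eNumber q ℓ) d ℓ m := by
  have : Fact ℓ.Prime := ⟨hℓ⟩
  obtain ⟨h2, he⟩ := eNumber_mem hq2 hℓ hq
  refine ⟨padicValNat ℓ (∑ j ∈ range (eNumber q ℓ), q ^ j), ?_, fun m => ?_⟩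
  · refine one_le_padicValNat_of_dvd ?_ he
    have : q ^ 0 ≤ ∑ j ∈ range (eNumber q ℓ), q ^ j :=
      single_le_sum (f := fun j => q ^ j) (fun _ _ => Nat.zero_le _) (mem_range.mpr (by omega))
    rw [pow_zero] at this
    omega
  · induction m with
    | zero => simp [glVal, blockVal]
    | succ m ih =>
      have h3 : glVal ℓ q (m + 1) = glVal ℓ q m + padicValNat ℓ (q ^ (m + 1) - 1) := by
        rw [glVal, glVal, sum_range_succ]
      rw [h3, ih, blockVal, blockVal]
      by_cases hd : eNumber q ℓ ∣ m + 1
      · rw [Nat.succ_div_of_dvd hd, Nat.factorial_succ,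
          padicValNat.mul (Nat.succ_ne_zero _) (Nat.factorial_ne_zero _)]
        have h4 : m + 1 = eNumber q ℓ * (m / eNumber q ℓ + 1) := by
          rw [← Nat.succ_div_of_dvd hd, Nat.mul_div_cancel' hd]
        have h5 := padicValNat_pow_mul_sub_one hq2 hℓ hq (Nat.succ_ne_zero (m / eNumber q ℓ))
        rw [Nat.succ_eq_add_one, ← h4, padicValNat_pow_sub_one hq2 (i := eNumber q ℓ) (by omega)] at h5
        rw [h5]
        ring
      · rw [Nat.succ_div_of_not_dvd hd, padicValNat_pow_sub_one hq2 (Nat.succ_ne_zero m),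
          padicValNat.eq_zero_of_not_dvd (fun h => hd ((dvd_geomSum_iff hq2 hℓ hq _).mp h))]
        ring

end Arithmetic

end Steinberg

namespace Steinberg

/-! ### Compositions, refinement, and coarsening at constant value -/

section Compositions

variable {e d ℓ : ℕ}

/-- A property of lists of block sizes that is inherited by refinements, by coarsenings of the same
`blockVal`, and that ignores empty blocks. -/
structure IsClosedType (e d ℓ : ℕ) (T : List ℕ → Prop) : Prop where
  split : ∀ l₁ a b l₂, T (l₁ ++ (a + b) :: l₂) → T (l₁ ++ a :: b :: l₂)
  merge : ∀ l₁ a b l₂, blockVal e d ℓ (a + b) = blockVal e d ℓ a + blockVal e d ℓ b →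
    T (l₁ ++ a :: b :: l₂) → T (l₁ ++ (a + b) :: l₂)
  zero : ∀ l₁ l₂, T (l₁ ++ 0 :: l₂) ↔ T (l₁ ++ l₂)

theorem blockVal_of_lt [Fact ℓ.Prime] {m : ℕ} (hm : m / e < ℓ) :
    blockVal e d ℓ m = d * (m / e) := by
  rw [blockVal, Nat.add_eq_left]
  exact padicValNat.eq_zero_of_not_dvd fun h =>
    absurd (((Fact.out : ℓ.Prime).dvd_factorial).mp h) (not_le.mpr hm)

theorem le_blockVal (m : ℕ) : d * (m / e) ≤ blockVal e d ℓ m := Nat.le_add_right _ _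

theorem lt_blockVal_of_le [Fact ℓ.Prime] {m : ℕ} (hm : ℓ ≤ m / e) :
    d * (m / e) < blockVal e d ℓ m :=
  Nat.lt_add_of_pos_right (one_le_padicValNat_of_dvd (Nat.factorial_ne_zero _)
    (((Fact.out : ℓ.Prime).dvd_factorial).mpr hm))

/-- The parts `e` and `1` into which a block of size `m` is cut. -/
def parts (e m : ℕ) : List ℕ := List.replicate (m / e) e ++ List.replicate (m % e) 1

theorem sum_parts (m : ℕ) : (parts e m).sum = m := by
  simp [parts, Nat.div_add_mod']

/-- The sum of the `⌊m / e⌋` over the block sizes `m`. -/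
def weight (e : ℕ) (l : List ℕ) : ℕ := (l.map (· / e)).sum

/-- The sum of the `blockVal` of the block sizes. -/
def totalVal (e d ℓ : ℕ) (l : List ℕ) : ℕ := (l.map (blockVal e d ℓ)).sum

theorem weight_cons (m : ℕ) (l : List ℕ) : weight e (m :: l) = m / e + weight e l := by
  simp [weight]

theorem totalVal_cons (m : ℕ) (l : List ℕ) :
    totalVal e d ℓ (m :: l) = blockVal e d ℓ m + totalVal e d ℓ l := by
  simp [totalVal]

theorem weight_mul_le (l : List ℕ) : e * weight e l ≤ l.sum := by
  induction l with
  | nil => simp [weight]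
  | cons m l ih =>
    rw [weight_cons, List.sum_cons, mul_add]
    exact add_le_add (Nat.mul_div_le m e) ih

theorem mul_weight_le_totalVal (l : List ℕ) : d * weight e l ≤ totalVal e d ℓ l := by
  induction l with
  | nil => simp [weight]
  | cons m l ih =>
    rw [weight_cons, totalVal_cons, mul_add]
    exact add_le_add (le_blockVal m) ih

theorem totalVal_eq_of_lt [Fact ℓ.Prime] {l : List ℕ} (hl : ∀ m ∈ l, m / e < ℓ) :
    totalVal e d ℓ l = d * weight e l := by
  induction l with
  | nil => simp [weight, totalVal]
  | cons m l ih =>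
    rw [weight_cons, totalVal_cons, mul_add, ih fun m hm => hl m (List.mem_cons_of_mem _ hm),
      blockVal_of_lt (hl m List.mem_cons_self)]

theorem totalVal_eq_of_weight_lt [Fact ℓ.Prime] {l : List ℕ} (hl : weight e l < ℓ) :
    totalVal e d ℓ l = d * weight e l :=
  totalVal_eq_of_lt fun _ hm =>
    (List.single_le_sum (fun _ _ => Nat.zero_le _) _ (List.mem_map_of_mem hm)).trans_lt hl

theorem mul_lt_totalVal_of_mem [Fact ℓ.Prime] {l : List ℕ} {m : ℕ} (hm : m ∈ l) (h : ℓ ≤ m / e) :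
    d * weight e l < totalVal e d ℓ l := by
  induction l with
  | nil => simp at hm
  | cons k l ih =>
    rw [weight_cons, totalVal_cons, mul_add]
    rcases List.mem_cons.mp hm with rfl | hm
    · exact add_lt_add_of_lt_of_le (lt_blockVal_of_le h) (mul_weight_le_totalVal l)
    · exact add_lt_add_of_le_of_lt (le_blockVal k) (ih hm)

/-- A block with m / e ≥ ℓ already makes the weight at least ℓ, and its factorial adds a further
factor ℓ, so the total exceeds d ℓ. -/
theorem lt_of_totalVal_le [Fact ℓ.Prime] {l : List ℕ} (h : totalVal e d ℓ l ≤ d * ℓ) :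
    ∀ m ∈ l, m / e < ℓ := by
  intro m hm
  by_contra! h1
  have h2 : ℓ ≤ weight e l :=
    h1.trans (List.single_le_sum (fun _ _ => Nat.zero_le _) _ (List.mem_map_of_mem hm))
  have h3 := mul_lt_totalVal_of_mem (d := d) hm h1
  have h4 := Nat.mul_le_mul_left d h2
  omega

variable {T : List ℕ → Prop}

theorem IsClosedType.split_sum (hT : IsClosedType e d ℓ T) (u l₁ l₂ : List ℕ)
    (h : T (l₁ ++ u.sum :: l₂)) : T (l₁ ++ u ++ l₂) := by
  induction u generalizing l₁ with
  | nil => simpa using (hT.zero l₁ l₂).mp h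
  | cons a u ih =>
    have h1 := hT.split l₁ a u.sum l₂ (by simpa using h)
    have h2 := ih (l₁ ++ [a]) (by simpa using h1)
    simpa using h2

theorem IsClosedType.split_parts (hT : IsClosedType e d ℓ T) (l l₁ : List ℕ) (h : T (l₁ ++ l)) :
    T (l₁ ++ l.flatMap (parts e)) := by
  induction l generalizing l₁ with
  | nil => simpa using h
  | cons m l ih =>
    have h1 := hT.split_sum (parts e m) l₁ l (by rwa [sum_parts])
    have h2 := ih _ h1
    simpa using h2

/-- Blocks smaller than e have value 0, so merging them costs nothing. -/
theorem IsClosedType.merge_ones [Fact ℓ.Prime] (hT : IsClosedType e d ℓ T) {r : ℕ} (hr : r < e)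
    (l₁ l₂ : List ℕ) (h : T (l₁ ++ List.replicate r 1 ++ l₂)) : T (l₁ ++ r :: l₂) := by
  induction r generalizing l₁ with
  | zero => exact (hT.zero l₁ l₂).mpr (by simpa using h)
  | succ r ih =>
    have h1 := ih (by omega) (l₁ ++ [1]) (by simpa [List.replicate_succ] using h)
    have h2 := hT.merge l₁ 1 r l₂ (by
      simp [blockVal, Nat.div_eq_of_lt (show 1 + r < e by omega),
        Nat.div_eq_of_lt (show r < e by omega), Nat.div_eq_of_lt (show 1 < e by omega)])
      (by simpa using h1)
    rwa [add_comm] at h2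

/-- As long as m / e < ℓ, the value of a block is d times m / e, hence additive along these merges.
-/
theorem IsClosedType.merge_parts_aux [Fact ℓ.Prime] (hT : IsClosedType e d ℓ T) {k r : ℕ}
    (hk : k < ℓ) (hr : r < e) (l₁ l₂ : List ℕ)
    (h : T (l₁ ++ List.replicate k e ++ r :: l₂)) : T (l₁ ++ (e * k + r) :: l₂) := by
  have he : 0 < e := by omega
  have hdiv : ∀ j, (e * j + r) / e = j := fun j => by
    rw [Nat.mul_add_div he, Nat.div_eq_of_lt hr, add_zero]
  induction k generalizing l₁ with
  | zero => simpa using h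
  | succ k ih =>
    have h1 := ih (by omega) (l₁ ++ [e]) (by simpa [List.replicate_succ] using h)
    have h3 : e + (e * k + r) = e * (k + 1) + r := by ring
    have h2 := hT.merge l₁ e (e * k + r) l₂ (by
      have h1ℓ : 1 < ℓ := (Fact.out : ℓ.Prime).one_lt
      rw [h3, blockVal_of_lt (by rw [hdiv]; exact hk), blockVal_of_lt (m := e * k + r)
        (by rw [hdiv]; omega), blockVal_of_lt (m := e) (by rwa [Nat.div_self he]), hdiv, hdiv,
        Nat.div_self he]
      ring)
      (by simpa using h1)
    rwa [h3] at h2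

theorem IsClosedType.merge_parts [Fact ℓ.Prime] (hT : IsClosedType e d ℓ T) (he : 0 < e)
    (l l₁ : List ℕ) (hl : ∀ m ∈ l, m / e < ℓ) (h : T (l₁ ++ l.flatMap (parts e))) :
    T (l₁ ++ l) := by
  induction l generalizing l₁ with
  | nil => simpa using h
  | cons m l ih =>
    have hm := hl m List.mem_cons_self
    have hr : m % e < e := Nat.mod_lt _ he
    have h1 := ih (l₁ ++ parts e m) (fun m hm => hl m (List.mem_cons_of_mem _ hm))
      (by simpa using h)
    have h2 := hT.merge_ones hr (l₁ ++ List.replicate (m / e) e) l (by simpa [parts] using h1)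
    have h3 := hT.merge_parts_aux hm hr l₁ l h2
    rwa [Nat.div_add_mod] at h3

/-- Neighbouring parts e and 1 can be interchanged: they merge to e + 1 without changing the value,
because e ≥ 2, and this block splits in the other order. -/
theorem IsClosedType.of_perm [Fact ℓ.Prime] (hT : IsClosedType e d ℓ T) (he : 2 ≤ e)
    {l l' : List ℕ} (hp : l.Perm l') (hl : ∀ x ∈ l, x = e ∨ x = 1) (l₁ : List ℕ)
    (h : T (l₁ ++ l)) : T (l₁ ++ l') := by
  have hv : blockVal e d ℓ (1 + e) = blockVal e d ℓ 1 + blockVal e d ℓ e := by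
    have h0 : 0 < e := by omega
    have h1 : (1 + e) / e = 1 := by
      rw [Nat.add_div_right _ h0, Nat.div_eq_of_lt (show 1 < e by omega)]
    simp [blockVal, h1, Nat.div_self h0, Nat.div_eq_of_lt (show 1 < e by omega)]
  induction hp generalizing l₁ with
  | nil => exact h
  | cons x _ ih =>
    have := ih (fun y hy => hl y (List.mem_cons_of_mem _ hy)) (l₁ ++ [x]) (by simpa using h)
    simpa using this
  | swap x y l =>
    rcases hl x (by simp) with rfl | rfl <;> rcases hl y (by simp) with rfl | rfl
    · exact h
    · refine hT.split l₁ _ _ l ?_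
      rw [add_comm]
      exact hT.merge l₁ _ _ l hv h
    · refine hT.split l₁ _ _ l ?_
      rw [add_comm]
      exact hT.merge l₁ _ _ l (by rw [add_comm, hv, add_comm]) h
    · exact h
  | trans h₁ _ ih₁ ih₂ =>
    exact ih₂ (fun x hx => hl x (h₁.mem_iff.mpr hx)) l₁ (ih₁ hl l₁ h)

/-- The list with `i` parts `e` and the remaining parts `1`. -/
def basicType (e n i : ℕ) : List ℕ := List.replicate i e ++ List.replicate (n - e * i) 1

theorem eq_or_eq_of_mem_basicType {n i x : ℕ} (hx : x ∈ basicType e n i) : x = e ∨ x = 1 := by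
  rcases List.mem_append.mp hx with h | h
  · exact Or.inl (List.eq_of_mem_replicate h)
  · exact Or.inr (List.eq_of_mem_replicate h)

theorem sum_basicType {n i : ℕ} (hi : e * i ≤ n) : (basicType e n i).sum = n := by
  simp [basicType]
  rw [mul_comm i e]
  omega

theorem totalVal_basicType (he : 2 ≤ e) (n i : ℕ) : totalVal e d ℓ (basicType e n i) = d * i := by
  have h1 : blockVal e d ℓ 1 = 0 := by simp [blockVal, Nat.div_eq_of_lt (show 1 < e by omega)]
  have h2 : blockVal e d ℓ e = d := by simp [blockVal, Nat.div_self (show 0 < e by omega)]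
  simp [totalVal, basicType, h1, h2, mul_comm]

theorem flatMap_parts_perm (l : List ℕ) :
    (l.flatMap (parts e)).Perm (basicType e l.sum (weight e l)) := by
  induction l with
  | nil => simp [basicType, weight]
  | cons m l ih =>
    have h1 : (m :: l).sum - e * weight e (m :: l) = m % e + (l.sum - e * weight e l) := by
      have := weight_mul_le (e := e) l
      have h2 := Nat.div_add_mod m e
      rw [weight_cons, List.sum_cons, mul_add]
      omega
    rw [List.flatMap_cons, basicType, h1, weight_cons, List.replicate_add, List.replicate_add]
    refine (List.Perm.append_left _ ih).trans ?_
    simp only [parts, basicType, List.append_assoc]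
    refine List.Perm.append_left _ ?_
    rw [← List.append_assoc, ← List.append_assoc]
    exact List.Perm.append_right _ List.perm_append_comm

theorem IsClosedType.basicType_weight [Fact ℓ.Prime] (hT : IsClosedType e d ℓ T) (he : 2 ≤ e)
    {l : List ℕ} (h : T l) : T (basicType e l.sum (weight e l)) := by
  refine hT.of_perm he (flatMap_parts_perm l) (fun x hx => ?_) [] (hT.split_parts l [] h)
  exact eq_or_eq_of_mem_basicType ((flatMap_parts_perm l).mem_iff.mp hx)

/-- The last part e is cut into e parts 1. -/
theorem IsClosedType.basicType_of_le (hT : IsClosedType e d ℓ T)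
    {n s i : ℕ} (hi : i ≤ s) (hs : e * s ≤ n) (h : T (basicType e n s)) : T (basicType e n i) := by
  induction s, hi using Nat.le_induction with
  | base => exact h
  | succ s hi ih =>
    have hs' : e * s + e ≤ n := hs
    refine ih (by omega) ?_
    have h1 := hT.split_sum (List.replicate e 1) (List.replicate s e)
      (List.replicate (n - e * (s + 1)) 1) (by
        simpa [basicType, List.replicate_succ'] using h)
    have h2 : n - e * s = e + (n - e * (s + 1)) := by rw [mul_add, mul_one]; omega
    rw [basicType, h2, List.replicate_add]
    simpa using h1

theorem IsClosedType.basicType_of_le_weight [Fact ℓ.Prime] (hT : IsClosedType e d ℓ T)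
    (he : 2 ≤ e) {l : List ℕ} (h : T l) {i : ℕ} (hi : i ≤ weight e l) :
    T (basicType e l.sum i) :=
  hT.basicType_of_le hi (weight_mul_le l) (hT.basicType_weight he h)

/-- The bound on the value forces all blocks below the threshold ℓ and the weight down to at most i.
So l is recovered from a basic type by cutting parts e, reordering parts, and merging at constant
value. -/
theorem IsClosedType.of_basicType [Fact ℓ.Prime] (hT : IsClosedType e d ℓ T) (he : 2 ≤ e)
    (hd : 1 ≤ d) {l : List ℕ} {i : ℕ} (hi : i ≤ ℓ) (hil : e * i ≤ l.sum)
    (hl : totalVal e d ℓ l ≤ d * i) (h : T (basicType e l.sum i)) : T l := by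
  have h1 : ∀ m ∈ l, m / e < ℓ := lt_of_totalVal_le (hl.trans (Nat.mul_le_mul_left d hi))
  have h2 : weight e l ≤ i :=
    Nat.le_of_mul_le_mul_left ((mul_weight_le_totalVal l).trans hl) hd
  have h3 := hT.basicType_of_le h2 hil h
  exact hT.merge_parts (by omega) l [] h1
    (hT.of_perm he (flatMap_parts_perm l).symm (fun x hx => eq_or_eq_of_mem_basicType hx) [] h3)

end Compositions

end Steinberg

namespace Steinberg

/-! ### Lists of block sizes and block functions -/

section BlockFunctions

open Finset

/-- The index of the block containing `i`, for consecutive blocks with sizes `l`. -/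
def blockIdx : List ℕ → ℕ → ℕ
  | [], _ => 0
  | a :: l, i => if i < a then 0 else blockIdx l (i - a) + 1

theorem blockIdx_mono (l : List ℕ) : Monotone (blockIdx l) := by
  induction l with
  | nil => exact fun _ _ _ => le_rfl
  | cons a l ih =>
    intro i j hij
    simp only [blockIdx]
    split_ifs with h1 h2
    · exact le_rfl
    · exact Nat.zero_le _
    · omega
    · exact Nat.succ_le_succ (ih (by omega))

theorem blockIdx_lt {l : List ℕ} {i : ℕ} (hi : i < l.sum) : blockIdx l i < l.length := by
  induction l generalizing i with
  | nil => simp at hi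
  | cons a l ih =>
    rw [List.sum_cons] at hi
    simp only [blockIdx, List.length_cons]
    split_ifs with h
    · omega
    · exact Nat.succ_lt_succ (ih (by omega))

theorem blockIdx_eq {l : List ℕ} {i k : ℕ} (hk : k < l.length) (h1 : (l.take k).sum ≤ i)
    (h2 : i < (l.take (k + 1)).sum) : blockIdx l i = k := by
  induction l generalizing i k with
  | nil => simp at hk
  | cons a l ih =>
    cases k with
    | zero =>
      simp only [zero_add, List.take_succ_cons, List.take_zero, List.sum_cons, List.sum_nil,
        add_zero] at h2
      simp [blockIdx, h2]
    | succ k =>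
      rw [List.take_succ_cons, List.sum_cons] at h1 h2
      rw [blockIdx, if_neg (by omega), ih (by simpa using hk) (by omega) (by omega)]

theorem card_filter_blockIdx {l : List ℕ} (k : Fin l.length) :
    ((range l.sum).filter fun i => blockIdx l i = k).card = l[k] := by
  induction l with
  | nil => exact k.elim0
  | cons a l ih =>
    rw [List.sum_cons]
    refine Fin.cases ?_ (fun k => ?_) k
    · have h1 : ((range (a + l.sum)).filter fun i => blockIdx (a :: l) i = 0) = range a := by
        ext i
        rw [mem_filter, mem_range, mem_range, blockIdx]
        split_ifs with h
        · simp only [and_true, h, iff_true]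
          omega
        · simp [h]
      exact (congrArg card h1).trans (card_range a)
    · have h1 : ((range (a + l.sum)).filter fun i => blockIdx (a :: l) i = k.succ) =
          ((range l.sum).filter fun i => blockIdx l i = k).map (addLeftEmbedding a) := by
        ext i
        simp only [mem_filter, mem_range, mem_map, addLeftEmbedding_apply, Fin.val_succ]
        rw [blockIdx]
        constructor
        · rintro ⟨h1, h2⟩
          split_ifs at h2 with h
          exact ⟨i - a, ⟨by omega, by omega⟩, by omega⟩
        · rintro ⟨j, ⟨h1, h2⟩, rfl⟩
          rw [if_neg (by omega), Nat.add_sub_cancel_left, h2]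
          exact ⟨Nat.add_lt_add_left h1 a, rfl⟩
      rw [h1, card_map, ih k]
      simp

theorem exists_blockIdx_split (l₁ : List ℕ) (a b : ℕ) (l₂ : List ℕ) :
    ∃ f : ℕ → ℕ, ∀ i, blockIdx (l₁ ++ (a + b) :: l₂) i = f (blockIdx (l₁ ++ a :: b :: l₂) i) := by
  induction l₁ with
  | nil =>
    refine ⟨fun k => k - 1, fun i => ?_⟩
    simp only [List.nil_append, blockIdx]
    split_ifs with h1 h2 h3 h4 h5
    all_goals first | omega | skip
    rw [Nat.sub_sub]
    rfl
  | cons c l₁ ih =>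
    obtain ⟨f, hf⟩ := ih
    refine ⟨fun k => if k = 0 then 0 else f (k - 1) + 1, fun i => ?_⟩
    simp only [List.cons_append, blockIdx]
    split_ifs with h1 h2
    · rfl
    · exact absurd rfl h2
    · omega
    · rw [hf]
      rfl

/-- An empty block only renumbers the blocks after it, so both lists refine each other. -/
theorem exists_blockIdx_zero (l₁ l₂ : List ℕ) :
    ∃ f : ℕ → ℕ, Function.Injective f ∧
      ∀ i, blockIdx (l₁ ++ 0 :: l₂) i = f (blockIdx (l₁ ++ l₂) i) := by
  induction l₁ with
  | nil => exact ⟨fun k => k + 1, add_left_injective 1, fun i => by simp [blockIdx]⟩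
  | cons c l₁ ih =>
    obtain ⟨f, hf, h⟩ := ih
    refine ⟨fun k => if k = 0 then 0 else f (k - 1) + 1, fun j k hjk => ?_, fun i => ?_⟩
    · simp only at hjk
      split_ifs at hjk with h1 h2 h3
      · omega
      · have := hf (Nat.succ_injective hjk)
        omega
    · simp only [List.cons_append, blockIdx]
      split_ifs with h1 h2
      · rfl
      · exact absurd rfl h2
      · omega
      · rw [h]
        rfl

variable {n : ℕ}

/-- Every monotone function on `Fin n` is the block function of a list of block sizes. -/
theorem exists_blockIdx_eq {β : Fin n → ℕ} (hβ : Monotone β) :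
    ∃ l : List ℕ, l.sum = n ∧ ∀ i : Fin n, blockIdx l i = β i := by
  obtain ⟨m, hm⟩ : ∃ m, ∀ i, β i < m :=
    ⟨univ.sup β + 1, fun i => Nat.lt_succ_of_le (le_sup (mem_univ i))⟩
  have hsum : ∀ k, ((List.range k).map fun j => (univ.filter fun i => β i = j).card).sum =
      (univ.filter fun i => β i < k).card := by
    intro k
    induction k with
    | zero => simp
    | succ k ih =>
      rw [List.range_succ, List.map_append, List.sum_append, ih]
      simp only [List.map_cons, List.map_nil, List.sum_cons, List.sum_nil, add_zero]
      rw [← card_union_of_disjoint]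
      · congr 1
        ext i
        simp only [mem_union, mem_filter, mem_univ, true_and]
        omega
      · rw [disjoint_filter]
        intro i _ h1 h2
        omega
  -- Values not attained by β become empty blocks.
  refine ⟨(List.range m).map fun j => (univ.filter fun i => β i = j).card, ?_, fun i => ?_⟩
  · rw [hsum, filter_true_of_mem fun i _ => hm i, card_univ, Fintype.card_fin]
  · have htake : ∀ k ≤ m, (((List.range m).map fun j =>
        (univ.filter fun i => β i = j).card).take k).sum = (univ.filter fun i => β i < k).card := by
      intro k hk
      rw [← List.map_take, List.take_range, min_eq_left hk, hsum]
    refine blockIdx_eq (by simpa using hm i) ?_ ?_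
    · rw [htake _ (hm i).le]
      calc _ ≤ (Iio i).card := card_le_card fun j hj => by
            rw [mem_Iio]
            by_contra! h
            exact absurd (hβ h) (not_le.mpr (mem_filter.mp hj).2)
        _ = i := Fin.card_Iio i
    · rw [htake _ (hm i)]
      calc i.val < (Iic i).card := by rw [Fin.card_Iic]; omega
        _ ≤ _ := card_le_card fun j hj => by
            rw [mem_filter]
            exact ⟨mem_univ j, Nat.lt_succ_of_le (hβ (mem_Iic.mp hj))⟩

theorem monotone_blockIdx_comp_val (l : List ℕ) : Monotone fun i : Fin n => blockIdx l i :=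
  fun _ _ h => blockIdx_mono l h

/-- The valuation of the index of a parabolic subgroup in terms of the block sizes. -/
theorem parabolicVal_add_totalVal {F : Type*} [Field F] [Fintype F] {e d ℓ c : ℕ} [Fact ℓ.Prime]
    (hq : ¬ ℓ ∣ Fintype.card F)
    (hval : ∀ m, glVal ℓ (Fintype.card F) m = m * c + blockVal e d ℓ m)
    {l : List ℕ} (hl : l.sum = n) :
    parabolicVal F ℓ (fun i : Fin n => blockIdx l i) + totalVal e d ℓ l = blockVal e d ℓ n := by
  let β : Fin n → Fin l.length := fun i => ⟨blockIdx l i, blockIdx_lt (hl ▸ i.2)⟩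
  have h1 := padicValNat_index_parabolic hq β
  have hcard : ∀ k : Fin l.length, (univ.filter fun i => β i = k).card = l[k] := by
    intro k
    rw [← card_filter_blockIdx k, hl]
    rw [← Finset.card_map Fin.valEmbedding]
    congr 1
    ext i
    simp only [mem_map, mem_filter, mem_univ, true_and, Fin.valEmbedding_apply, mem_range, β,
      Fin.ext_iff]
    constructor
    · rintro ⟨j, hj, rfl⟩
      exact ⟨j.2, hj⟩
    · rintro ⟨h2, h3⟩
      exact ⟨⟨i, h2⟩, h3, rfl⟩
  simp only [hcard] at h1
  have h2 : ∑ k : Fin l.length, glVal ℓ (Fintype.card F) l[k] =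
      l.sum * c + totalVal e d ℓ l := by
    have h3 : ∀ l : List ℕ, (l.map (glVal ℓ (Fintype.card F))).sum =
        l.sum * c + totalVal e d ℓ l := by
      intro l
      induction l with
      | nil => simp [totalVal]
      | cons a l ih =>
        rw [List.map_cons, List.sum_cons, ih, hval, totalVal_cons, List.sum_cons]
        ring
    rw [← h3, ← Fin.sum_univ_fun_getElem]
    rfl
  rw [h2, hval, hl] at h1
  change parabolicVal F ℓ (fun i : Fin n => blockIdx l i) + _ = _ at h1
  omega

end BlockFunctions

end Steinberg

namespace Steinberg

/-! ### Uniserial modules, socles and chains of submodules -/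

section SubmoduleChains

variable {A M : Type*} [Ring A] [AddCommGroup M] [Module A M]

theorem moduleSocle_eq_of_forall_le {Q : Submodule A M} (hQ : Q ≠ ⊥)
    (h : ∀ N : Submodule A M, N ≠ ⊥ → Q ≤ N) : moduleSocle A M = Q := by
  have hatom : IsAtom Q := ⟨hQ, fun N hN => by
    by_contra hN0
    exact absurd (h N hN0) hN.not_ge⟩
  refine le_antisymm (sSup_le fun N hN => ?_) (le_sSup (isSimpleModule_iff_isAtom.mpr hatom))
  have hN' : IsAtom N := isSimpleModule_iff_isAtom.mp hN
  exact ((hN'.le_iff.mp (h N hN'.1)).resolve_left hQ).ge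

/-- The hypothesis says that Y / X lies in every nonzero submodule of M / X, so it is the unique
simple one and equals the socle. -/
theorem comap_moduleSocle_eq {X Y : Submodule A M} (hXY : X < Y)
    (h : ∀ N : Submodule A M, ¬ N ≤ X → Y ≤ N) :
    (moduleSocle A (M ⧸ X)).comap X.mkQ = Y := by
  have h1 : moduleSocle A (M ⧸ X) = Y.map X.mkQ := by
    refine moduleSocle_eq_of_forall_le (fun h0 => ?_) fun N hN => ?_
    · have h1 := Submodule.map_le_iff_le_comap.mp h0.le
      rw [Submodule.comap_bot, Submodule.ker_mkQ] at h1
      exact hXY.not_ge h1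
    · rw [Submodule.map_le_iff_le_comap]
      refine h _ fun h2 => hN ?_
      rw [eq_bot_iff]
      intro y hy
      obtain ⟨x, rfl⟩ := X.mkQ_surjective y
      exact (Submodule.Quotient.mk_eq_zero X).mpr (h2 hy)
  rw [h1, Submodule.comap_map_mkQ, sup_eq_right.mpr hXY.le]

variable {X : ℕ → Submodule A M} {k : ℕ}

theorem covBy_of_forall_le (hlt : ∀ i < k, X i < X (i + 1))
    (hmin : ∀ i < k, ∀ N : Submodule A M, ¬ N ≤ X i → X (i + 1) ≤ N) {i : ℕ} (hi : i < k) :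
    X i ⋖ X (i + 1) :=
  ⟨hlt i hi, fun N h1 h2 => h2.not_ge (hmin i hi N h1.not_ge)⟩

theorem socleSeries_eq_of_forall_le (h0 : X 0 = ⊥) (hlt : ∀ i < k, X i < X (i + 1))
    (hmin : ∀ i < k, ∀ N : Submodule A M, ¬ N ≤ X i → X (i + 1) ≤ N) {i : ℕ} (hi : i ≤ k) :
    socleSeries A M i = X i := by
  induction i with
  | zero => rw [h0, socleSeries]
  | succ i ih =>
    rw [socleSeries, ih (by omega)]
    exact comap_moduleSocle_eq (hlt i hi) (hmin i hi)

/-- A submodule of X (i + 1) that is not contained in X i must contain X (i + 1), so nothing exists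
below the chain except its terms. -/
theorem exists_eq_of_le (h0 : X 0 = ⊥)
    (hmin : ∀ i < k, ∀ N : Submodule A M, ¬ N ≤ X i → X (i + 1) ≤ N) {i : ℕ} (hi : i ≤ k)
    {N : Submodule A M} (hN : N ≤ X i) : ∃ j ≤ i, N = X j := by
  induction i with
  | zero => exact ⟨0, le_rfl, by rw [h0] at hN ⊢; exact le_bot_iff.mp hN⟩
  | succ i ih =>
    by_cases h : N ≤ X i
    · obtain ⟨j, hj, rfl⟩ := ih (by omega) h
      exact ⟨j, by omega, rfl⟩
    · exact ⟨i + 1, le_rfl, le_antisymm hN (hmin i hi N h)⟩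

theorem isUniserial_of_forall_le (h0 : X 0 = ⊥) (hlt : ∀ i < k, X i < X (i + 1))
    (hmin : ∀ i < k, ∀ N : Submodule A M, ¬ N ≤ X i → X (i + 1) ≤ N) : IsUniserial A (X k) := by
  have hmono : ∀ i j, i ≤ j → j ≤ k → X i ≤ X j := by
    intro i j hij
    induction j, hij using Nat.le_induction with
    | base => exact fun _ => le_rfl
    | succ j _ ih => exact fun hj => (ih (by omega)).trans (hlt j hj).le
  intro N₁ N₂
  obtain ⟨i, hi, h1⟩ := exists_eq_of_le h0 hmin le_rfl (Submodule.map_subtype_le (X k) N₁)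
  obtain ⟨j, hj, h2⟩ := exists_eq_of_le h0 hmin le_rfl (Submodule.map_subtype_le (X k) N₂)
  have hinj := Submodule.map_le_map_iff_of_injective (X k).injective_subtype
  rcases le_total i j with h | h
  · left
    rw [← hinj, h1, h2]
    exact hmono i j h hj
  · right
    rw [← hinj, h1, h2]
    exact hmono j i h hi

theorem length_eq_of_covBy (h0 : X 0 = ⊥) (hcov : ∀ i < k, X i ⋖ X (i + 1)) {i : ℕ} (hi : i ≤ k) :
    Module.length A (X i) = i := by
  induction i with
  | zero => rw [h0, Module.length_bot, Nat.cast_zero]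
  | succ i ih =>
    have hle := (hcov i hi).le
    have hs := (covBy_iff_quot_is_simple hle).mp (hcov i hi)
    have h1 := Module.length_eq_add_of_exact ((X i).submoduleOf (X (i + 1))).subtype
      ((X i).submoduleOf (X (i + 1))).mkQ (Submodule.injective_subtype _)
      (Submodule.mkQ_surjective _) (LinearMap.exact_subtype_mkQ _)
    have h2 : Module.length A (X (i + 1) ⧸ (X i).submoduleOf (X (i + 1))) = 1 :=
      Module.length_eq_one_iff.mpr hs
    rw [h1, h2, (Submodule.submoduleOfEquivOfLe hle).length_eq, ih (by omega), Nat.cast_succ]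

/-- If N is not a term, climbing the series keeps every term below N, since N cannot sit inside a
covering step. The last term then forces N = ⊤, which is a term. -/
theorem mem_compositionSeries_of_isUniserial (hU : IsUniserial A M)
    {s : CompositionSeries (Submodule A M)} (h0 : s.head = ⊥) (h1 : s.last = ⊤)
    (N : Submodule A M) : N ∈ s := by
  by_contra hN
  have h : ∀ j (hj : j < s.length + 1), s ⟨j, hj⟩ ≤ N := by
    intro j
    induction j with
    | zero =>
      intro _
      change s.head ≤ N
      rw [h0]
      exact bot_le
    | succ j ih =>
      intro hj
      have h2 := ih (by omega)
      refine (hU _ N).resolve_right fun h3 => ?_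
      have h4 : s ⟨j, by omega⟩ ⋖ s ⟨j + 1, hj⟩ := s.step ⟨j, by omega⟩
      rcases h4.eq_or_eq h2 h3 with h5 | h5
      · exact hN ⟨_, h5.symm⟩
      · exact hN ⟨_, h5.symm⟩
  refine hN ⟨Fin.last _, ?_⟩
  refine le_antisymm (h _ _) ?_
  change N ≤ s.last
  rw [h1]
  exact le_top

/-- In a uniserial module with finitely many submodules, all submodules form the only composition
series. -/
theorem exists_unique_compositionSeries (hU : IsUniserial A M) [Finite (Submodule A M)] :
    ∃ s : CompositionSeries (Submodule A M), s.head = ⊥ ∧ s.last = ⊤ ∧ Set.range s = Set.univ ∧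
      ∀ s' : CompositionSeries (Submodule A M), s'.head = ⊥ → s'.last = ⊤ → s' = s := by
  have : IsNoetherian A M := isNoetherian_iff'.mpr inferInstance
  have : IsArtinian A M := inferInstance
  obtain ⟨s, h0, h1⟩ := exists_compositionSeries_of_isNoetherian_isArtinian A M
  refine ⟨s, h0, h1, ?_, fun s' h0' h1' => ?_⟩
  · exact Set.eq_univ_of_forall fun N => mem_compositionSeries_of_isUniserial hU h0 h1 N
  · refine CompositionSeries.ext fun N => ?_
    exact iff_of_true (mem_compositionSeries_of_isUniserial hU h0' h1' N)
      (mem_compositionSeries_of_isUniserial hU h0 h1 N)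

/-- f enumerates all of S in decreasing order and c enumerates the elements of S that are at least c
ℓ, so the two agree from the top as long as c lasts. -/
theorem finEnum_eq_of_strictAnti {V ℓ : ℕ} {S : Set ℕ} (hS : S.Finite) (hV : S.ncard = V)
    {f : Fin V → ℕ} (hf : StrictAnti f) (hfS : ∀ i, f i ∈ S) {c : ℕ → ℕ}
    (hc : ∀ i j, i < j → j ≤ ℓ → c j < c i) (hcS : ∀ i ≤ ℓ, c i ∈ S)
    (hall : ∀ x ∈ S, c ℓ ≤ x → ∃ i ≤ ℓ, x = c i) :
    ℓ < V ∧ ∀ i : Fin V, i.val ≤ ℓ → f i = c i := by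
  have hsurj : ∀ x ∈ S, ∃ i, f i = x := by
    have h1 : Set.range f = S := by
      refine Set.eq_of_subset_of_ncard_le (Set.range_subset_iff.mpr hfS) ?_ hS
      rw [hV, ← Set.image_univ, Set.ncard_image_of_injective _ hf.injective, Set.ncard_univ,
        Nat.card_fin]
    intro x hx
    rwa [← h1] at hx
  have hle : ∀ i j, i ≤ j → j ≤ ℓ → c j ≤ c i := fun i j hij hj =>
    hij.eq_or_lt.elim (fun h => h ▸ le_rfl) fun h => (hc i j h hj).le
  have key : ∀ i ≤ ℓ, ∃ h : i < V, f ⟨i, h⟩ = c i := by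
    intro i
    induction i using Nat.strong_induction_on with
    | _ i ih =>
      intro hi
      obtain ⟨j, hj⟩ := hsurj (c i) (hcS i hi)
      have hij : i ≤ j := by
        by_contra! h
        obtain ⟨h1, h2⟩ := ih j h (by omega)
        exact absurd (hj.symm.trans h2) (hc j i h hi).ne
      have hiV : i < V := by omega
      refine ⟨hiV, ?_⟩
      have h1 : c i ≤ f ⟨i, hiV⟩ := hj ▸ hf.antitone (Fin.le_def.mpr hij)
      obtain ⟨k, hk, h2⟩ := hall _ (hfS ⟨i, hiV⟩) ((hle i ℓ hi le_rfl).trans h1)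
      rcases lt_trichotomy k i with h3 | h3 | h3
      · obtain ⟨h4, h5⟩ := ih k h3 hk
        have h6 := hf.injective (h2.trans h5.symm)
        rw [Fin.mk.injEq] at h6
        omega
      · rw [h2, h3]
      · have := hc i k h3 hk
        omega
  exact ⟨(key ℓ le_rfl).1, fun i hi => (key i hi).2⟩

end SubmoduleChains

end Steinberg

namespace Steinberg

open Matrix MonoidAlgebra

/-! ### Submodules of L in terms of compositions -/

section GowFiltration

variable {n : ℕ} {F R : Type*} [Field F] [Fintype F] [DecidableEq F] [CommRing R] {ℓ e d : ℕ}
  {ψ : AddChar F R}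

/-- The lists of block sizes whose eigenvectors lie in `M`. -/
def ContainsType (ψ : AddChar F R) (M : Submodule (ResGroupAlg n F R ℓ) (Reduction n F R ℓ))
    (l : List ℕ) : Prop :=
  l.sum = n ∧ toReduction n F R ℓ (eigenvec ψ fun i : Fin n => blockIdx l i) ∈ M

/-- The standing assumptions, with `e = eNumber q ℓ` and `d = ν_ℓ([e]_q)`. -/
structure Setting (F : Type*) {R : Type*} [Field F] [Fintype F] [CommRing R] [IsLocalRing R]
    (ℓ e d : ℕ) (ψ : AddChar F R) : Prop where
  prime : ℓ.Prime
  maximalIdeal_eq : IsLocalRing.maximalIdeal R = Ideal.span {(ℓ : R)}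
  not_dvd : ¬ ℓ ∣ Fintype.card F
  char_ne_one : ψ ≠ 1
  two_le : 2 ≤ e
  one_le : 1 ≤ d
  glVal_eq : ∃ c, ∀ m, glVal ℓ (Fintype.card F) m = m * c + blockVal e d ℓ m

variable [IsDomain R] [IsLocalRing R]

theorem Setting.isUnit_card (h : Setting F ℓ e d ψ) : IsUnit (Fintype.card F : R) :=
  isUnit_natCast_of_not_dvd h.prime h.maximalIdeal_eq h.not_dvd

theorem Setting.parabolicVal_add (h : Setting F ℓ e d ψ) {l : List ℕ} (hl : l.sum = n) :
    parabolicVal F ℓ (fun i : Fin n => blockIdx l i) + totalVal e d ℓ l = blockVal e d ℓ n := by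
  have : Fact ℓ.Prime := ⟨h.prime⟩
  obtain ⟨c, hc⟩ := h.glVal_eq
  exact parabolicVal_add_totalVal h.not_dvd hc hl

theorem Setting.le_of_containsType (h : Setting F ℓ e d ψ)
    {M N : Submodule (ResGroupAlg n F R ℓ) (Reduction n F R ℓ)}
    (hMN : ∀ l, ContainsType ψ M l → ContainsType ψ N l) : M ≤ N := by
  refine le_of_eigenvec_mem h.maximalIdeal_eq h.isUnit_card h.char_ne_one fun β hβ hM => ?_
  obtain ⟨l, hl, hlβ⟩ := exists_blockIdx_eq hβ
  have h1 : (fun i : Fin n => blockIdx l i) = β := funext hlβ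
  have h2 := (hMN l ⟨hl, by rwa [h1]⟩).2
  rwa [h1] at h2

theorem Setting.exists_containsType_of_not_le (h : Setting F ℓ e d ψ)
    {M N : Submodule (ResGroupAlg n F R ℓ) (Reduction n F R ℓ)} (hMN : ¬ M ≤ N) :
    ∃ l, ContainsType ψ M l ∧ ¬ ContainsType ψ N l := by
  by_contra! h1
  exact hMN (h.le_of_containsType h1)

variable [CharZero R]

theorem Setting.containsType_gowFiltration_iff (h : Setting F ℓ e d ψ) (c : ℕ) (l : List ℕ) :
    ContainsType ψ (gowFiltration n F R ℓ c) l ↔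
      l.sum = n ∧ c + totalVal e d ℓ l ≤ blockVal e d ℓ n := by
  refine and_congr_right fun hl => ?_
  rw [eigenvec_mem_gowFiltration_iff h.prime h.maximalIdeal_eq h.isUnit_card h.char_ne_one
    (monotone_blockIdx_comp_val l)]
  have := h.parabolicVal_add hl
  omega

theorem Setting.gowFiltration_antitone (h : Setting F ℓ e d ψ) :
    Antitone (gowFiltration n F R ℓ) := by
  refine fun c c' hc => h.le_of_containsType fun l hl => ?_
  rw [h.containsType_gowFiltration_iff] at hl ⊢
  exact ⟨hl.1, by omega⟩

theorem Setting.gowFiltration_eq_bot (h : Setting F ℓ e d ψ) {c : ℕ} (hc : blockVal e d ℓ n < c) :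
    gowFiltration n F R ℓ c = ⊥ := by
  rw [eq_bot_iff]
  refine h.le_of_containsType fun l hl => ?_
  rw [h.containsType_gowFiltration_iff] at hl
  omega

/-- Splitting a block refines the parabolic subgroup. Merging two blocks without changing the total
value keeps the valuation of the index, which is where the transition coefficient is a unit. -/
theorem Setting.isClosedType (h : Setting F ℓ e d ψ)
    (M : Submodule (ResGroupAlg n F R ℓ) (Reduction n F R ℓ)) :
    IsClosedType e d ℓ (ContainsType ψ M) where
  split l₁ a b l₂ hM := by
    obtain ⟨f, hf⟩ := exists_blockIdx_split l₁ a b l₂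
    refine ⟨by rw [← hM.1]; simp [add_assoc], ?_⟩
    refine eigenvec_mem_of_refine h.isUnit_card h.char_ne_one (monotone_blockIdx_comp_val _)
      (monotone_blockIdx_comp_val _) (fun i j hij => ?_) hM.2
    rw [hf, hf, hij]
  merge l₁ a b l₂ hab hM := by
    obtain ⟨f, hf⟩ := exists_blockIdx_split l₁ a b l₂
    have hsum : (l₁ ++ (a + b) :: l₂).sum = n := by rw [← hM.1]; simp [add_assoc]
    refine ⟨hsum, ?_⟩
    refine eigenvec_mem_of_coarsen h.prime h.maximalIdeal_eq h.isUnit_card h.char_ne_one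
      (monotone_blockIdx_comp_val _) (monotone_blockIdx_comp_val _) (fun i j hij => ?_) ?_ hM.2
    · rw [hf, hf, hij]
    · have h1 := h.parabolicVal_add hM.1
      have h2 := h.parabolicVal_add hsum
      simp only [totalVal, List.map_append, List.map_cons, List.sum_append, List.sum_cons,
        hab] at h1 h2
      omega
  zero l₁ l₂ := by
    obtain ⟨f, hinj, hf⟩ := exists_blockIdx_zero l₁ l₂
    refine and_congr (by simp) ⟨fun hM => ?_, fun hM => ?_⟩
    · refine eigenvec_mem_of_refine h.isUnit_card h.char_ne_one (monotone_blockIdx_comp_val _)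
        (monotone_blockIdx_comp_val _) (fun i j hij => ?_) hM
      rw [hf, hf, hij]
    · refine eigenvec_mem_of_refine h.isUnit_card h.char_ne_one (monotone_blockIdx_comp_val _)
        (monotone_blockIdx_comp_val _) (fun i j hij => ?_) hM
      rw [hf, hf] at hij
      exact hinj hij

theorem Setting.mul_le_blockVal (h : Setting F ℓ e d ψ) {i : ℕ} (hi : e * i ≤ n) :
    d * i ≤ blockVal e d ℓ n :=
  (Nat.mul_le_mul_left d ((Nat.le_div_iff_mul_le (by have := h.two_le; omega)).mpr
    (by rwa [mul_comm]))).trans (le_blockVal n)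

theorem Setting.basicType_mem_iff (h : Setting F ℓ e d ψ) {i : ℕ} (hi : e * i ≤ n) (c : ℕ) :
    ContainsType ψ (gowFiltration n F R ℓ c) (basicType e n i) ↔
      c + d * i ≤ blockVal e d ℓ n := by
  rw [h.containsType_gowFiltration_iff, totalVal_basicType h.two_le]
  exact and_iff_right (sum_basicType hi)

theorem Setting.gowFiltration_le (h : Setting F ℓ e d ψ) {i : ℕ} (hi : i ≤ ℓ) (hin : e * i ≤ n)
    {M : Submodule (ResGroupAlg n F R ℓ) (Reduction n F R ℓ)}
    (hM : ContainsType ψ M (basicType e n i)) :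
    gowFiltration n F R ℓ (blockVal e d ℓ n - d * i) ≤ M := by
  have : Fact ℓ.Prime := ⟨h.prime⟩
  have h1 := h.mul_le_blockVal hin
  refine h.le_of_containsType fun l hl => ?_
  obtain ⟨rfl, hl⟩ := (h.containsType_gowFiltration_iff _ _).mp hl
  exact (h.isClosedType M).of_basicType h.two_le h.one_le hi hin (by omega) hM

theorem padicValNat_factorial_self {ℓ : ℕ} [hℓ : Fact ℓ.Prime] : padicValNat ℓ ℓ.factorial = 1 := by
  have h := hℓ.out
  rw [← Nat.mul_factorial_pred h.ne_zero, padicValNat.mul h.ne_zero (Nat.factorial_ne_zero _),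
    padicValNat.self h.one_lt, Nat.add_eq_left]
  refine padicValNat.eq_zero_of_not_dvd fun h1 => ?_
  have := h.dvd_factorial.mp h1
  have := h.pos
  omega

/-- If `⌊n / e⌋ ≤ ℓ`, then every submodule of `L` belongs to the Gow filtration. -/
theorem Setting.exists_eq_gowFiltration (h : Setting F ℓ e d ψ) (hn : n / e ≤ ℓ)
    (M : Submodule (ResGroupAlg n F R ℓ) (Reduction n F R ℓ)) :
    ∃ c ≤ blockVal e d ℓ n + 1, M = gowFiltration n F R ℓ c := by
  classical
  have : Fact ℓ.Prime := ⟨h.prime⟩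
  have he : 0 < e := by have := h.two_le; omega
  have hw : ∀ l : List ℕ, l.sum = n → weight e l ≤ n / e := by
    intro l hl
    rw [Nat.le_div_iff_mul_le he, mul_comm, ← hl]
    exact weight_mul_le l
  by_cases hM : M ≤ ⊥
  · exact ⟨_, le_rfl, by rw [h.gowFiltration_eq_bot (Nat.lt_succ_self _), le_bot_iff.mp hM]⟩
  obtain ⟨l₀, hl₀, -⟩ := h.exists_containsType_of_not_le hM
  -- The largest weight occurring in M decides which term of the filtration M is.
  let p : ℕ → Prop := fun i => ∃ l, ContainsType ψ M l ∧ weight e l = i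
  obtain ⟨l₁, hl₁, hi⟩ : p (Nat.findGreatest p (n / e)) :=
    Nat.findGreatest_spec (hw l₀ hl₀.1) ⟨l₀, hl₀, rfl⟩
  have hmax : ∀ l, ContainsType ψ M l → weight e l ≤ weight e l₁ := fun l hl => by
    rw [hi]
    exact Nat.le_findGreatest (hw l hl.1) ⟨l, hl, rfl⟩
  by_cases hbad : ∃ l, ContainsType ψ M l ∧ d * weight e l₁ < totalVal e d ℓ l
  · refine ⟨0, Nat.zero_le _, ?_⟩
    -- A value above d times the weight needs weight at least ℓ. Then n / e = ℓ, the value is the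
    -- maximum d ℓ + 1, and the index of this parabolic subgroup is prime to ℓ. So the one-block
    -- composition also lies in M, and its refinements exhaust L.
    obtain ⟨l, hl, hlt⟩ := hbad
    have h1 := (Nat.mul_le_mul_left d (hmax l hl)).trans_lt hlt
    have h2 : ℓ ≤ weight e l := by
      by_contra! h3
      exact h1.ne' (totalVal_eq_of_weight_lt h3)
    have h3 : n / e = ℓ := le_antisymm hn (h2.trans (hw l hl.1))
    have h4 : blockVal e d ℓ n = d * ℓ + 1 := by rw [blockVal, h3, padicValNat_factorial_self]
    have h5 := h.parabolicVal_add hl.1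
    have h6 := Nat.mul_le_mul_left d h2
    have h7 : ([n] : List ℕ).sum = n := List.sum_singleton
    have h8 := h.parabolicVal_add h7
    have h9 : totalVal e d ℓ [n] = blockVal e d ℓ n := by simp [totalVal]
    have h10 : ContainsType ψ M [n] := by
      refine ⟨h7, eigenvec_mem_of_coarsen h.prime h.maximalIdeal_eq h.isUnit_card h.char_ne_one
        (monotone_blockIdx_comp_val _) (monotone_blockIdx_comp_val _) (fun i j _ => ?_) ?_ hl.2⟩
      · simp [blockIdx]
      · omega
    refine le_antisymm (h.le_of_containsType fun l' hl' => ?_)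
      (h.le_of_containsType fun l' hl' => ?_)
    · rw [h.containsType_gowFiltration_iff]
      have := h.parabolicVal_add hl'.1
      exact ⟨hl'.1, by omega⟩
    · have h11 := (h.isClosedType M).split_sum l' [] [] (by simpa [hl'.1] using h10)
      simpa using h11
  · push Not at hbad
    have h1 : e * weight e l₁ ≤ n := hl₁.1 ▸ weight_mul_le l₁
    have h2 := h.mul_le_blockVal h1
    refine ⟨blockVal e d ℓ n - d * weight e l₁, by omega, le_antisymm
      (h.le_of_containsType fun l hl => ?_) ?_⟩
    · rw [h.containsType_gowFiltration_iff]
      have := hbad l hl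
      exact ⟨hl.1, by omega⟩
    · have h3 := (h.isClosedType M).basicType_of_le_weight h.two_le hl₁ le_rfl
      rw [hl₁.1] at h3
      exact h.gowFiltration_le ((hw l₁ hl₁.1).trans hn) h1 h3

/-- The values `c` at which the first terms of the Gow filtration, starting at `0`, are taken. -/
def chainVal (H d : ℕ) : ℕ → ℕ
  | 0 => H + 1
  | i + 1 => H - d * i

theorem Setting.chainVal_lt (h : Setting F ℓ e d ψ) {i : ℕ} (hi : e * i ≤ n) :
    chainVal (blockVal e d ℓ n) d (i + 1) < chainVal (blockVal e d ℓ n) d i := by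
  have h1 := h.mul_le_blockVal hi
  have h2 := h.one_le
  cases i with
  | zero => simp only [chainVal]; omega
  | succ j =>
    rw [mul_add, mul_one] at h1
    simp only [chainVal, mul_add, mul_one]
    omega

/-- The eigenvector of the basic type with i parts e lies in the larger term and not in the smaller
one. -/
theorem Setting.chain_lt (h : Setting F ℓ e d ψ) {i : ℕ} (hi : e * i ≤ n) {c : ℕ}
    (hc : chainVal (blockVal e d ℓ n) d (i + 1) < c) :
    gowFiltration n F R ℓ c <
      gowFiltration n F R ℓ (chainVal (blockVal e d ℓ n) d (i + 1)) := by
  have h1 := h.mul_le_blockVal hi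
  refine lt_of_le_not_ge (h.gowFiltration_antitone hc.le) fun h2 => ?_
  have h3 := (h.basicType_mem_iff hi (chainVal (blockVal e d ℓ n) d (i + 1))).mpr
    (by simp only [chainVal]; omega)
  have h4 := (h.basicType_mem_iff hi c).mp ⟨h3.1, h2 h3.2⟩
  simp only [chainVal] at hc
  omega

/-- A composition in M outside the i-th term has weight at least i, since for weights below ℓ the
value is exactly d times the weight. Refining it puts the i-th basic type into M, which generates
the next term. -/
theorem Setting.chain_le (h : Setting F ℓ e d ψ) {i : ℕ} (hi : i ≤ ℓ) (hin : e * i ≤ n)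
    {M : Submodule (ResGroupAlg n F R ℓ) (Reduction n F R ℓ)}
    (hM : ¬ M ≤ gowFiltration n F R ℓ (chainVal (blockVal e d ℓ n) d i)) :
    gowFiltration n F R ℓ (chainVal (blockVal e d ℓ n) d (i + 1)) ≤ M := by
  have : Fact ℓ.Prime := ⟨h.prime⟩
  obtain ⟨l, hl, hl'⟩ := h.exists_containsType_of_not_le hM
  rw [h.containsType_gowFiltration_iff] at hl'
  have h1 : i ≤ weight e l := by
    by_contra! h2
    refine hl' ⟨hl.1, ?_⟩
    rw [totalVal_eq_of_weight_lt (h2.trans_le hi)]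
    have h3 := h.mul_le_blockVal hin
    cases i with
    | zero => omega
    | succ j =>
      have h4 := Nat.mul_le_mul_left d (Nat.le_of_lt_succ h2)
      rw [mul_add, mul_one] at h3
      simp only [chainVal]
      omega
  have h2 := (h.isClosedType M).basicType_of_le_weight h.two_le hl h1
  rw [hl.1] at h2
  exact h.gowFiltration_le hi hin h2

/-- The ℓ + 1 largest valuations are H - d i for 0 ≤ i ≤ ℓ. The basic types attain them, and any
valuation at least H - d ℓ comes from a composition whose value is d times its weight. -/
theorem Setting.theta_eq (h : Setting F ℓ e d ψ) (hin : e * ℓ ≤ n)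
    {P : Fin (numPValues n F ℓ) → StdParabolic n F} (hP : StrictAnti fun i => theta ℓ (P i)) :
    ℓ < numPValues n F ℓ ∧
      ∀ i : Fin (numPValues n F ℓ), i.val ≤ ℓ →
        theta ℓ (P i) = chainVal (blockVal e d ℓ n) d (i.val + 1) := by
  have : Fact ℓ.Prime := ⟨h.prime⟩
  have hle : ∀ i ≤ ℓ, e * i ≤ n := fun i hi => (Nat.mul_le_mul_left e hi).trans hin
  refine finEnum_eq_of_strictAnti (c := fun i => chainVal (blockVal e d ℓ n) d (i + 1))
    (Set.finite_range (theta (n := n) (F := F) ℓ)) rfl hP (fun i => ⟨P i, rfl⟩)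
    (fun i j hij hj => ?_) (fun i hi => ?_) ?_
  · have h1 := h.mul_le_blockVal (hle j hj)
    have h2 : d * i < d * j := Nat.mul_lt_mul_of_pos_left hij h.one_le
    simp only [chainVal]
    omega
  · have h1 := h.parabolicVal_add (sum_basicType (hle i hi))
    refine ⟨⟨_, borel_le_parabolic (monotone_blockIdx_comp_val (basicType e n i))⟩, ?_⟩
    rw [theta_parabolic (monotone_blockIdx_comp_val (basicType e n i))]
    rw [totalVal_basicType h.two_le] at h1
    simp only [chainVal]
    omega
  · rintro x ⟨Q, rfl⟩ hx
    obtain ⟨β, hβ, hQ⟩ := exists_parabolicVal_eq_theta (ℓ := ℓ) Q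
    obtain ⟨l, hl, hlβ⟩ := exists_blockIdx_eq hβ
    have h1 : (fun i : Fin n => blockIdx l i) = β := funext hlβ
    have h2 := h.parabolicVal_add hl
    rw [h1, ← hQ] at h2
    simp only [chainVal] at hx ⊢
    have h3 := h.mul_le_blockVal hin
    have h4 : totalVal e d ℓ l ≤ d * ℓ := by omega
    have h5 := totalVal_eq_of_lt (d := d) (lt_of_totalVal_le h4)
    refine ⟨weight e l, Nat.le_of_mul_le_mul_left (h5 ▸ h4) h.one_le, ?_⟩
    omega

theorem exists_setting {p : ℕ} (hℓ : ℓ.Prime) (hℓp : ℓ ≠ p) [CharP F p]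
    (hmax : IsLocalRing.maximalIdeal R = Ideal.span {(ℓ : R)})
    (hζ : ∃ ζ : R, IsPrimitiveRoot ζ p) :
    ∃ (d : ℕ) (ψ : AddChar F R), Setting F ℓ (eNumber (Fintype.card F) ℓ) d ψ := by
  obtain ⟨ζ, hζ⟩ := hζ
  obtain ⟨ψ, hψ⟩ := exists_addChar_ne_one (F := F) hζ
  obtain ⟨k, hp, hk⟩ := FiniteField.card F p
  have hq : ¬ ℓ ∣ Fintype.card F := by
    rw [hk]
    exact fun h1 => hℓp ((Nat.prime_dvd_prime_iff_eq hℓ hp).mp (hℓ.dvd_of_dvd_pow h1))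
  have hq2 : 2 ≤ Fintype.card F := Fintype.one_lt_card
  obtain ⟨d, hd, hval⟩ := exists_glVal_eq hq2 hℓ hq
  exact ⟨d, ψ, hℓ, hmax, hq, hψ, (eNumber_mem hq2 hℓ hq).1, hd, _, hval⟩

end GowFiltration

end Steinberg

theorem theoremA2 (n p ℓ : ℕ) (hn : 2 ≤ n) (hℓ : ℓ.Prime) (hℓp : ℓ ≠ p)
    (F : Type*) [Field F] [Fintype F] [DecidableEq F] [CharP F p]
    (R : Type*) [CommRing R] [IsDomain R] [IsPrincipalIdealRing R] [IsLocalRing R] [CharZero R]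
    (hmax : IsLocalRing.maximalIdeal R = Ideal.span {(ℓ : R)})
    (hζ : ∃ ζ : R, IsPrimitiveRoot ζ p) :
    (n / Steinberg.eNumber (Fintype.card F) ℓ ≤ ℓ →
      IsUniserial (Steinberg.ResGroupAlg n F R ℓ) (Steinberg.Reduction n F R ℓ) ∧
      ∃ s : CompositionSeries
          (Submodule (Steinberg.ResGroupAlg n F R ℓ) (Steinberg.Reduction n F R ℓ)),
        s.head = ⊥ ∧ s.last = ⊤ ∧
        Set.range s = Set.range (fun c : ℕ => Steinberg.gowFiltration n F R ℓ c) ∧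
        ∀ s' : CompositionSeries
            (Submodule (Steinberg.ResGroupAlg n F R ℓ) (Steinberg.Reduction n F R ℓ)),
          s'.head = ⊥ → s'.last = ⊤ → s' = s) ∧
    (ℓ < n / Steinberg.eNumber (Fintype.card F) ℓ →
      ∀ P : Fin (Steinberg.numPValues n F ℓ) → Steinberg.StdParabolic n F,
        StrictAnti (fun i => Steinberg.theta ℓ (P i)) →
        ℓ < Steinberg.numPValues n F ℓ ∧
        (∀ i : Fin (Steinberg.numPValues n F ℓ), (i : ℕ) ≤ ℓ →
          socleSeries (Steinberg.ResGroupAlg n F R ℓ) (Steinberg.Reduction n F R ℓ) (i + 1) =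
              Steinberg.gowFiltration n F R ℓ (Steinberg.theta ℓ (P i)) ∧
          IsSimpleModule (Steinberg.ResGroupAlg n F R ℓ)
            (Steinberg.gowFactor n F R ℓ (Steinberg.theta ℓ (P i)))) ∧
        (∃ s : CompositionSeries
            (Submodule (Steinberg.ResGroupAlg n F R ℓ) (Steinberg.Reduction n F R ℓ)),
          s.length = ℓ + 1 ∧ s.head = ⊥ ∧
          ∀ (i : Fin (Steinberg.numPValues n F ℓ)) (j : Fin (s.length + 1)),
            (j : ℕ) = (i : ℕ) + 1 →
              s j = Steinberg.gowFiltration n F R ℓ (Steinberg.theta ℓ (P i))) ∧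
        (∀ i : Fin (Steinberg.numPValues n F ℓ), (i : ℕ) = ℓ →
          IsUniserial (Steinberg.ResGroupAlg n F R ℓ)
            (Steinberg.gowFiltration n F R ℓ (Steinberg.theta ℓ (P i))) ∧
          Module.length (Steinberg.ResGroupAlg n F R ℓ)
            (Steinberg.gowFiltration n F R ℓ (Steinberg.theta ℓ (P i))) = ℓ + 1)) := by
  obtain ⟨d, ψ, h⟩ := Steinberg.exists_setting (F := F) hℓ hℓp hmax hζ
  generalize Steinberg.eNumber (Fintype.card F) ℓ = e at h ⊢
  set H := Steinberg.blockVal e d ℓ n with hH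
  refine ⟨fun hN => ?_, fun hN P hP => ?_⟩
  · have hall := h.exists_eq_gowFiltration (n := n) hN
    have hU : IsUniserial (Steinberg.ResGroupAlg n F R ℓ) (Steinberg.Reduction n F R ℓ) := by
      intro N₁ N₂
      obtain ⟨c₁, -, rfl⟩ := hall N₁
      obtain ⟨c₂, -, rfl⟩ := hall N₂
      rcases le_total c₁ c₂ with hc | hc
      · exact Or.inr (h.gowFiltration_antitone hc)
      · exact Or.inl (h.gowFiltration_antitone hc)
    have hrange : Set.range (fun c : ℕ => Steinberg.gowFiltration n F R ℓ c) = Set.univ :=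
      Set.eq_univ_of_forall fun M => (hall M).elim fun c hc => ⟨c, hc.2.symm⟩
    -- The terms with c ≤ H + 1 already exhaust all submodules.
    have hfin : Finite
        (Submodule (Steinberg.ResGroupAlg n F R ℓ) (Steinberg.Reduction n F R ℓ)) := by
      refine Set.finite_univ_iff.mp (((Set.finite_Iic (H + 1)).image
        (Steinberg.gowFiltration n F R ℓ)).subset fun M _ => ?_)
      obtain ⟨c, hc, rfl⟩ := hall M
      exact ⟨c, hc, rfl⟩
    obtain ⟨s, h0, h1, hs, huniq⟩ := Steinberg.exists_unique_compositionSeries hU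
    exact ⟨hU, s, h0, h1, by rw [hs, hrange], huniq⟩
  · have he : 0 < e := by have := h.two_le; omega
    have hin : ∀ i < ℓ + 1, e * i ≤ n := fun i hi =>
      (Nat.mul_le_mul_left e (by omega)).trans (Nat.mul_div_le n e)
    obtain ⟨hV, hθ⟩ := h.theta_eq (hin ℓ (Nat.lt_succ_self ℓ)) hP
    -- The chain starts at X 0 = L(H + 1) = 0, so the term for P i is X (i + 1).
    let X : ℕ → Submodule (Steinberg.ResGroupAlg n F R ℓ) (Steinberg.Reduction n F R ℓ) :=
      fun i => Steinberg.gowFiltration n F R ℓ (Steinberg.chainVal H d i)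
    have h0 : X 0 = ⊥ := h.gowFiltration_eq_bot (Nat.lt_succ_self _)
    have hlt : ∀ i < ℓ + 1, X i < X (i + 1) := fun i hi =>
      h.chain_lt (hin i hi) (h.chainVal_lt (hin i hi))
    have hmin : ∀ i < ℓ + 1, ∀ N, ¬ N ≤ X i → X (i + 1) ≤ N := fun i hi N =>
      h.chain_le (Nat.le_of_lt_succ hi) (hin i hi)
    have hcov : ∀ i < ℓ + 1, X i ⋖ X (i + 1) := fun i => Steinberg.covBy_of_forall_le hlt hmin
    refine ⟨hV, fun i hi => ?_, ?_, fun i hi => ?_⟩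
    · rw [hθ i hi]
      have hi' := Nat.lt_succ_of_le hi
      refine ⟨Steinberg.socleSeries_eq_of_forall_le h0 hlt hmin hi', ?_⟩
      -- The filtration is constant between consecutive values of the chain: L(c_i + 1) is properly
      -- below X (i + 1), so it lies in X i, and it contains X i by monotonicity.
      have h1 : Steinberg.gowFiltration n F R ℓ (Steinberg.chainVal H d (i + 1) + 1) = X i := by
        refine le_antisymm ?_ (h.gowFiltration_antitone (h.chainVal_lt (hin i hi')))
        by_contra h2
        exact (h.chain_lt (hin i hi') (Nat.lt_succ_self _)).not_ge (hmin i hi' _ h2)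
      have h2 := (covBy_iff_quot_is_simple (hcov i hi').le).mp (hcov i hi')
      rw [← h1] at h2
      exact h2
    · refine ⟨⟨ℓ + 1, fun j => X j, fun j => hcov j j.2⟩, rfl, h0, fun i j hij => ?_⟩
      have hj : j.val < ℓ + 1 + 1 := j.2
      rw [hθ i (by omega), ← hij]
    · rw [hθ i hi.le, hi]
      refine ⟨Steinberg.isUniserial_of_forall_le (X := X) h0 hlt hmin, ?_⟩
      rw [Steinberg.length_eq_of_covBy (X := X) h0 hcov le_rfl, Nat.cast_succ]
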